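/- **Setting.** An MDP has measurable state and action spaces, transition kernel $\mathcal P$, initial law $\rho$, rewards $\mathcal R(s,a)\in[0,R]$ with $R>0$, discount $\gamma\in(0,1)$ and horizon $H\ge 1$. A policy $\pi_\theta(a\mid s)>0$, $\theta\in\mathbb R^d$, is a density with respect to a reference measure on the actions. Let $p(\cdot\mid\theta)$ be the induced law of trajectories $\tau=(s_h,a_h)_{h<H}$, let $J(\theta)=\mathbb E_{\tau\sim p(\cdot\mid\theta)}\big[\sum_{h<H}\gamma^h\mathcal R(s_h,a_h)\big]$ and $J^*=\sup_\theta J(\theta)$. Let $g(\tau\mid\theta)$ be the REINFORCE estimator $\big(\sum_h\gamma^h\mathcal R(s_h,a_h)-b\big)\sum_h\nabla_\theta\log\pi_\theta(a_h\mid s_h)$ or the GPOMDP estimator $\sum_h\big(\gamma^h\mathcal R(s_h,a_h)-b_h\big)\sum_{u\le h}\nabla_\theta\log\pi_\theta(a_u\mid s_u)$ with constant baselines $b$, $b_h$. For $\omega(\tau\mid\theta_b,\theta_a)=p(\tau\mid\theta_a)/p(\tau\mid\theta_b)$ put $g^{\omega_{\theta_b}}(\tau\mid\theta_a)=\omega(\tau\mid\theta_b,\theta_a)\,g(\tau\mid\theta_a)$.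 **Assumptions.** For constants $G,M,\sigma,W>0$ and all $\theta,\theta_a,\theta_b,s,a$: $\|\nabla_\theta\log\pi_\theta(a\mid s)\|\le G$; $\pi_\theta(a\mid s)$ is twice differentiable in $\theta$ and $\|\nabla^2_\theta\log\pi_\theta(a\mid s)\|\le M$; $\mathbb E_{p(\cdot\mid\theta)}\|g(\tau\mid\theta)-\nabla J(\theta)\|^2\le\sigma^2$; $\operatorname{Var}_{\tau\sim p(\cdot\mid\theta_b)}[\omega(\tau\mid\theta_b,\theta_a)]\le W\|\theta_a-\theta_b\|^2$. Let $L=HR(M+HG^2)/(1-\gamma)$. **Agents.** There are $K\ge1$ agents. The set $\mathcal H_t\subseteq[K]$ of honest agents in iteration $t$ has $|\mathcal H_t|\ge(1-\alpha)K$, where $\alpha\ge0$, $\bar\epsilon>0$ and $\bar\alpha:=\alpha+\bar\epsilon<1/4$. A Byzantine agent may send arbitrary messages, different ones to different agents, depending on everything that has happened so far; it does not corrupt its own local computation. **Subroutines.** (i) A measurable map $\mathrm{Agg}:(\mathbb R^d)^K\to\mathbb R^d$ that is an $(\alpha,C_{ra})$-robust aggregator: for all random inputs $x$ and all $\mathcal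 H\subseteq[K]$ with $|\mathcal H|\ge(1-\alpha)K$, $$\mathbb E\Big\|\mathrm{Agg}(x)-\tfrac1{|\mathcal H|}\sum_{i\in\mathcal H}x_i\Big\|^2\le\frac{C_{ra}\,\alpha}{|\mathcal H|(|\mathcal H|-1)}\sum_{i,l\in\mathcal H}\mathbb E\|x_i-x_l\|^2 .$$ (ii) A synchronous (measurable) message-passing protocol Avg-Agree$_\kappa$ of $\kappa$ rounds with $C_{avg}$-averaging agreement: for every input $x$, every honest set $\mathcal H$ with $|\mathcal H|\ge(1-\alpha)K$, all Byzantine messages, and every $\mathcal G\subseteq\mathcal H$ with $|\mathcal G|\ge(1-\bar\alpha)K$, the outputs $\hat x$ satisfy $$\max_{i,l\in\mathcal G}\|\hat x_i-\hat x_l\|\le2^{-\kappa}\max_{i,l\in\mathcal G}\|x_i-x_l\|,\qquad \Big\|\tfrac1{|\mathcal G|}\sum_{i\in\mathcal G}\hat x_i-\tfrac1{|\mathcal G|}\sum_{i\in\mathcal G}x_i\Big\|\le C_{avg}\max_{i,l\in\mathcal G}\|x_i-x_l\| .$$ Moreover, either no agent turns from Byzantine to honest during the run ($\mathcal H_{t+1}\subseteq\mathcal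 H_t$), or the local outputs of all agents, also of those that are Byzantine, contract: $\max_{i,l\in[K]}\|\hat x_i-\hat x_l\|\le2^{-\kappa}\max_{i,l\in\mathcal H}\|x_i-x_l\|$. **Algorithm (DecByzPG).** Input: $\theta_0$, batch sizes $N,B\ge1$, step size $\eta$, $p\in(0,1]$; $\theta_0^{(k)}=\theta_0$. For $t=0,\dots,T-1$: draw a common coin $c_t\sim\mathrm{Be}(p)$. Agent $k$ draws $m$ independent trajectories $\tau_i$ from $p(\cdot\mid\theta_t^{(k)})$, where $m=N$ if $c_t=1$ or $t=0$, and $m=B$ otherwise, and forms $\tilde v_t^{(k)}=\frac1N\sum_{i\le N}g(\tau_i\mid\theta_t^{(k)})$ in the first case and $$\tilde v_t^{(k)}=\frac1B\sum_{i\le B}g(\tau_i\mid\theta_t^{(k)})+\frac1\eta\big(\theta_t^{(k)}-\theta_{t-1}^{(k)}\big)-\frac1B\sum_{i\le B}g^{\omega_{\theta_t^{(k)}}}(\tau_i\mid\theta_{t-1}^{(k)})$$ in the second. The agents exchange these vectors. Each agent applies $\mathrm{Agg}$ to what it received, obtaining $v_t^{(k)}$, and sets $\tilde\theta_{t+1}^{(k)}=\theta_t^{(k)}+\eta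 v_t^{(k)}$. Then $(\theta_{t+1}^{(k)})_k$ is the output of Avg-Agree$_\kappa$ on $(\tilde\theta_{t+1}^{(k)})_k$. Finally $\hat T$ is drawn uniformly from $\{0,\dots,T-1\}$, independently of the run, and agent $k$ outputs $\theta^{(k)}_{\hat T}$. **Theorem.** There are constants $c_A,c_\kappa,C,C'>0$, depending only on $H,R,\gamma,G,M,\sigma,W,C_{ra},C_{avg},\bar\epsilon$ and the choice of $g$ with its baselines, such that the following holds in the above setting. Let $A\ge c_A\big(\frac{\alpha}{p^2}+\frac1{pK}\big)$, $\eta=\frac12\min\{\frac1{\sqrt A},\frac1L\}$ and $\kappa\ge c_\kappa\log\frac{NK}{p^2}$ (so the orders $A=\Theta(\frac{\alpha}{p^2}+\frac1{pK})$ and $\kappa=\Theta(\log\frac{NK}{p^2})$ are admissible, with large enough constants). Then for every $T\ge1$ there is $\mathcal G\subseteq[K]$ with $|\mathcal G|\ge(1-\bar\alpha)K$ such that for all $k\in\mathcal G$ the following expectation exists and $$\mathbb E\big\|\nabla J(\theta^{(k)}_{\hat T})\big\|^2\le\frac{4\,\mathbb E[\Phi_0]}{\eta T}+\frac{C\sigma^2}{N}\Big(\alpha+\frac1K\Big)+C'\,2^{-\kappa},$$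 where $\Phi_0=J^*-J(\theta_0)+\frac{2\eta}{p}\Big\|\frac1K\sum_{k\in[K]}\frac1\eta\big(\theta_1^{(k)}-\theta_0^{(k)}\big)-\nabla J(\theta_0)\Big\|^2$. If the norm term in $\Phi_0$ is not integrable, the bound holds also with that term dropped. -/

import Mathlib

open MeasureTheory ProbabilityTheory
open scoped ENNReal

namespace DecByzPG

noncomputable section

/-! ### Reinforcement learning -/

/-- The parameter space, real `d`-space with the Euclidean norm. -/
abbrev Param (d : ℕ) : Type := EuclideanSpace ℝ (Fin d)

/-- A Markov decision process on measurable state and action spaces, with transition dynamics,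
initial distribution, and rewards in `[0, R]`. Horizon and discount factor are kept separate. -/
structure MDP (S A : Type*) [MeasurableSpace S] [MeasurableSpace A] (R : ℝ) where
  trans : Kernel (S × A) S
  [markov_trans : IsMarkovKernel trans]
  rho : Measure S
  [prob_rho : IsProbabilityMeasure rho]
  reward : S → A → ℝ
  measurable_reward : Measurable (Function.uncurry reward)
  reward_nonneg : ∀ s a, 0 ≤ reward s a
  reward_le : ∀ s a, reward s a ≤ R

attribute [instance] MDP.markov_trans MDP.prob_rho

/-- A parametrized stochastic policy: `dens θ s a` is the probability density (with respect to a
reference measure on the actions: counting measure, Lebesgue measure, ...) of choosing `a` at `s`.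
It is positive, so that its logarithm and all importance weights are well-defined. -/
structure Policy (S A : Type*) [MeasurableSpace S] [MeasurableSpace A] (d : ℕ) where
  ref : Measure A
  [sigmaFinite_ref : SigmaFinite ref]
  dens : Param d → S → A → ℝ
  dens_pos : ∀ θ s a, 0 < dens θ s a
  measurable_dens : ∀ θ, Measurable (Function.uncurry (dens θ))
  lintegral_dens : ∀ θ s, ∫⁻ a, ENNReal.ofReal (dens θ s a) ∂ref = 1

attribute [instance] Policy.sigmaFinite_ref

/-- Trajectories `(s₀, a₀), …, (s_{Hz-1}, a_{Hz-1})` of length `Hz`. -/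
abbrev Traj (S A : Type*) (Hz : ℕ) := Fin Hz → S × A

section RL

variable {S A : Type*} [MeasurableSpace S] [MeasurableSpace A] {R : ℝ} {d Hz : ℕ}

/-- The action kernel `s ↦ π_θ(· | s)`. -/
def Policy.kernel (pol : Policy S A d) (θ : Param d) : Kernel S A :=
  Kernel.withDensity (Kernel.const S pol.ref) (fun s a => ENNReal.ofReal (pol.dens θ s a))

/-- The law of the trajectory of length `n` started at a given state: draw `a ∼ π_θ(· | s)`, then
the next state from the transition dynamics, and continue from there. -/
def trajKernel (mdp : MDP S A R) (pol : Policy S A d) (θ : Param d) :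
    (n : ℕ) → Kernel S (Traj S A n)
  | 0 => Kernel.const S (Measure.dirac Fin.elim0)
  | n + 1 =>
    (Kernel.id ×ₖ (pol.kernel θ ⊗ₖ (trajKernel mdp pol θ n ∘ₖ mdp.trans))).map
      (fun x : S × (A × Traj S A n) => (Fin.cons (x.1, x.2.1) x.2.2 : Traj S A (n + 1)))

/-- The trajectory distribution `p(· | θ)` for the horizon `Hz`. -/
def trajLaw (mdp : MDP S A R) (pol : Policy S A d) (Hz : ℕ) (θ : Param d) :
    Measure (Traj S A Hz) :=
  mdp.rho.bind (trajKernel mdp pol θ Hz)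

/-- The discounted cumulative reward of a trajectory. -/
def MDP.totalReward (mdp : MDP S A R) (γ : ℝ) (τ : Traj S A Hz) : ℝ :=
  ∑ h : Fin Hz, γ ^ (h : ℕ) * mdp.reward (τ h).1 (τ h).2

/-- The objective `J`. -/
def objective (mdp : MDP S A R) (pol : Policy S A d) (γ : ℝ) (Hz : ℕ) (θ : Param d) : ℝ :=
  ∫ τ, mdp.totalReward γ τ ∂(trajLaw mdp pol Hz θ)

/-- The score `∇_θ log π_θ(a | s)`. -/
def Policy.score (pol : Policy S A d) (s : S) (a : A) (θ : Param d) : Param d :=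
  gradient (fun θ' => Real.log (pol.dens θ' s a)) θ

/-- The gradient estimators: REINFORCE with a baseline, and GPOMDP with one baseline per step. -/
inductive Estimator (Hz : ℕ) where
  | reinforce (b : ℝ) : Estimator Hz
  | gpomdp (b : Fin Hz → ℝ) : Estimator Hz

/-- The estimate `g(τ | θ)` of the gradient of `J`. -/
def Estimator.grad (est : Estimator Hz) (mdp : MDP S A R) (pol : Policy S A d) (γ : ℝ)
    (τ : Traj S A Hz) (θ : Param d) : Param d :=
  match est with
  | .reinforce b =>
      (mdp.totalReward γ τ - b) • ∑ h : Fin Hz, pol.score (τ h).1 (τ h).2 θ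
  | .gpomdp b =>
      ∑ h : Fin Hz, (γ ^ (h : ℕ) * mdp.reward (τ h).1 (τ h).2 - b h) •
        ∑ u ∈ Finset.Iic h, pol.score (τ u).1 (τ u).2 θ

/-- The importance weight `p(τ | θa) / p(τ | θb)` of a trajectory drawn at `θb`; the factors of the
initial distribution and of the dynamics cancel. -/
def Policy.impWeight (pol : Policy S A d) (θb θa : Param d) (τ : Traj S A Hz) : ℝ :=
  ∏ h : Fin Hz, pol.dens θa (τ h).1 (τ h).2 / pol.dens θb (τ h).1 (τ h).2

/-- The four standing assumptions on the policy class: bounded score, twice differentiable with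
bounded Hessian of the log-policy, bounded variance of the gradient estimator, and bounded variance
of the importance weights. -/
structure Assumptions (mdp : MDP S A R) (pol : Policy S A d) (γ : ℝ) (est : Estimator Hz)
    (G M σ W : ℝ) : Prop where
  score_le : ∀ θ s a, ‖pol.score s a θ‖ ≤ G
  differentiable : ∀ s a, Differentiable ℝ (fun θ => pol.dens θ s a)
  differentiable_gradient : ∀ s a, Differentiable ℝ (gradient (fun θ => pol.dens θ s a))
  hessian_le : ∀ θ s a, ‖fderiv ℝ (pol.score s a) θ‖ ≤ M
  variance_le : ∀ θ, ∫⁻ τ, ‖est.grad mdp pol γ τ θ - gradient (objective mdp pol γ Hz) θ‖ₑ ^ 2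
      ∂(trajLaw mdp pol Hz θ) ≤ ENNReal.ofReal (σ ^ 2)
  impWeight_le : ∀ θa θb : Param d,
    evariance (pol.impWeight θb θa : Traj S A Hz → ℝ) (trajLaw mdp pol Hz θb)
      ≤ ENNReal.ofReal (W * ‖θa - θb‖ ^ 2)

end RL

/-- The smoothness constant `L` of the objective. -/
def smoothConst (Hz : ℕ) (R γ G M : ℝ) : ℝ := Hz * R * (M + Hz * G ^ 2) / (1 - γ)

/-! ### Robust aggregation and averaging agreement -/

/-- The average of the vectors with index in `s`. -/
def avg {K d : ℕ} (s : Finset (Fin K)) (x : Fin K → Param d) : Param d :=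
  (s.card : ℝ)⁻¹ • ∑ i ∈ s, x i

/-- `(α, C)`-robust aggregators. The expectations are over the randomness of the input, which has an
arbitrary law `μ`. -/
def RobustAggregator {K d : ℕ} (α C : ℝ) (agg : (Fin K → Param d) → Param d) : Prop :=
  ∀ (μ : Measure (Fin K → Param d)) [IsProbabilityMeasure μ] (Hon : Finset (Fin K)),
    (1 - α) * K ≤ Hon.card →
    ∫⁻ x, ‖agg x - avg Hon x‖ₑ ^ 2 ∂μ ≤
      ENNReal.ofReal (C * α / (Hon.card * (Hon.card - 1))) *
        ∑ i ∈ Hon, ∑ l ∈ Hon, ∫⁻ x, ‖x i - x l‖ₑ ^ 2 ∂μ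

/-- What agent `k` receives from agent `i` in a round of all-to-all communication. `honest i k` is
the message that the algorithm prescribes. A Byzantine `i` may send anything, and different things
to different agents, but it cannot alter its own local information. -/
def receive {K : ℕ} {Msg : Type*} (Hon : Finset (Fin K)) (honest byz : Fin K → Fin K → Msg)
    (k i : Fin K) : Msg :=
  if i ∈ Hon ∨ i = k then honest i k else byz i k

/-- A round-based synchronous protocol among `K` agents, each of which holds an input vector and
computes an output vector. `send i s k` is the message from `i`, in local state `s`, to `k`. -/
structure Protocol.{u} (K d : ℕ) where
  State : Type u
  Msg : Type u
  [measurableSpace_state : MeasurableSpace State]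
  [measurableSpace_msg : MeasurableSpace Msg]
  start : Fin K → Param d → State
  send : Fin K → State → Fin K → Msg
  update : Fin K → State → (Fin K → Msg) → State
  output : Fin K → State → Param d
  measurable_start : ∀ k, Measurable (start k)
  measurable_send : ∀ i k, Measurable (fun s => send i s k)
  measurable_update : ∀ k, Measurable (Function.uncurry (update k))
  measurable_output : ∀ k, Measurable (output k)

attribute [instance] Protocol.measurableSpace_state Protocol.measurableSpace_msg

namespace Protocol

variable {K d : ℕ} (proto : Protocol K d)

/-- The local states after `r` rounds; `byz r i k` is the message which `i`, if Byzantine, sends to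
`k` in round `r`. -/
def states (Hon : Finset (Fin K)) (byz : ℕ → Fin K → Fin K → proto.Msg) (x : Fin K → Param d) :
    ℕ → Fin K → proto.State
  | 0 => fun k => proto.start k (x k)
  | r + 1 => fun k => proto.update k (states Hon byz x r k)
      (receive Hon (fun i k' => proto.send i (states Hon byz x r i) k') (byz r) k)

/-- The outputs after `κ` rounds. -/
def run (κ : ℕ) (Hon : Finset (Fin K)) (byz : ℕ → Fin K → Fin K → proto.Msg)
    (x : Fin K → Param d) (k : Fin K) : Param d :=
  proto.output k (proto.states Hon byz x κ k)

/-- `C`-averaging agreement of the protocol when run for `κ` rounds: for any input, any set of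
honest agents, any Byzantine messages, and any large enough set `𝒢` of honest agents. -/
def AveragingAgreement (κ : ℕ) (α αbar C : ℝ) : Prop :=
  ∀ (Hon : Finset (Fin K)), (1 - α) * K ≤ Hon.card →
  ∀ (byz : ℕ → Fin K → Fin K → proto.Msg) (x : Fin K → Param d) (𝒢 : Finset (Fin K)),
    𝒢 ⊆ Hon → (1 - αbar) * K ≤ 𝒢.card →
    Metric.diam (proto.run κ Hon byz x '' 𝒢) ≤ Metric.diam (x '' 𝒢) / 2 ^ κ ∧
    ‖avg 𝒢 (proto.run κ Hon byz x) - avg 𝒢 x‖ ≤ C * Metric.diam (x '' 𝒢)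

/-- The contraction also covers the values computed locally by agents that send wrong messages
(whose local computation is not corrupted). -/
def CoversAllAgents (κ : ℕ) (α : ℝ) : Prop :=
  ∀ (Hon : Finset (Fin K)), (1 - α) * K ≤ Hon.card →
  ∀ (byz : ℕ → Fin K → Fin K → proto.Msg) (x : Fin K → Param d),
    Metric.diam (Set.range (proto.run κ Hon byz x)) ≤ Metric.diam (x '' Hon) / 2 ^ κ

end Protocol

/-! ### The algorithm -/

/-- The input data of the algorithm: large and small batch size, step size, switching probability,
number of agreement rounds, common starting point. -/
structure Input (d : ℕ) where
  N : ℕ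
  B : ℕ
  η : ℝ
  p : ℝ
  κ : ℕ
  θ₀ : Param d

/-- The batch size in iteration `t` if the common coin shows `c`. -/
def Input.batch {d : ℕ} (inp : Input d) (t : ℕ) (c : Bool) : ℕ :=
  if c = true ∨ t = 0 then inp.N else inp.B

section Algorithm

variable {S A : Type*} [MeasurableSpace S] [MeasurableSpace A] {R : ℝ} {d Hz K : ℕ}

/-- The local estimate of an agent in iteration `t`, from the coin `c`, the sampled trajectories `τ`
(of which the first `N` or `B` are used), and the current and the previous local parameters. -/
def localEstimate (mdp : MDP S A R) (pol : Policy S A d) (γ : ℝ) (est : Estimator Hz)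
    (inp : Input d) (t : ℕ) (c : Bool) (τ : ℕ → Traj S A Hz) (θ θprev : Param d) : Param d :=
  if c = true ∨ t = 0 then
    (inp.N : ℝ)⁻¹ • ∑ i ∈ Finset.range inp.N, est.grad mdp pol γ (τ i) θ
  else
    (inp.B : ℝ)⁻¹ • ∑ i ∈ Finset.range inp.B, est.grad mdp pol γ (τ i) θ
      + inp.η⁻¹ • (θ - θprev)
      - (inp.B : ℝ)⁻¹ • ∑ i ∈ Finset.range inp.B,
          pol.impWeight θ θprev (τ i) • est.grad mdp pol γ (τ i) θprev

/-- A run of `T` iterations of the decentralized algorithm against an arbitrary adversary.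

`ℱ t` is all that has happened before iteration `t`. In iteration `t`, a common coin is drawn, and
every agent samples trajectories at its local parameters. `gradMsg t i k` and `agreeMsg t r i k` are
the vector and the agreement message of round `r` that `i` sends to `k` if `i` is Byzantine; these
may depend on everything that has happened so far, including all samples of iteration `t`. -/
structure Run {Ω : Type*} [mΩ : MeasurableSpace Ω] (P : Measure Ω)
    (mdp : MDP S A R) (pol : Policy S A d) (γ : ℝ) (est : Estimator Hz) (inp : Input d)
    (agg : (Fin K → Param d) → Param d) (proto : Protocol K d)
    (Hon : ℕ → Finset (Fin K)) (T : ℕ) where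
  ℱ : Filtration ℕ mΩ
  coin : ℕ → Ω → Bool
  traj : ℕ → Fin K → ℕ → Ω → Traj S A Hz
  gradMsg : ℕ → Fin K → Fin K → Ω → Param d
  agreeMsg : ℕ → ℕ → Fin K → Fin K → Ω → proto.Msg
  θ : ℕ → Fin K → Ω → Param d
  measurable_coin : ∀ t < T, Measurable[ℱ (t + 1)] (coin t)
  measurable_traj : ∀ t < T, ∀ k i, Measurable[ℱ (t + 1)] (traj t k i)
  measurable_gradMsg : ∀ t < T, ∀ i k, Measurable[ℱ (t + 1)] (gradMsg t i k)
  measurable_agreeMsg : ∀ t < T, ∀ r i k, Measurable[ℱ (t + 1)] (agreeMsg t r i k)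
  measurable_θ : ∀ t ≤ T, ∀ k, Measurable[ℱ t] (θ t k)
  /-- Given the past, the coin shows `true` with probability `p`, and given also the coin, the
  trajectories in the batches are independent with laws `p(· | θ t k)`. -/
  law : ∀ t < T, ∀ F : Set Ω, MeasurableSet[ℱ t] F → ∀ (c : Bool)
    (U : Set (Fin K → Fin (inp.batch t c) → Traj S A Hz)), MeasurableSet U →
    P (F ∩ {ω | coin t ω = c ∧ (fun k (i : Fin (inp.batch t c)) => traj t k i ω) ∈ U}) =
      ENNReal.ofReal (if c = true then inp.p else 1 - inp.p) *
        ∫⁻ ω in F, Measure.pi (fun k => Measure.pi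
          (fun _ : Fin (inp.batch t c) => trajLaw mdp pol Hz (θ t k ω))) U ∂P
  start : ∀ k ω, θ 0 k ω = inp.θ₀
  /-- Exchange of the local estimates, aggregation, local step, averaging agreement. For `t = 0` the
  previous parameters `θ (t - 1)` are not used. -/
  step : ∀ t < T, ∀ k ω, θ (t + 1) k ω =
    proto.run inp.κ (Hon t) (fun r i k' => agreeMsg t r i k' ω)
      (fun k' => θ t k' ω + inp.η • agg (receive (Hon t)
        (fun i _ => localEstimate mdp pol γ est inp t (coin t ω) (fun j => traj t i j ω)
          (θ t i ω) (θ (t - 1) i ω))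
        (fun i k'' => gradMsg t i k'' ω) k')) k

variable {Ω : Type*} [MeasurableSpace Ω] {P : Measure Ω}
  {mdp : MDP S A R} {pol : Policy S A d} {γ : ℝ} {est : Estimator Hz} {inp : Input d}
  {agg : (Fin K → Param d) → Param d} {proto : Protocol K d}
  {Hon : ℕ → Finset (Fin K)} {T : ℕ}

/-- The realized gradient estimate of agent `k` in iteration `0`. -/
def Run.realized₀ (run : Run P mdp pol γ est inp agg proto Hon T) (k : Fin K) (ω : Ω) : Param d :=
  inp.η⁻¹ • (run.θ 1 k ω - run.θ 0 k ω)

/-- The expectation of `Φ₀`, that is, of `J* - J(θ₀) + (2η/p) ‖(1/K) ∑ₖ v̂₀⁽ᵏ⁾ - ∇J(θ₀)‖²`, where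
`J*` is the supremum of `J` (which is bounded). -/
def Run.expectedPhi₀ (run : Run P mdp pol γ est inp agg proto Hon T) : ℝ :=
  (⨆ θ, objective mdp pol γ Hz θ) - objective mdp pol γ Hz inp.θ₀
    + 2 * inp.η / inp.p * ∫ ω, ‖avg Finset.univ (fun k => run.realized₀ k ω)
        - gradient (objective mdp pol γ Hz) inp.θ₀‖ ^ 2 ∂P

end Algorithm

end

end DecByzPG

open MeasureTheory ProbabilityTheory
open scoped ENNReal

namespace DecByzPG

noncomputable section

section TrajectoryLaw

variable {S A : Type*} [MeasurableSpace S] [MeasurableSpace A] {R : ℝ} {d Hz : ℕ}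

/-! ### The law of trajectories -/

/-! The analysis follows one virtual iterate, the honest average `x_t` (`Run.center`), with realized
direction `u_t = (x_{t+1} - x_t)/η` (`Run.drift`) and error `e_t = u_t - ∇J(x_t)` (`Run.gradError`).
Since `J` is smooth with constant `L` and `ηL ≤ 1/2`, every step satisfies `J(x_{t+1}) ≥ J(x_t) +
η/2 ‖∇J(x_t)‖² - η/2 ‖e_t‖² + η/4 ‖u_t‖²` (`objective_ascent`). It remains to show that the summed
second moments of `e_t` are a stationary noise level plus something that the terms `η/4 ‖u_t‖²`
absorb.

The correction `(θ_t - θ_{t-1})/η` in the local estimate makes this possible. It records what the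
agents really did, including the harm done by aggregation and agreement. Hence, on the outcome "no
restart" of the coin, the conditional mean of an estimate is close to `∇J(x_t) + e_{t-1}`: the old
error is carried over and only fresh noise is added, whose variance is of order `η² ‖u_{t-1}‖²` up
to the disagreement of the agents. On the outcome "restart" the old error is forgotten. Splitting
noise from bias by Young's inequality with weight `p/2` gives the contraction factor `1 - p/2` per
iteration and costs a factor `3/p` on the bias (`change_bound`, `fresh_bound`, `succ_bound`). The
averaged noise contributes `1/K`. The aggregation bias contributes `α/p`. Summing the geometric
recursion costs one more factor `1/p`, which is why the step size must resolve `α/p² + 1/(pK)`.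

Aggregation is controlled path by path: the robustness hypothesis holds for Dirac laws, so it holds
for every realized input, whatever the adversary has seen (`RobustAggregator.norm_sub_le`). The
agents' aggregates therefore differ from the honest average by at most a multiple of the spread of
the honest estimates, and agreement multiplies the resulting disagreement by `δ ≤ 2^{-κ}`
(`step_bounds`). This gives a scalar process `Run.spread` that dominates all distances between
tracked agents; its second moment is of order `δ²` times drift and noise, and logarithmically many
rounds make it negligible even after division by `p²`.

The probabilistic input is that trajectory laws at different parameters have the importance weight
as density (`trajLaw_eq_withDensity`). It yields the gradient formula, the unbiasedness of both
estimators and the smoothness of `J` by differentiation under a fixed law. The sampling law of a run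
turns this into moment bounds conditional on past and coin (`integral_coin_le`). The scalar
recursions are solved together in `sum_le_of_recursions`, and the independent uniform time converts
the sum over iterations into an expectation. -/

lemma Policy.measurable_ofReal_dens (pol : Policy S A d) (θ : Param d) :
    Measurable (Function.uncurry fun s a => ENNReal.ofReal (pol.dens θ s a)) :=
  (pol.measurable_dens θ).ennreal_ofReal

lemma Policy.lintegral_kernel (pol : Policy S A d) (θ : Param d) (s : S) {f : A → ℝ≥0∞}
    (hf : Measurable f) :
    ∫⁻ a, f a ∂(pol.kernel θ s) = ∫⁻ a, ENNReal.ofReal (pol.dens θ s a) * f a ∂pol.ref := by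
  rw [Policy.kernel, Kernel.lintegral_withDensity _ (pol.measurable_ofReal_dens θ) s hf]
  rfl

instance (pol : Policy S A d) (θ : Param d) : IsMarkovKernel (pol.kernel θ) := by
  refine ⟨fun s => ⟨?_⟩⟩
  rw [Policy.kernel, Kernel.withDensity_apply' _ (pol.measurable_ofReal_dens θ)]
  simpa using pol.lintegral_dens θ s

lemma measurable_cons {X : Type*} [MeasurableSpace X] (n : ℕ) :
    Measurable (fun q : X × (Fin n → X) => (Fin.cons q.1 q.2 : Fin (n + 1) → X)) := by
  refine measurable_pi_iff.2 fun i => ?_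
  refine Fin.cases ?_ (fun j => ?_) i
  · simpa using measurable_fst
  · simp only [Fin.cons_succ]
    exact (measurable_pi_apply j).comp measurable_snd

lemma measurable_trajCons (n : ℕ) :
    Measurable (fun x : S × (A × Traj S A n) =>
      (Fin.cons (x.1, x.2.1) x.2.2 : Traj S A (n + 1))) :=
  (measurable_cons n).comp
    ((measurable_fst.prodMk measurable_snd.fst).prodMk measurable_snd.snd)

instance isMarkovKernel_trajKernel (mdp : MDP S A R) (pol : Policy S A d) (θ : Param d) :
    ∀ n, IsMarkovKernel (trajKernel mdp pol θ n)
  | 0 => by unfold trajKernel; infer_instance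
  | n + 1 => by
    have := isMarkovKernel_trajKernel mdp pol θ n
    unfold trajKernel
    exact Kernel.IsMarkovKernel.map _ (measurable_trajCons n)

instance (mdp : MDP S A R) (pol : Policy S A d) (θ : Param d) :
    IsProbabilityMeasure (trajLaw mdp pol Hz θ) := by
  unfold trajLaw; infer_instance

lemma lintegral_trajKernel_succ (mdp : MDP S A R) (pol : Policy S A d) (θ : Param d) (n : ℕ)
    (s : S) {f : Traj S A (n + 1) → ℝ≥0∞} (hf : Measurable f) :
    ∫⁻ τ, f τ ∂(trajKernel mdp pol θ (n + 1) s) =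
      ∫⁻ a, ENNReal.ofReal (pol.dens θ s a) *
        ∫⁻ s', ∫⁻ τ, f (Fin.cons (s, a) τ) ∂(trajKernel mdp pol θ n s') ∂(mdp.trans (s, a))
          ∂pol.ref := by
  have hF : Measurable (fun x : S × (A × Traj S A n) =>
      f (Fin.cons (x.1, x.2.1) x.2.2 : Traj S A (n + 1))) := hf.comp (measurable_trajCons n)
  have hF' : Measurable (fun x : A × Traj S A n =>
      f (Fin.cons (s, x.1) x.2 : Traj S A (n + 1))) := hF.comp measurable_prodMk_left
  rw [trajKernel, Kernel.lintegral_map _ (measurable_trajCons n) _ hf,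
    Kernel.lintegral_id_prod hF, Kernel.lintegral_compProd _ _ _ hF']
  have h2 : Measurable fun a => ∫⁻ τ, f (Fin.cons (s, a) τ)
      ∂((trajKernel mdp pol θ n ∘ₖ mdp.trans) (s, a)) := by
    exact Measurable.lintegral_kernel_prod_right' (κ := (trajKernel mdp pol θ n ∘ₖ mdp.trans).comap
      (fun a : A => (s, a)) measurable_prodMk_left) hF'
  rw [pol.lintegral_kernel θ s h2]
  refine lintegral_congr fun a => ?_
  congr 1
  exact Kernel.lintegral_comp _ _ _ (hF'.comp (measurable_prodMk_left (x := a)))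

lemma lintegral_trajLaw (mdp : MDP S A R) (pol : Policy S A d) (θ : Param d)
    {f : Traj S A Hz → ℝ≥0∞} (hf : Measurable f) :
    ∫⁻ τ, f τ ∂(trajLaw mdp pol Hz θ) = ∫⁻ s, ∫⁻ τ, f τ ∂(trajKernel mdp pol θ Hz s) ∂mdp.rho := by
  rw [trajLaw, Measure.lintegral_bind (Kernel.aemeasurable _) hf.aemeasurable]

lemma Policy.measurable_impWeight (pol : Policy S A d) (θb θa : Param d) :
    Measurable (pol.impWeight θb θa : Traj S A Hz → ℝ) := by
  unfold Policy.impWeight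
  refine Finset.measurable_prod _ fun h _ => ?_
  exact ((pol.measurable_dens θa).comp (measurable_pi_apply h)).div
    ((pol.measurable_dens θb).comp (measurable_pi_apply h))

lemma Policy.impWeight_pos (pol : Policy S A d) (θb θa : Param d) (τ : Traj S A Hz) :
    0 < pol.impWeight θb θa τ :=
  Finset.prod_pos fun _ _ => div_pos (pol.dens_pos _ _ _) (pol.dens_pos _ _ _)

lemma Policy.impWeight_cons (pol : Policy S A d) (θb θa : Param d) (s : S) (a : A) {n : ℕ}
    (τ : Traj S A n) :
    pol.impWeight θb θa (Fin.cons (s, a) τ : Traj S A (n + 1)) =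
      pol.dens θa s a / pol.dens θb s a * pol.impWeight θb θa τ := by
  simp only [Policy.impWeight, Fin.prod_univ_succ, Fin.cons_zero, Fin.cons_succ]

/-- Both laws use the same reference measure for actions and the same dynamics, so passing from one
to the other multiplies each step by a ratio of policy densities. The induction peels off the first
step. -/
lemma lintegral_trajKernel_change (mdp : MDP S A R) (pol : Policy S A d) (θb θa : Param d) :
    ∀ (n : ℕ) (s : S) {f : Traj S A n → ℝ≥0∞}, Measurable f →
    ∫⁻ τ, f τ ∂(trajKernel mdp pol θa n s) =
      ∫⁻ τ, ENNReal.ofReal (pol.impWeight θb θa τ) * f τ ∂(trajKernel mdp pol θb n s)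
  | 0, s, f, hf => by simp [trajKernel, Policy.impWeight]
  | n + 1, s, f, hf => by
    have hw := (pol.measurable_impWeight (Hz := n + 1) θb θa).ennreal_ofReal
    rw [lintegral_trajKernel_succ _ _ _ _ _ hf,
      lintegral_trajKernel_succ (f := fun τ => ENNReal.ofReal (pol.impWeight θb θa τ) * f τ)
        _ _ _ _ _ (hw.mul hf)]
    refine lintegral_congr fun a => ?_
    have hc : Measurable fun τ : Traj S A n => f (Fin.cons (s, a) τ : Traj S A (n + 1)) :=
      hf.comp ((measurable_cons n).comp measurable_prodMk_left)
    have hm : Measurable fun τ : Traj S A n => ENNReal.ofReal (pol.impWeight θb θa τ)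
        * f (Fin.cons (s, a) τ : Traj S A (n + 1)) :=
      (pol.measurable_impWeight θb θa).ennreal_ofReal.mul hc
    simp_rw [Policy.impWeight_cons, ENNReal.ofReal_mul (div_pos (pol.dens_pos θa s a)
      (pol.dens_pos θb s a)).le, mul_assoc]
    simp_rw [lintegral_const_mul _ hm]
    rw [lintegral_const_mul _ hm.lintegral_kernel, ← mul_assoc,
      ← ENNReal.ofReal_mul (pol.dens_pos θb s a).le, mul_div_cancel₀ _ (pol.dens_pos θb s a).ne']
    simp_rw [fun s' => lintegral_trajKernel_change mdp pol θb θa n s' hc]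

lemma trajLaw_eq_withDensity (mdp : MDP S A R) (pol : Policy S A d) (θb θa : Param d) :
    trajLaw mdp pol Hz θa = (trajLaw mdp pol Hz θb).withDensity
      (fun τ => ENNReal.ofReal (pol.impWeight θb θa τ)) := by
  have hw := (pol.measurable_impWeight (Hz := Hz) θb θa).ennreal_ofReal
  refine Measure.ext_of_lintegral _ fun f hf => ?_
  rw [lintegral_withDensity_eq_lintegral_mul _ hw hf, lintegral_trajLaw _ _ _ hf,
    lintegral_trajLaw _ _ _ (hw.mul hf)]
  simp_rw [fun s => lintegral_trajKernel_change mdp pol θb θa Hz s hf]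
  rfl

section ChangeOfMeasure

variable {E : Type*} [NormedAddCommGroup E] [NormedSpace ℝ E]

lemma integral_trajLaw_change (mdp : MDP S A R) (pol : Policy S A d) (θb θa : Param d)
    (f : Traj S A Hz → E) :
    ∫ τ, f τ ∂(trajLaw mdp pol Hz θa) =
      ∫ τ, pol.impWeight θb θa τ • f τ ∂(trajLaw mdp pol Hz θb) := by
  rw [trajLaw_eq_withDensity mdp pol θb θa, integral_withDensity_eq_integral_toReal_smul
    (pol.measurable_impWeight θb θa).ennreal_ofReal (by simp)]
  simp_rw [ENNReal.toReal_ofReal (pol.impWeight_pos _ _ _).le]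

lemma integral_impWeight (mdp : MDP S A R) (pol : Policy S A d) (θb θa : Param d) :
    ∫ τ, pol.impWeight θb θa τ ∂(trajLaw mdp pol Hz θb) = 1 := by
  have h := integral_trajLaw_change mdp pol θb θa (fun _ : Traj S A Hz => (1 : ℝ))
  simpa using h.symm

end ChangeOfMeasure

/-- The first `m` steps of a trajectory of length `n`. -/
def truncate {m n : ℕ} (h : m ≤ n) (τ : Traj S A n) : Traj S A m := fun i => τ (Fin.castLE h i)

lemma measurable_truncate {m n : ℕ} (h : m ≤ n) :
    Measurable (truncate h : Traj S A n → Traj S A m) :=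
  measurable_pi_iff.2 fun _ => measurable_pi_apply _

/-- The law is built from the front by Markov kernels, so what happens after step `m` integrates to
one. GPOMDP needs this because its reward at each step is weighted only by the scores up to that
step. -/
lemma lintegral_trajKernel_truncate (mdp : MDP S A R) (pol : Policy S A d) (θ : Param d) :
    ∀ (m n : ℕ) (h : m ≤ n) (s : S) {f : Traj S A m → ℝ≥0∞}, Measurable f →
    ∫⁻ τ, f (truncate h τ) ∂(trajKernel mdp pol θ n s) = ∫⁻ τ, f τ ∂(trajKernel mdp pol θ m s)
  | 0, n, h, s, f, hf => by
    have : ∀ τ : Traj S A n, truncate h τ = Fin.elim0 := fun τ => Subsingleton.elim _ _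
    have e : (fun i => Fin.elim0 i : Traj S A 0) = Fin.elim0 := rfl
    simp_rw [this]
    rw [lintegral_const, measure_univ, mul_one, trajKernel, Kernel.const_apply,
      lintegral_dirac' _ hf]
  | m + 1, 0, h, _, _, _ => absurd h (by omega)
  | m + 1, n + 1, h, s, f, hf => by
    rw [lintegral_trajKernel_succ _ _ _ _ _ hf,
      lintegral_trajKernel_succ (f := fun τ => f (truncate h τ)) _ _ _ _ _
        (hf.comp (measurable_truncate h))]
    refine lintegral_congr fun a => ?_
    have hc : Measurable fun τ : Traj S A m => f (Fin.cons (s, a) τ : Traj S A (m + 1)) :=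
      hf.comp ((measurable_cons m).comp measurable_prodMk_left)
    have he : ∀ τ : Traj S A n, truncate h (Fin.cons (s, a) τ : Traj S A (n + 1)) =
        (Fin.cons (s, a) (truncate (Nat.le_of_succ_le_succ h) τ) : Traj S A (m + 1)) := by
      intro τ
      funext i
      refine Fin.cases rfl (fun j => ?_) i
      rfl
    simp_rw [he, fun s' => lintegral_trajKernel_truncate mdp pol θ m n
      (Nat.le_of_succ_le_succ h) s' hc]

lemma map_truncate_trajLaw (mdp : MDP S A R) (pol : Policy S A d) (θ : Param d) {m n : ℕ}
    (h : m ≤ n) : (trajLaw mdp pol n θ).map (truncate h) = trajLaw mdp pol m θ := by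
  refine Measure.ext_of_lintegral _ fun f hf => ?_
  rw [lintegral_map hf (measurable_truncate h), lintegral_trajLaw _ _ _ hf,
    lintegral_trajLaw (f := fun τ => f (truncate h τ)) _ _ _ (hf.comp (measurable_truncate h))]
  simp_rw [fun s => lintegral_trajKernel_truncate mdp pol θ m n h s hf]

lemma integral_truncate {E : Type*} [NormedAddCommGroup E] [NormedSpace ℝ E] (mdp : MDP S A R)
    (pol : Policy S A d) (θ : Param d) {m n : ℕ} (h : m ≤ n) {f : Traj S A m → E}
    (hf : StronglyMeasurable f) :
    ∫ τ, f (truncate h τ) ∂(trajLaw mdp pol n θ) = ∫ τ, f τ ∂(trajLaw mdp pol m θ) := by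
  rw [← map_truncate_trajLaw mdp pol θ h, integral_map (measurable_truncate h).aemeasurable
    hf.aestronglyMeasurable]

end TrajectoryLaw

/-! ### Measurability of derivatives with respect to a parameter -/

/-- Each directional derivative is a pointwise limit of difference quotients, hence measurable. In
finite dimension the values on a basis determine the derivative. -/
lemma stronglyMeasurable_of_hasFDerivAt {X E : Type*} [MeasurableSpace X] [NormedAddCommGroup E]
    [NormedSpace ℝ E] {d : ℕ} {F : Param d → X → E} {F' : X → Param d →L[ℝ] E} {θ : Param d}
    (hF : ∀ θ', StronglyMeasurable (F θ')) (h : ∀ x, HasFDerivAt (fun θ' => F θ' x) (F' x) θ) :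
    StronglyMeasurable F' := by
  have h1 : ∀ v, StronglyMeasurable fun x => F' x v := by
    intro v
    refine stronglyMeasurable_of_tendsto (f := fun (n : ℕ) x =>
      (n : ℝ) • (F (θ + (n : ℝ)⁻¹ • v) x - F θ x)) Filter.atTop
      (fun n => ((hF _).sub (hF _)).const_smul _) (tendsto_pi_nhds.2 fun x => ?_)
    refine (h x).lim v ?_
    simpa using tendsto_natCast_atTop_atTop (R := ℝ)
  have h2 : F' = fun x => ∑ j, (EuclideanSpace.proj j : Param d →L[ℝ] ℝ).smulRight
      (F' x (EuclideanSpace.single j 1)) := by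
    funext x
    ext v
    have hv : v = ∑ j, v j • EuclideanSpace.single j (1 : ℝ) := by
      ext i
      simp [Finset.sum_apply, Pi.single_apply]
    conv_lhs => rw [hv]
    simp [map_sum]
  rw [h2]
  refine Finset.stronglyMeasurable_fun_sum _ fun j _ => ?_
  exact (ContinuousLinearMap.smulRightL ℝ (Param d) E
    (EuclideanSpace.proj j)).continuous.comp_stronglyMeasurable (h1 _)

/-! ### The score -/

/-- The regularity of the policy class in the parameter: bounded score and bounded Hessian of the
log-policy. -/
structure SmoothPolicy {S A : Type*} [MeasurableSpace S] [MeasurableSpace A] {d : ℕ}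
    (pol : Policy S A d) (G M : ℝ) : Prop where
  score_le : ∀ θ s a, ‖pol.score s a θ‖ ≤ G
  differentiable : ∀ s a, Differentiable ℝ (fun θ => pol.dens θ s a)
  differentiable_gradient : ∀ s a, Differentiable ℝ (gradient (fun θ => pol.dens θ s a))
  hessian_le : ∀ θ s a, ‖fderiv ℝ (pol.score s a) θ‖ ≤ M

section Score

variable {S A : Type*} [MeasurableSpace S] [MeasurableSpace A] {R : ℝ} {d n : ℕ}
  {pol : Policy S A d} {G M : ℝ}

lemma Assumptions.smoothPolicy {mdp : MDP S A R} {γ σ W : ℝ} {est : Estimator n}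
    (h : Assumptions mdp pol γ est G M σ W) : SmoothPolicy pol G M :=
  ⟨h.score_le, h.differentiable, h.differentiable_gradient, h.hessian_le⟩

namespace SmoothPolicy

lemma hasGradientAt_log (h : SmoothPolicy pol G M) (θ : Param d) (s : S) (a : A) :
    HasGradientAt (fun θ' => Real.log (pol.dens θ' s a)) (pol.score s a θ) θ :=
  (((h.differentiable s a) θ).log (pol.dens_pos θ s a).ne').hasGradientAt

/-- The second-order hypothesis concerns the gradient of the density. This quotient form transfers
differentiability to the score. -/
lemma score_eq (h : SmoothPolicy pol G M) (s : S) (a : A) :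
    pol.score s a = fun θ => (pol.dens θ s a)⁻¹ • gradient (fun θ => pol.dens θ s a) θ := by
  funext θ
  have := ((h.differentiable s a) θ).hasGradientAt
  rw [hasGradientAt_iff_hasFDerivAt] at this
  refine HasGradientAt.gradient ?_
  rw [hasGradientAt_iff_hasFDerivAt]
  rw [map_smulₛₗ]
  exact this.log (pol.dens_pos θ s a).ne'

lemma differentiable_score (h : SmoothPolicy pol G M) (s : S) (a : A) :
    Differentiable ℝ (pol.score s a) := by
  rw [h.score_eq]
  exact ((h.differentiable s a).inv fun θ => (pol.dens_pos θ s a).ne').smul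
    (h.differentiable_gradient s a)

lemma norm_score_sub_le (h : SmoothPolicy pol G M) (s : S) (a : A) (θ θ' : Param d) :
    ‖pol.score s a θ - pol.score s a θ'‖ ≤ M * ‖θ - θ'‖ :=
  Convex.norm_image_sub_le_of_norm_fderiv_le (fun x _ => h.differentiable_score s a x)
    (fun x _ => h.hessian_le x s a) convex_univ (Set.mem_univ _) (Set.mem_univ _)

lemma abs_log_sub_le (h : SmoothPolicy pol G M) (s : S) (a : A) (θ θ' : Param d) :
    |Real.log (pol.dens θ s a) - Real.log (pol.dens θ' s a)| ≤ G * ‖θ - θ'‖ := by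
  refine Convex.norm_image_sub_le_of_norm_hasFDerivWithin_le (𝕜 := ℝ)
    (f := fun θ => Real.log (pol.dens θ s a))
    (fun x _ => (h.hasGradientAt_log x s a).hasFDerivAt.hasFDerivWithinAt)
    (fun x _ => ?_) convex_univ (Set.mem_univ _) (Set.mem_univ _)
  simpa using h.score_le x s a

lemma measurable_score (h : SmoothPolicy pol G M) (θ : Param d) :
    Measurable (fun x : S × A => pol.score x.1 x.2 θ) := by
  have h1 : StronglyMeasurable fun x : S × A =>
      (InnerProductSpace.toDual ℝ (Param d)) (pol.score x.1 x.2 θ) :=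
    stronglyMeasurable_of_hasFDerivAt (F := fun θ' (x : S × A) => Real.log (pol.dens θ' x.1 x.2))
      (fun θ' => (Real.measurable_log.comp (pol.measurable_dens θ')).stronglyMeasurable)
      (fun x => (h.hasGradientAt_log θ x.1 x.2).hasFDerivAt)
  have h2 := ((InnerProductSpace.toDual ℝ (Param d)).symm.continuous.comp_stronglyMeasurable
    h1).measurable
  simpa using h2

end SmoothPolicy

/-- The score `∇_θ log p(τ | θ)` of a trajectory. -/
def Policy.trajScore (pol : Policy S A d) (θ : Param d) (τ : Traj S A n) : Param d :=
  ∑ h, pol.score (τ h).1 (τ h).2 θ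

namespace SmoothPolicy

lemma measurable_trajScore (h : SmoothPolicy pol G M) (θ : Param d) :
    Measurable (pol.trajScore θ : Traj S A n → Param d) :=
  Finset.measurable_fun_sum _ fun i _ => (h.measurable_score θ).comp (measurable_pi_apply i)

lemma norm_trajScore_le (h : SmoothPolicy pol G M) (θ : Param d) (τ : Traj S A n) :
    ‖pol.trajScore θ τ‖ ≤ n * G := by
  refine (norm_sum_le_of_le _ fun i _ => h.score_le θ (τ i).1 (τ i).2).trans ?_
  simp

lemma differentiable_trajScore (h : SmoothPolicy pol G M) (τ : Traj S A n) :
    Differentiable ℝ (fun θ => pol.trajScore θ τ) :=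
  Differentiable.fun_sum fun _ _ => h.differentiable_score _ _

lemma norm_fderiv_trajScore_le (h : SmoothPolicy pol G M) (θ : Param d) (τ : Traj S A n) :
    ‖fderiv ℝ (fun θ => pol.trajScore θ τ) θ‖ ≤ n * M := by
  have : fderiv ℝ (fun θ => pol.trajScore θ τ) θ =
      ∑ i, fderiv ℝ (pol.score (τ i).1 (τ i).2) θ :=
    fderiv_fun_sum fun _ _ => h.differentiable_score _ _ θ
  rw [this]
  refine (norm_sum_le_of_le _ fun i _ => h.hessian_le θ (τ i).1 (τ i).2).trans ?_
  simp

/-- In exponential form the bound and the derivative of the weight follow from those of the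
log-policy, without a product rule. -/
lemma impWeight_eq_exp (pol : Policy S A d) (θb θa : Param d) (τ : Traj S A n) :
    pol.impWeight θb θa τ = Real.exp (∑ i, (Real.log (pol.dens θa (τ i).1 (τ i).2)
      - Real.log (pol.dens θb (τ i).1 (τ i).2))) := by
  rw [Real.exp_sum, Policy.impWeight]
  refine Finset.prod_congr rfl fun i _ => ?_
  rw [Real.exp_sub, Real.exp_log (pol.dens_pos _ _ _), Real.exp_log (pol.dens_pos _ _ _)]

lemma impWeight_le (h : SmoothPolicy pol G M) (θb θa : Param d) (τ : Traj S A n) :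
    pol.impWeight θb θa τ ≤ Real.exp (n * (G * ‖θa - θb‖)) := by
  rw [impWeight_eq_exp]
  refine Real.exp_le_exp.2 ?_
  refine (Finset.sum_le_sum fun i _ => (le_abs_self _).trans (h.abs_log_sub_le _ _ _ _)).trans ?_
  simp

lemma impWeight_self (pol : Policy S A d) (θ : Param d) (τ : Traj S A n) :
    pol.impWeight θ θ τ = 1 := by
  rw [impWeight_eq_exp]; simp

lemma hasFDerivAt_impWeight (h : SmoothPolicy pol G M) (θb θ : Param d) (τ : Traj S A n) :
    HasFDerivAt (fun θa => pol.impWeight θb θa τ)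
      (pol.impWeight θb θ τ • innerSL ℝ (pol.trajScore θ τ)) θ := by
  have h1 : HasFDerivAt (fun θa => ∑ i, (Real.log (pol.dens θa (τ i).1 (τ i).2)
      - Real.log (pol.dens θb (τ i).1 (τ i).2))) (innerSL ℝ (pol.trajScore θ τ)) θ := by
    rw [Policy.trajScore, map_sum]
    refine HasFDerivAt.fun_sum fun i _ => ?_
    exact (h.hasGradientAt_log θ _ _).hasFDerivAt.sub_const _
  simp_rw [impWeight_eq_exp]
  exact h1.exp

end SmoothPolicy

end Score

/-! ### Differentiation of expectations over trajectories -/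

section Differentiation

variable {S A : Type*} [MeasurableSpace S] [MeasurableSpace A] {R : ℝ} {d n : ℕ}
  {pol : Policy S A d} {G M : ℝ} {E : Type*} [NormedAddCommGroup E] [NormedSpace ℝ E]

/-- Under the fixed law at the base point, the parameter enters only through the weight and the
integrand. The weight has derivative weight times score and equals one at the base point, which
produces the extra score term. -/
lemma hasFDerivAt_integral_trajLaw (mdp : MDP S A R) (h : SmoothPolicy pol G M) (hG : 0 ≤ G)
    {f : Param d → Traj S A n → E} {f' : Param d → Traj S A n → Param d →L[ℝ] E} {C₀ C₁ : ℝ}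
    (hf : ∀ θ, StronglyMeasurable (f θ)) (hf₀ : ∀ θ τ, ‖f θ τ‖ ≤ C₀) (hf₁ : ∀ θ τ, ‖f' θ τ‖ ≤ C₁)
    (hf' : ∀ θ τ, HasFDerivAt (fun θ' => f θ' τ) (f' θ τ) θ) (θ : Param d) :
    HasFDerivAt (fun θ' => ∫ τ, f θ' τ ∂(trajLaw mdp pol n θ'))
      (∫ τ, (f' θ τ + (innerSL ℝ (pol.trajScore θ τ)).smulRight (f θ τ))
        ∂(trajLaw mdp pol n θ)) θ := by
  have e : ∀ θ', ∫ τ, f θ' τ ∂(trajLaw mdp pol n θ') =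
      ∫ τ, pol.impWeight θ θ' τ • f θ' τ ∂(trajLaw mdp pol n θ) :=
    fun θ' => integral_trajLaw_change mdp pol θ θ' _
  have hmeas : ∀ θ', StronglyMeasurable fun τ : Traj S A n => pol.impWeight θ θ' τ • f θ' τ :=
    fun θ' => (pol.measurable_impWeight θ θ').stronglyMeasurable.smul (hf θ')
  have hderiv : ∀ θ' (τ : Traj S A n), HasFDerivAt (fun θ' => pol.impWeight θ θ' τ • f θ' τ)
      (pol.impWeight θ θ' τ • f' θ' τ +
        (pol.impWeight θ θ' τ • innerSL ℝ (pol.trajScore θ' τ)).smulRight (f θ' τ)) θ' :=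
    fun θ' τ => (h.hasFDerivAt_impWeight θ θ' τ).smul (hf' θ' τ)
  simp_rw [e]
  have key := hasFDerivAt_integral_of_dominated_of_fderiv_le (𝕜 := ℝ)
    (μ := trajLaw mdp pol n θ) (x₀ := θ) (s := Metric.ball θ 1)
    (F := fun θ' τ => pol.impWeight θ θ' τ • f θ' τ)
    (F' := fun θ' τ => pol.impWeight θ θ' τ • f' θ' τ +
        (pol.impWeight θ θ' τ • innerSL ℝ (pol.trajScore θ' τ)).smulRight (f θ' τ))
    (bound := fun _ => Real.exp (n * G) * (C₁ + n * G * C₀))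
    (Metric.ball_mem_nhds _ one_pos)
    (Filter.Eventually.of_forall fun θ' => (hmeas θ').aestronglyMeasurable)
    ?_ (stronglyMeasurable_of_hasFDerivAt hmeas fun τ => hderiv θ τ).aestronglyMeasurable
    (Filter.Eventually.of_forall fun τ θ' hθ' => ?_)
    (integrable_const _) (Filter.Eventually.of_forall fun τ θ' _ => hderiv θ' τ)
  · simpa [SmoothPolicy.impWeight_self] using key
  · simp only [SmoothPolicy.impWeight_self, one_smul]
    exact Integrable.of_bound (hf θ).aestronglyMeasurable C₀
      (Filter.Eventually.of_forall fun τ => hf₀ θ τ)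
  · have hw0 := (pol.impWeight_pos θ θ' τ).le
    -- On the unit ball around the base point the Lipschitz log-policy keeps the weight below a
    -- constant, which serves as dominating function.
    have hw : pol.impWeight θ θ' τ ≤ Real.exp (n * G) := by
      refine (h.impWeight_le θ θ' τ).trans (Real.exp_le_exp.2 ?_)
      have : ‖θ' - θ‖ ≤ 1 := by simpa [dist_eq_norm] using (Metric.mem_ball.1 hθ').le
      gcongr
      nlinarith
    refine (norm_add_le _ _).trans ?_
    rw [norm_smul, ContinuousLinearMap.norm_smulRight_apply, norm_smul, innerSL_apply_norm,
      Real.norm_of_nonneg hw0, mul_assoc, ← mul_add]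
    have h1 := h.norm_trajScore_le θ' τ
    have h2 : ‖pol.trajScore θ' τ‖ * ‖f θ' τ‖ ≤ n * G * C₀ :=
      mul_le_mul h1 (hf₀ θ' τ) (norm_nonneg _) (by positivity)
    exact mul_le_mul hw (add_le_add (hf₁ θ' τ) h2) (by positivity) (Real.exp_pos _).le

/-- The score-function formula for the gradient of an expectation over trajectories. -/
lemma hasGradientAt_integral_trajLaw (mdp : MDP S A R) (h : SmoothPolicy pol G M) (hG : 0 ≤ G)
    {f : Traj S A n → ℝ} {C : ℝ} (hf : Measurable f) (hC : ∀ τ, |f τ| ≤ C) (θ : Param d) :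
    HasGradientAt (fun θ' => ∫ τ, f τ ∂(trajLaw mdp pol n θ'))
      (∫ τ, f τ • pol.trajScore θ τ ∂(trajLaw mdp pol n θ)) θ := by
  have hC' : ∀ τ, |f τ| ≤ |C| := fun τ => (hC τ).trans (le_abs_self C)
  have key := hasFDerivAt_integral_trajLaw mdp h hG (f := fun _ => f) (f' := fun _ _ => 0) (C₁ := 0)
    (fun _ => hf.stronglyMeasurable) (fun _ => hC') (by simp)
    (fun _ _ => hasFDerivAt_const _ _) θ
  rw [hasGradientAt_iff_hasFDerivAt]
  suffices e : InnerProductSpace.toDual ℝ (Param d)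
      (∫ τ, f τ • pol.trajScore θ τ ∂(trajLaw mdp pol n θ)) =
        ∫ τ, ((0 : Param d →L[ℝ] ℝ) + (innerSL ℝ (pol.trajScore θ τ)).smulRight (f τ))
          ∂(trajLaw mdp pol n θ) by
    rw [e]; exact key
  have hm : StronglyMeasurable fun τ : Traj S A n =>
      (innerSL ℝ (pol.trajScore θ τ)).smulRight (f τ) := by
    have h1 := (innerSL ℝ (E := Param d)).continuous.comp_stronglyMeasurable
      (h.measurable_trajScore (n := n) θ).stronglyMeasurable
    exact (ContinuousLinearMap.smulRightL ℝ (Param d) ℝ).continuous₂.comp_stronglyMeasurable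
      (h1.prodMk hf.stronglyMeasurable)
  have hi : Integrable (fun τ : Traj S A n => (0 : Param d →L[ℝ] ℝ) +
      (innerSL ℝ (pol.trajScore θ τ)).smulRight (f τ)) (trajLaw mdp pol n θ) := by
    simp only [zero_add]
    refine Integrable.of_bound hm.aestronglyMeasurable (n * G * |C|)
      (Filter.Eventually.of_forall fun τ => ?_)
    rw [ContinuousLinearMap.norm_smulRight_apply, innerSL_apply_norm]
    exact mul_le_mul (h.norm_trajScore_le θ τ) (hC' τ) (norm_nonneg _) (by positivity)
  have hi2 : Integrable (fun τ => f τ • pol.trajScore θ τ) (trajLaw mdp pol n θ) := by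
    refine Integrable.of_bound (hf.smul (h.measurable_trajScore θ)).aestronglyMeasurable
      (|C| * (n * G)) (Filter.Eventually.of_forall fun τ => ?_)
    rw [norm_smul]
    exact mul_le_mul (hC' τ) (h.norm_trajScore_le θ τ) (norm_nonneg _) (by positivity)
  refine ContinuousLinearMap.ext fun v => ?_
  rw [ContinuousLinearMap.integral_apply hi, InnerProductSpace.toDual_apply_apply,
    real_inner_comm, ← integral_inner hi2]
  refine integral_congr_ae (Filter.Eventually.of_forall fun τ => ?_)
  simp [inner_smul_right, real_inner_comm, mul_comm]

end Differentiation

/-! ### Smoothness of the objective -/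

open scoped RealInnerProductSpace in
/-- The quadratic lower bound for a function with Lipschitz gradient. -/
lemma quadratic_lower_bound {d : ℕ} {f : Param d → ℝ} {f' : Param d → Param d} {L : ℝ}
    (hf : ∀ x, HasGradientAt f (f' x) x) (hL : ∀ x y, ‖f' x - f' y‖ ≤ L * ‖x - y‖)
    (x v : Param d) : f x + ⟪f' x, v⟫ - L / 2 * ‖v‖ ^ 2 ≤ f (x + v) := by
  let g : ℝ → ℝ := fun t => f (x + t • v) - t * ⟪f' x, v⟫ + L / 2 * t ^ 2 * ‖v‖ ^ 2
  have hg : ∀ t, HasDerivAt g (⟪f' (x + t • v), v⟫ - ⟪f' x, v⟫ + L * t * ‖v‖ ^ 2) t := by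
    intro t
    have h1 : HasDerivAt (fun t : ℝ => x + t • v) v t := by
      simpa using ((hasDerivAt_id t).smul_const v).const_add x
    have h2 : HasDerivAt (fun t => f (x + t • v)) ⟪f' (x + t • v), v⟫ t := by
      exact ((hf (x + t • v)).hasFDerivAt.comp_hasDerivAt t h1).congr_deriv (by simp)
    have h3 : HasDerivAt (fun t : ℝ => t * ⟪f' x, v⟫) ⟪f' x, v⟫ t := by
      simpa using (hasDerivAt_id t).mul_const ⟪f' x, v⟫
    have h4 : HasDerivAt (fun t : ℝ => L / 2 * t ^ 2 * ‖v‖ ^ 2) (L * t * ‖v‖ ^ 2) t := by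
      exact (((hasDerivAt_pow 2 t).const_mul (L / 2)).mul_const (‖v‖ ^ 2)).congr_deriv
        (by rw [show (2 - 1 : ℕ) = 1 from rfl]; push_cast; ring)
    exact (h2.sub h3).add h4
  have hmono : MonotoneOn g (Set.Icc 0 1) := by
    refine monotoneOn_of_deriv_nonneg (convex_Icc 0 1)
      (fun t _ => (hg t).continuousAt.continuousWithinAt)
      (fun t _ => (hg t).differentiableAt.differentiableWithinAt) fun t ht => ?_
    rw [interior_Icc] at ht
    rw [(hg t).deriv, ← inner_sub_left]
    have h1 := neg_le_of_abs_le (abs_real_inner_le_norm (f' (x + t • v) - f' x) v)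
    have h2 := hL (x + t • v) x
    rw [add_sub_cancel_left, norm_smul, Real.norm_of_nonneg ht.1.le] at h2
    nlinarith [mul_le_mul_of_nonneg_right h2 (norm_nonneg v)]
  have := hmono (Set.left_mem_Icc.2 zero_le_one) (Set.right_mem_Icc.2 zero_le_one) zero_le_one
  simp only [g] at this
  simp at this
  linarith

section Objective

variable {S A : Type*} [MeasurableSpace S] [MeasurableSpace A] {R : ℝ} {d Hz : ℕ}

lemma MDP.measurable_totalReward (mdp : MDP S A R) (γ : ℝ) :
    Measurable (mdp.totalReward γ : Traj S A Hz → ℝ) :=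
  Finset.measurable_fun_sum _ fun i _ =>
    (mdp.measurable_reward.comp (measurable_pi_apply i)).const_mul _

lemma MDP.totalReward_nonneg (mdp : MDP S A R) {γ : ℝ} (hγ0 : 0 ≤ γ) (τ : Traj S A Hz) :
    0 ≤ mdp.totalReward γ τ :=
  Finset.sum_nonneg fun _ _ => mul_nonneg (pow_nonneg hγ0 _) (mdp.reward_nonneg _ _)

lemma MDP.totalReward_le (mdp : MDP S A R) {γ : ℝ} (hR : 0 ≤ R) (hγ0 : 0 ≤ γ) (hγ1 : γ < 1)
    (τ : Traj S A Hz) : mdp.totalReward γ τ ≤ R / (1 - γ) := by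
  have h1 : mdp.totalReward γ τ ≤ ∑ h : Fin Hz, γ ^ (h : ℕ) * R :=
    Finset.sum_le_sum fun h _ =>
      mul_le_mul_of_nonneg_left (mdp.reward_le _ _) (pow_nonneg hγ0 _)
  refine h1.trans ?_
  rw [← Finset.sum_mul, Fin.sum_univ_eq_sum_range (fun i => γ ^ i), div_eq_inv_mul]
  refine mul_le_mul_of_nonneg_right ?_ hR
  rw [← tsum_geometric_of_lt_one hγ0 hγ1]
  exact (summable_geometric_of_lt_one hγ0 hγ1).sum_le_tsum _ fun i _ => pow_nonneg hγ0 i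

lemma MDP.abs_totalReward_le (mdp : MDP S A R) {γ : ℝ} (hR : 0 ≤ R) (hγ0 : 0 ≤ γ) (hγ1 : γ < 1)
    (τ : Traj S A Hz) : |mdp.totalReward γ τ| ≤ R / (1 - γ) := by
  rw [abs_of_nonneg (mdp.totalReward_nonneg hγ0 τ)]
  exact mdp.totalReward_le hR hγ0 hγ1 τ

variable {mdp : MDP S A R} {pol : Policy S A d} {γ G M : ℝ}

lemma integrable_totalReward (hR : 0 ≤ R) (hγ0 : 0 ≤ γ) (hγ1 : γ < 1) (θ : Param d) :
    Integrable (mdp.totalReward γ) (trajLaw mdp pol Hz θ) :=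
  Integrable.of_bound (mdp.measurable_totalReward γ).aestronglyMeasurable (R / (1 - γ))
    (Filter.Eventually.of_forall fun τ => mdp.abs_totalReward_le hR hγ0 hγ1 τ)

lemma objective_nonneg (hγ0 : 0 ≤ γ) (θ : Param d) : 0 ≤ objective mdp pol γ Hz θ :=
  integral_nonneg fun τ => mdp.totalReward_nonneg hγ0 τ

lemma objective_le (hR : 0 ≤ R) (hγ0 : 0 ≤ γ) (hγ1 : γ < 1) (θ : Param d) :
    objective mdp pol γ Hz θ ≤ R / (1 - γ) := by
  refine (integral_mono (integrable_totalReward hR hγ0 hγ1 θ) (integrable_const _)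
    fun τ => mdp.totalReward_le hR hγ0 hγ1 τ).trans ?_
  simp

lemma objective_le_iSup (hR : 0 ≤ R) (hγ0 : 0 ≤ γ) (hγ1 : γ < 1) (θ : Param d) :
    objective mdp pol γ Hz θ ≤ ⨆ θ, objective mdp pol γ Hz θ :=
  le_ciSup ⟨R / (1 - γ), by rintro _ ⟨θ, rfl⟩; exact objective_le hR hγ0 hγ1 θ⟩ θ

namespace SmoothPolicy

variable (h : SmoothPolicy pol G M) (mdp)
include h

lemma hasGradientAt_objective (hG : 0 ≤ G) (hR : 0 ≤ R) (hγ0 : 0 ≤ γ) (hγ1 : γ < 1)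
    (θ : Param d) :
    HasGradientAt (objective mdp pol γ Hz)
      (∫ τ, mdp.totalReward γ τ • pol.trajScore θ τ ∂(trajLaw mdp pol Hz θ)) θ :=
  hasGradientAt_integral_trajLaw mdp h hG (mdp.measurable_totalReward γ)
    (fun τ => mdp.abs_totalReward_le hR hγ0 hγ1 τ) θ

lemma hasGradientAt_gradient_objective (hG : 0 ≤ G) (hR : 0 ≤ R) (hγ0 : 0 ≤ γ) (hγ1 : γ < 1)
    (θ : Param d) :
    HasGradientAt (objective mdp pol γ Hz) (gradient (objective mdp pol γ Hz) θ) θ :=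
  (h.hasGradientAt_objective mdp hG hR hγ0 hγ1 θ).differentiableAt.hasGradientAt

/-- Differentiating the score formula once more gives the mean of return times (Hessian of the
log-likelihood plus outer square of the score). With return at most `R/(1-γ)` and `H` steps, its
norm is at most `R/(1-γ) · (HM + H²G²) = L`. -/
lemma norm_gradient_objective_sub_le (hG : 0 ≤ G) (hR : 0 ≤ R) (hγ0 : 0 ≤ γ)
    (hγ1 : γ < 1) (θ θ' : Param d) :
    ‖gradient (objective mdp pol γ Hz) θ - gradient (objective mdp pol γ Hz) θ'‖ ≤
      smoothConst Hz R γ G M * ‖θ - θ'‖ := by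
  have hR' : 0 ≤ R / (1 - γ) := div_nonneg hR (by linarith)
  simp_rw [fun θ => (h.hasGradientAt_objective mdp (Hz := Hz) hG hR hγ0 hγ1 θ).gradient]
  have hd : ∀ θ (τ : Traj S A Hz), HasFDerivAt
      (fun θ' => mdp.totalReward γ τ • pol.trajScore θ' τ)
      (mdp.totalReward γ τ • fderiv ℝ (fun θ => pol.trajScore θ τ) θ) θ := fun θ τ =>
    (h.differentiable_trajScore τ θ).hasFDerivAt.const_smul (mdp.totalReward γ τ)
  have hb0 : ∀ θ (τ : Traj S A Hz), ‖mdp.totalReward γ τ • pol.trajScore θ τ‖ ≤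
      R / (1 - γ) * (Hz * G) := fun θ τ => by
    rw [norm_smul]
    exact mul_le_mul (mdp.abs_totalReward_le hR hγ0 hγ1 τ) (h.norm_trajScore_le θ τ)
      (norm_nonneg _) hR'
  have hb1 : ∀ θ (τ : Traj S A Hz),
      ‖mdp.totalReward γ τ • fderiv ℝ (fun θ => pol.trajScore θ τ) θ‖ ≤
      R / (1 - γ) * (Hz * M) := fun θ τ => by
    rw [norm_smul]
    exact mul_le_mul (mdp.abs_totalReward_le hR hγ0 hγ1 τ) (h.norm_fderiv_trajScore_le θ τ)
      (norm_nonneg _) hR'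
  refine Convex.norm_image_sub_le_of_norm_hasFDerivWithin_le (𝕜 := ℝ) (s := Set.univ)
    (f := fun θ => ∫ τ, mdp.totalReward γ τ • pol.trajScore θ τ ∂(trajLaw mdp pol Hz θ))
    (fun θ _ => (hasFDerivAt_integral_trajLaw mdp h hG
      (fun θ => ((mdp.measurable_totalReward γ).smul
        (h.measurable_trajScore θ)).stronglyMeasurable) hb0 hb1 hd θ).hasFDerivWithinAt)
    (fun θ _ => ?_) convex_univ (Set.mem_univ _) (Set.mem_univ _)
  have hbound : ∀ τ : Traj S A Hz,
      ‖mdp.totalReward γ τ • fderiv ℝ (fun θ => pol.trajScore θ τ) θ +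
        (innerSL ℝ (pol.trajScore θ τ)).smulRight (mdp.totalReward γ τ • pol.trajScore θ τ)‖ ≤
      smoothConst Hz R γ G M := fun τ => by
    refine (norm_add_le _ _).trans ?_
    rw [ContinuousLinearMap.norm_smulRight_apply, innerSL_apply_norm]
    refine (add_le_add (hb1 θ τ) (mul_le_mul (h.norm_trajScore_le θ τ) (hb0 θ τ) (norm_nonneg _)
      (by positivity))).trans (le_of_eq ?_)
    rw [smoothConst]
    ring
  refine (norm_integral_le_of_norm_le_const (Filter.Eventually.of_forall hbound)).trans ?_
  simp

lemma norm_gradient_objective_le (hG : 0 ≤ G) (hR : 0 ≤ R) (hγ0 : 0 ≤ γ) (hγ1 : γ < 1)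
    (θ : Param d) : ‖gradient (objective mdp pol γ Hz) θ‖ ≤ R / (1 - γ) * (Hz * G) := by
  rw [(h.hasGradientAt_objective mdp (Hz := Hz) hG hR hγ0 hγ1 θ).gradient]
  refine (norm_integral_le_of_norm_le_const (C := R / (1 - γ) * (Hz * G))
    (Filter.Eventually.of_forall fun τ => ?_)).trans (le_of_eq (by simp))
  · rw [norm_smul]
    exact mul_le_mul (mdp.abs_totalReward_le hR hγ0 hγ1 τ) (h.norm_trajScore_le θ τ)
      (norm_nonneg _) (div_nonneg hR (by linarith))

end SmoothPolicy

/-! ### The gradient estimators -/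

/-- A bound for the coefficients of the score in a gradient estimator. -/
def Estimator.bound (R : ℝ) : Estimator Hz → ℝ
  | .reinforce b => Hz * R + |b|
  | .gpomdp b => ∑ h, (R + |b h|)

lemma Estimator.bound_nonneg (est : Estimator Hz) (hR : 0 ≤ R) : 0 ≤ est.bound R := by
  cases est with
  | reinforce b => simp only [Estimator.bound]; positivity
  | gpomdp b => simp only [Estimator.bound]; positivity

lemma MDP.abs_discounted_le (mdp : MDP S A R) (hγ0 : 0 ≤ γ) (hγ1 : γ < 1) (k : ℕ)
    (s : S) (a : A) : |γ ^ k * mdp.reward s a| ≤ R := by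
  have h0 := mdp.reward_nonneg s a
  rw [abs_of_nonneg (by positivity)]
  exact (mul_le_of_le_one_left h0 (pow_le_one₀ hγ0 hγ1.le)).trans (mdp.reward_le s a)

lemma MDP.abs_totalReward_le' (mdp : MDP S A R) (hγ0 : 0 ≤ γ) (hγ1 : γ < 1) (τ : Traj S A Hz) :
    |mdp.totalReward γ τ| ≤ Hz * R := by
  refine (Finset.abs_sum_le_sum_abs _ _).trans ?_
  refine le_trans (Finset.sum_le_card_nsmul _ _ R ?_) (by simp)
  exact fun i _ => mdp.abs_discounted_le hγ0 hγ1 _ _ _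

lemma norm_sum_Iic_le {E : Type*} [NormedAddCommGroup E] {f : Fin Hz → E} {c : ℝ} (hc : 0 ≤ c)
    (hf : ∀ i, ‖f i‖ ≤ c) (i : Fin Hz) : ‖∑ u ∈ Finset.Iic i, f u‖ ≤ Hz * c := by
  refine (norm_sum_le_of_le _ fun u _ => hf u).trans ?_
  rw [Finset.sum_const, nsmul_eq_mul]
  refine mul_le_mul_of_nonneg_right ?_ hc
  exact_mod_cast (Finset.card_le_univ _).trans (by simp)

/-- A weighted sum of scores, with a bounded total weight, is bounded by any uniform bound. -/
lemma Estimator.norm_le_of_linear (est : Estimator Hz) (mdp : MDP S A R) (hγ0 : 0 ≤ γ)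
    (hγ1 : γ < 1) (τ : Traj S A Hz) {E : Type*} [NormedAddCommGroup E] [NormedSpace ℝ E]
    {ψ : Fin Hz → E} {c : ℝ} (hc : 0 ≤ c) (hψ : ∀ i, ‖ψ i‖ ≤ c) :
    ‖(match est with
      | .reinforce b => (mdp.totalReward γ τ - b) • ∑ i, ψ i
      | .gpomdp b => ∑ i : Fin Hz, (γ ^ (i : ℕ) * mdp.reward (τ i).1 (τ i).2 - b i) •
          ∑ u ∈ Finset.Iic i, ψ u : E)‖ ≤ est.bound R * (Hz * c) := by
  cases est with
  | reinforce b =>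
    simp only [Estimator.bound]
    rw [norm_smul]
    refine mul_le_mul ((abs_sub _ _).trans (add_le_add (mdp.abs_totalReward_le' hγ0 hγ1 τ) le_rfl))
      ((norm_sum_le_of_le _ fun _ _ => hψ _).trans (by simp)) (norm_nonneg _) ?_
    exact add_nonneg ((abs_nonneg _).trans (mdp.abs_totalReward_le' hγ0 hγ1 τ)) (abs_nonneg _)
  | gpomdp b =>
    simp only [Estimator.bound]
    rw [Finset.sum_mul]
    refine norm_sum_le_of_le _ fun i _ => ?_
    rw [norm_smul]
    refine mul_le_mul ((abs_sub _ _).trans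
      (add_le_add (mdp.abs_discounted_le hγ0 hγ1 i _ _) le_rfl))
      (norm_sum_Iic_le hc hψ i) (norm_nonneg _) ?_
    exact add_nonneg ((abs_nonneg _).trans (mdp.abs_discounted_le hγ0 hγ1 i (τ i).1 (τ i).2))
      (abs_nonneg _)

namespace SmoothPolicy

variable (h : SmoothPolicy pol G M) (mdp) (est : Estimator Hz)
include h

lemma norm_grad_le (hG : 0 ≤ G) (hγ0 : 0 ≤ γ) (hγ1 : γ < 1) (τ : Traj S A Hz) (θ : Param d) :
    ‖est.grad mdp pol γ τ θ‖ ≤ est.bound R * (Hz * G) :=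
  est.norm_le_of_linear mdp hγ0 hγ1 τ (ψ := fun i => pol.score (τ i).1 (τ i).2 θ) hG
    fun _ => h.score_le θ _ _

lemma norm_grad_sub_le (hM : 0 ≤ M) (hγ0 : 0 ≤ γ) (hγ1 : γ < 1) (τ : Traj S A Hz)
    (θ θ' : Param d) :
    ‖est.grad mdp pol γ τ θ - est.grad mdp pol γ τ θ'‖ ≤
      est.bound R * (Hz * M) * ‖θ - θ'‖ := by
  -- For a fixed trajectory the estimator is linear in the scores, so a difference of estimates is
  -- the same combination of differences of scores.
  have := est.norm_le_of_linear mdp hγ0 hγ1 τ (c := M * ‖θ - θ'‖)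
    (ψ := fun i => pol.score (τ i).1 (τ i).2 θ - pol.score (τ i).1 (τ i).2 θ')
    (by positivity) fun i => h.norm_score_sub_le _ _ θ θ'
  refine le_trans (le_of_eq ?_) (this.trans (le_of_eq (by ring)))
  cases est <;> simp only [Estimator.grad, Finset.sum_sub_distrib, smul_sub]

lemma measurable_grad (θ : Param d) :
    Measurable (fun τ : Traj S A Hz => est.grad mdp pol γ τ θ) := by
  have hs : ∀ i : Fin Hz, Measurable fun τ : Traj S A Hz => pol.score (τ i).1 (τ i).2 θ :=
    fun i => (h.measurable_score θ).comp (measurable_pi_apply i)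
  cases est with
  | reinforce b =>
    exact ((mdp.measurable_totalReward γ).sub_const b).smul
      (Finset.measurable_fun_sum _ fun _ _ => hs _)
  | gpomdp b =>
    refine Finset.measurable_fun_sum _ fun i _ => ?_
    exact (((mdp.measurable_reward.comp (measurable_pi_apply i)).const_mul _).sub_const _).smul
      (Finset.measurable_fun_sum _ fun u _ => hs u)

lemma continuous_grad (hM : 0 ≤ M) (hγ0 : 0 ≤ γ) (hγ1 : γ < 1) (τ : Traj S A Hz) :
    Continuous (est.grad mdp pol γ τ : Param d → Param d) := by
  rcases isEmpty_or_nonempty (Fin Hz) with hH | hH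
  · have : (est.grad mdp pol γ τ : Param d → Param d) = fun _ => 0 := by
      funext θ
      cases est <;> simp [Estimator.grad]
    rw [this]
    exact continuous_const
  · refine LipschitzWith.continuous (K := Real.toNNReal (est.bound R * (Hz * M)))
      (LipschitzWith.of_dist_le' (K := est.bound R * (Hz * M)) fun θ θ' => ?_)
    rw [dist_eq_norm, dist_eq_norm]
    exact h.norm_grad_sub_le mdp est hM hγ0 hγ1 τ θ θ'

/-- A Carathéodory function: continuous in the parameter, measurable in the trajectory. Joint
measurability is needed because parameters are random along a run. -/
lemma measurable_grad_uncurry (hM : 0 ≤ M) (hγ0 : 0 ≤ γ) (hγ1 : γ < 1) :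
    Measurable (fun q : Param d × Traj S A Hz => est.grad mdp pol γ q.2 q.1) :=
  measurable_uncurry_of_continuous_of_measurable
    (u := fun (θ : Param d) (τ : Traj S A Hz) => est.grad mdp pol γ τ θ)
    (fun τ => h.continuous_grad mdp est hM hγ0 hγ1 τ) (fun θ => h.measurable_grad mdp est θ)

lemma measurable_dens_uncurry :
    Measurable (fun q : Param d × (S × A) => pol.dens q.1 q.2.1 q.2.2) :=
  measurable_uncurry_of_continuous_of_measurable
    (u := fun (θ : Param d) (x : S × A) => pol.dens θ x.1 x.2)
    (fun x => (h.differentiable x.1 x.2).continuous) (fun θ => pol.measurable_dens θ)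

lemma measurable_impWeight_uncurry :
    Measurable (fun q : (Param d × Param d) × Traj S A Hz => pol.impWeight q.1.1 q.1.2 q.2) := by
  unfold Policy.impWeight
  refine Finset.measurable_fun_prod _ fun i _ => Measurable.div ?_ ?_
  · exact h.measurable_dens_uncurry.comp
      (measurable_fst.snd.prodMk ((measurable_pi_apply i).comp measurable_snd))
  · exact h.measurable_dens_uncurry.comp
      (measurable_fst.fst.prodMk ((measurable_pi_apply i).comp measurable_snd))

end SmoothPolicy

omit [MeasurableSpace S] [MeasurableSpace A] in
lemma sum_Iic_eq_sum_truncate {E : Type*} [AddCommMonoid E] (f : S × A → E) (i : Fin Hz)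
    (τ : Traj S A Hz) :
    ∑ u ∈ Finset.Iic i, f (τ u) =
      ∑ u : Fin (i + 1), f (truncate (Nat.succ_le_of_lt i.2) τ u) := by
  have : Finset.Iic i = Finset.univ.map (Fin.castLEEmb (Nat.succ_le_of_lt i.2)) := by
    ext u
    simp only [Finset.mem_Iic, Finset.mem_map, Finset.mem_univ, true_and]
    constructor
    · intro hu
      exact ⟨⟨u, Nat.lt_succ_of_le hu⟩, by ext; simp⟩
    · rintro ⟨v, rfl⟩
      exact Nat.le_of_lt_succ v.2
  rw [this, Finset.sum_map]
  rfl

/-- The gradient estimators are unbiased. -/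
lemma SmoothPolicy.integral_grad (h : SmoothPolicy pol G M) (mdp : MDP S A R) (est : Estimator Hz)
    (hG : 0 ≤ G) (hR : 0 ≤ R) (hγ0 : 0 ≤ γ) (hγ1 : γ < 1) (θ : Param d) :
    ∫ τ, est.grad mdp pol γ τ θ ∂(trajLaw mdp pol Hz θ) =
      gradient (objective mdp pol γ Hz) θ := by
  symm
  refine HasGradientAt.gradient ?_
  cases est with
  | reinforce b =>
    -- A constant baseline shifts the expectation by a constant and leaves the gradient unchanged.
    have h1 := hasGradientAt_integral_trajLaw mdp h hG (n := Hz)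
      (f := fun τ => mdp.totalReward γ τ - b) (C := R / (1 - γ) + |b|)
      ((mdp.measurable_totalReward γ).sub_const b)
      (fun τ => (abs_sub _ _).trans (add_le_add (mdp.abs_totalReward_le hR hγ0 hγ1 τ) le_rfl)) θ
    have h2 : (fun θ' => ∫ τ, (mdp.totalReward γ τ - b) ∂(trajLaw mdp pol Hz θ')) =
        fun θ' => objective mdp pol γ Hz θ' - b := by
      funext θ'
      rw [integral_sub (integrable_totalReward hR hγ0 hγ1 θ') (integrable_const _)]
      simp [objective]
    rw [h2] at h1
    have h3 := h1.hasFDerivAt.add_const b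
    simp only [sub_add_cancel] at h3
    exact hasGradientAt_iff_hasFDerivAt.2 h3
  | gpomdp b =>
    -- The reward of step `i`, minus its baseline, is a function of the first `i + 1` steps. The
    -- score formula for the law of that shorter trajectory produces exactly the partial score sum
    -- of GPOMDP.
    let f : (i : Fin Hz) → Traj S A (i + 1) → ℝ := fun i τ =>
      γ ^ (i : ℕ) * mdp.reward (τ (Fin.last i)).1 (τ (Fin.last i)).2 - b i
    have hfm : ∀ i, Measurable (f i) := fun i =>
      ((mdp.measurable_reward.comp (measurable_pi_apply (Fin.last (i : ℕ)))).const_mul _).sub_const _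
    have hfb : ∀ i τ, |f i τ| ≤ R + |b i| := fun i τ =>
      (abs_sub _ _).trans (add_le_add (mdp.abs_discounted_le hγ0 hγ1 i _ _) le_rfl)
    have hle : ∀ i : Fin Hz, (i : ℕ) + 1 ≤ Hz := fun i => Nat.succ_le_of_lt i.2
    have h1 : ∀ i : Fin Hz, HasGradientAt (fun θ' => ∫ τ, f i τ ∂(trajLaw mdp pol (i + 1) θ'))
        (∫ τ, f i τ • pol.trajScore θ τ ∂(trajLaw mdp pol (i + 1) θ)) θ := fun i =>
      hasGradientAt_integral_trajLaw mdp h hG (hfm i) (hfb i) θ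
    have hmi : ∀ i : Fin Hz, Measurable fun τ : Traj S A (i + 1) => f i τ • pol.trajScore θ τ := fun i =>
      (hfm i).smul (h.measurable_trajScore θ)
    have hint : ∀ (i : Fin Hz) θ', Integrable (fun τ : Traj S A Hz => f i (truncate (hle i) τ))
        (trajLaw mdp pol Hz θ') := fun i θ' =>
      Integrable.of_bound ((hfm i).comp (measurable_truncate _)).aestronglyMeasurable _
        (Filter.Eventually.of_forall fun τ => hfb i _)
    have h2 : ∀ θ', ∑ i : Fin Hz, ∫ τ, f i τ ∂(trajLaw mdp pol (i + 1) θ') =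
        objective mdp pol γ Hz θ' - ∑ i, b i := by
      intro θ'
      have : ∀ τ : Traj S A Hz, mdp.totalReward γ τ - ∑ i, b i =
          ∑ i, f i (truncate (hle i) τ) := fun τ => by
        rw [MDP.totalReward, ← Finset.sum_sub_distrib]
        rfl
      simp_rw [fun i => (integral_truncate mdp pol θ' (hle i) (hfm i).stronglyMeasurable).symm]
      rw [← integral_finsetSum _ fun i _ => hint i θ', objective]
      simp_rw [← this]
      rw [integral_sub (integrable_totalReward hR hγ0 hγ1 θ') (integrable_const _)]
      simp
    have h3 : ∀ τ : Traj S A Hz, (Estimator.gpomdp b).grad mdp pol γ τ θ =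
        ∑ i, f i (truncate (hle i) τ) • pol.trajScore θ (truncate (hle i) τ) := fun τ => by
      simp only [Estimator.grad]
      refine Finset.sum_congr rfl fun i _ => ?_
      rw [sum_Iic_eq_sum_truncate (fun x => pol.score x.1 x.2 θ)]
      rfl
    simp_rw [h3]
    rw [integral_finsetSum]
    · simp_rw [fun i => integral_truncate mdp pol θ (hle i) (hmi i).stronglyMeasurable]
      have h4 := HasFDerivAt.fun_sum (u := Finset.univ) fun i _ => (h1 i).hasFDerivAt
      simp_rw [h2] at h4
      have h5 := h4.add_const (∑ i, b i)
      simp only [sub_add_cancel] at h5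
      rw [hasGradientAt_iff_hasFDerivAt, map_sum]
      exact h5
    · intro i _
      refine Integrable.of_bound ((hmi i).comp (measurable_truncate _)).aestronglyMeasurable
        ((R + |b i|) * ((i + 1 : ℕ) * G)) (Filter.Eventually.of_forall fun τ => ?_)
      rw [norm_smul]
      exact mul_le_mul (hfb i _) (h.norm_trajScore_le θ _) (norm_nonneg _)
        ((abs_nonneg _).trans (hfb i (truncate (hle i) τ)))

end Objective

/-! ### Second moments of sums of independent vectors -/

section ProductSpace

variable {ι : Type*} [Fintype ι] {X : ι → Type*} [∀ i, MeasurableSpace (X i)]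
  (μ : ∀ i, Measure (X i)) [∀ i, IsProbabilityMeasure (μ i)] {d : ℕ}

lemma integrable_of_bounded {Y E : Type*} [MeasurableSpace Y] [NormedAddCommGroup E]
    (ν : Measure Y) [IsFiniteMeasure ν] {f : Y → E} (hf : AEStronglyMeasurable f ν)
    (hb : ∃ C, ∀ y, ‖f y‖ ≤ C) : Integrable f ν :=
  hb.elim fun C hC => Integrable.of_bound hf C (Filter.Eventually.of_forall hC)

lemma integral_pi_sum_eq_zero {f : ∀ i, X i → Param d} (hf : ∀ i, Measurable (f i))
    (hb : ∀ i, ∃ C, ∀ x, ‖f i x‖ ≤ C) (s : Finset ι) (h0 : ∀ i ∈ s, ∫ x, f i x ∂(μ i) = 0) :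
    ∫ x, ∑ i ∈ s, f i (x i) ∂(Measure.pi μ) = 0 := by
  rw [integral_finsetSum]
  · refine Finset.sum_eq_zero fun i hi => ?_
    rw [integral_comp_eval (hf i).aestronglyMeasurable, h0 i hi]
  · exact fun i _ => integrable_of_bounded _
      ((hf i).comp (measurable_pi_apply i)).aestronglyMeasurable
      ((hb i).imp fun C hC x => hC (x i))

open scoped RealInnerProductSpace in
-- Pythagoras: independent centred vectors are orthogonal in mean to each other and to the constant
-- `w`.
lemma integral_pi_norm_add_sum_sq {f : ∀ i, X i → Param d} (hf : ∀ i, Measurable (f i))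
    (hb : ∀ i, ∃ C, ∀ x, ‖f i x‖ ≤ C) (s : Finset ι) (h0 : ∀ i ∈ s, ∫ x, f i x ∂(μ i) = 0)
    (w : Param d) :
    ∫ x, ‖w + ∑ i ∈ s, f i (x i)‖ ^ 2 ∂(Measure.pi μ) =
      ‖w‖ ^ 2 + ∑ i ∈ s, ∫ x, ‖f i x‖ ^ 2 ∂(μ i) := by
  classical
  have hfe : ∀ i, Measurable fun x : ∀ i, X i => f i (x i) := fun i =>
    (hf i).comp (measurable_pi_apply i)
  have hint : ∀ i, Integrable (fun x : ∀ i, X i => f i (x i)) (Measure.pi μ) := fun i =>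
    integrable_of_bounded _ (hfe i).aestronglyMeasurable ((hb i).imp fun C hC x => hC (x i))
  have hinn : ∀ i j, Integrable (fun x : ∀ i, X i => ⟪f i (x i), f j (x j)⟫) (Measure.pi μ) := by
    intro i j
    obtain ⟨C, hC⟩ := hb i
    obtain ⟨C', hC'⟩ := hb j
    refine integrable_of_bounded _ ((hfe i).inner (hfe j)).aestronglyMeasurable
      ⟨C * C', fun x => (norm_inner_le_norm _ _).trans ?_⟩
    exact mul_le_mul (hC _) (hC' _) (norm_nonneg _) ((norm_nonneg _).trans (hC (x i)))
  have hcross : ∀ i ∈ s, ∀ j ∈ s, ∫ x, ⟪f i (x i), f j (x j)⟫ ∂(Measure.pi μ) =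
      if i = j then ∫ x, ‖f i x‖ ^ 2 ∂(μ i) else 0 := by
    intro i hi j hj
    split_ifs with hij
    · subst hij
      simp_rw [real_inner_self_eq_norm_sq]
      exact integral_comp_eval (f := fun y => ‖f i y‖ ^ 2)
        ((hf i).norm.pow_const 2).aestronglyMeasurable
    · have hind := (iIndepFun_pi (μ := μ) (X := f) fun i => (hf i).aemeasurable).indepFun hij
      have := hind.integral_bilin (hint i) (hint j) (innerSL ℝ)
      rw [integral_comp_eval (hf i).aestronglyMeasurable, h0 i hi] at this
      exact this.trans (by simp)
  have hexp : ∀ x : ∀ i, X i, ‖w + ∑ i ∈ s, f i (x i)‖ ^ 2 =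
      ‖w‖ ^ 2 + 2 * ⟪w, ∑ i ∈ s, f i (x i)⟫ + ∑ i ∈ s, ∑ j ∈ s, ⟪f i (x i), f j (x j)⟫ := by
    intro x
    rw [norm_add_sq_real, ← real_inner_self_eq_norm_sq (∑ i ∈ s, f i (x i)), sum_inner]
    simp_rw [inner_sum]
  have hsum : Integrable (fun x : ∀ i, X i => ∑ i ∈ s, f i (x i)) (Measure.pi μ) :=
    integrable_finsetSum _ fun i _ => hint i
  simp_rw [hexp]
  rw [integral_add, integral_add (integrable_const _) ((hsum.const_inner w).const_mul 2),
    integral_const_mul, integral_inner hsum, integral_pi_sum_eq_zero μ hf hb s h0,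
    integral_finsetSum _ fun i _ => integrable_finsetSum _ fun j _ => hinn i j]
  · simp_rw [fun i => integral_finsetSum s fun j _ => hinn i j]
    rw [Finset.sum_congr rfl fun i hi => Finset.sum_congr rfl fun j hj => hcross i hi j hj]
    simp
  · exact (integrable_const _).add ((hsum.const_inner w).const_mul 2)
  · exact integrable_finsetSum _ fun i _ => integrable_finsetSum _ fun j _ => hinn i j

end ProductSpace

/-! ### The sampling kernel -/

/-- It suffices to test on boxes, which form a generating π-system and on which the product measure
is a finite product. -/
lemma measurable_measure_pi {β ι : Type*} [MeasurableSpace β] [Fintype ι] {X : ι → Type*}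
    [∀ i, MeasurableSpace (X i)] {μ : β → ∀ i, Measure (X i)}
    [∀ b i, IsProbabilityMeasure (μ b i)] (h : ∀ i, Measurable fun b => μ b i) :
    Measurable fun b => Measure.pi (μ b) := by
  refine Measurable.measure_of_isPiSystem_of_isProbabilityMeasure generateFrom_pi.symm
    isPiSystem_pi ?_
  rintro _ ⟨t, ht, rfl⟩
  simp_rw [Measure.pi_pi]
  exact Finset.measurable_fun_prod _ fun i _ =>
    (Measure.measurable_coe (ht i (Set.mem_univ i))).comp (h i)

section Sampling

variable {S A : Type*} [MeasurableSpace S] [MeasurableSpace A] {R : ℝ} {d Hz K : ℕ}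
  {mdp : MDP S A R} {pol : Policy S A d} {γ G M : ℝ}

/-- Relative to the law at parameter `0` the density is jointly measurable, so the mass of a fixed
set is a measurable function of the parameter. -/
lemma SmoothPolicy.measurable_trajLaw (h : SmoothPolicy pol G M) (mdp : MDP S A R) :
    Measurable (fun θ => trajLaw mdp pol Hz θ) := by
  refine Measure.measurable_of_measurable_coe _ fun s hs => ?_
  have e : ∀ θ, trajLaw mdp pol Hz θ s =
      ∫⁻ τ in s, ENNReal.ofReal (pol.impWeight 0 θ τ) ∂(trajLaw mdp pol Hz 0) := fun θ => by
    rw [trajLaw_eq_withDensity mdp pol 0 θ, withDensity_apply _ hs]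
  simp_rw [e]
  refine Measurable.lintegral_prod_right' (f := fun q : Param d × Traj S A Hz =>
    ENNReal.ofReal (pol.impWeight 0 q.1 q.2)) (Measurable.ennreal_ofReal ?_)
  exact h.measurable_impWeight_uncurry.comp
    ((measurable_const.prodMk measurable_fst).prodMk measurable_snd)

/-- The law of independent batches of `n` trajectories of `K` agents with parameters `θ`. -/
def batchLaw (mdp : MDP S A R) (pol : Policy S A d) (Hz n : ℕ) (θ : Fin K → Param d) :
    Measure (Fin K → Fin n → Traj S A Hz) :=
  Measure.pi (fun k => Measure.pi (fun _ : Fin n => trajLaw mdp pol Hz (θ k)))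

instance (n : ℕ) (θ : Fin K → Param d) : IsProbabilityMeasure (batchLaw mdp pol Hz n θ) := by
  unfold batchLaw; infer_instance

lemma SmoothPolicy.measurable_batchLaw (h : SmoothPolicy pol G M) (mdp : MDP S A R) (n : ℕ) :
    Measurable (batchLaw mdp pol Hz n : (Fin K → Param d) → _) :=
  measurable_measure_pi fun k => measurable_measure_pi fun _ =>
    (h.measurable_trajLaw mdp).comp (measurable_pi_apply k)

/-- A one-trajectory estimator which depends on the current and the previous parameters `z`, with
its mean `m` and a bound `q` of its variance under the trajectory law at the current one. -/
structure IsSampler (mdp : MDP S A R) (pol : Policy S A d)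
    (φ : Param d × Param d → Traj S A Hz → Param d) (m : Param d × Param d → Param d)
    (q : Param d × Param d → ℝ) : Prop where
  measurable : Measurable (Function.uncurry φ)
  measurable_mean : Measurable m
  bounded : ∀ z, ∃ C, ∀ τ, ‖φ z τ‖ ≤ C
  mean : ∀ z, ∫ τ, φ z τ ∂(trajLaw mdp pol Hz z.1) = m z
  variance : ∀ z, ∫ τ, ‖φ z τ - m z‖ ^ 2 ∂(trajLaw mdp pol Hz z.1) ≤ q z

namespace IsSampler

variable {φ : Param d × Param d → Traj S A Hz → Param d} {m : Param d × Param d → Param d}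
    {q : Param d × Param d → ℝ}

lemma nonneg (hφ : IsSampler mdp pol φ m q) (z : Param d × Param d) : 0 ≤ q z :=
  (integral_nonneg fun _ => sq_nonneg _).trans (hφ.variance z)

lemma measurable_right (hφ : IsSampler mdp pol φ m q) (z : Param d × Param d) :
    Measurable (φ z) := hφ.measurable.of_uncurry_left

lemma integral_sub_mean (hφ : IsSampler mdp pol φ m q) (z : Param d × Param d) :
    ∫ τ, (φ z τ - m z) ∂(trajLaw mdp pol Hz z.1) = 0 := by
  rw [integral_sub (integrable_of_bounded _ (hφ.measurable_right z).aestronglyMeasurable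
    (hφ.bounded z)) (integrable_const _), hφ.mean]
  simp

/-- The centred average of a batch. -/
def noise (φ : Param d × Param d → Traj S A Hz → Param d) (m : Param d × Param d → Param d)
    (n : ℕ) (z : Param d × Param d) (τ : Fin n → Traj S A Hz) : Param d :=
  (n : ℝ)⁻¹ • ∑ i, φ z (τ i) - m z

omit [MeasurableSpace S] [MeasurableSpace A] in
lemma noise_eq {n : ℕ} (hn : 1 ≤ n) (z : Param d × Param d) (τ : Fin n → Traj S A Hz) :
    noise φ m n z τ = ∑ i, (n : ℝ)⁻¹ • (φ z (τ i) - m z) := by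
  have : (n : ℝ) ≠ 0 := by positivity
  rw [noise, ← Finset.smul_sum, Finset.sum_sub_distrib, smul_sub]
  simp [← Nat.cast_smul_eq_nsmul ℝ, smul_smul, this]

lemma measurable_noise (hφ : IsSampler mdp pol φ m q) (n : ℕ) :
    Measurable (fun x : (Param d × Param d) × (Fin n → Traj S A Hz) => noise φ m n x.1 x.2) := by
  have h1 : Measurable fun x : (Param d × Param d) × (Fin n → Traj S A Hz) =>
      ∑ i, φ x.1 (x.2 i) := Finset.measurable_fun_sum _ fun i _ => hφ.measurable.comp
    (measurable_fst.prodMk ((measurable_pi_apply i).comp measurable_snd))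
  exact (h1.const_smul (n : ℝ)⁻¹).sub (hφ.measurable_mean.comp measurable_fst)

lemma measurable_add_sum_noise (hφ : IsSampler mdp pol φ m q) (n : ℕ) (s : Finset (Fin K))
    (a : ℝ) : Measurable fun b : (Param d × (Fin K → Param d × Param d)) ×
      (Fin K → Fin n → Traj S A Hz) => b.1.1 + ∑ k ∈ s, a • noise φ m n (b.1.2 k) (b.2 k) := by
  have h0 : ∀ k, Measurable fun b : (Param d × (Fin K → Param d × Param d)) ×
      (Fin K → Fin n → Traj S A Hz) => (b.1.2 k, b.2 k) := fun k => by fun_prop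
  have h1 : ∀ k, Measurable fun b : (Param d × (Fin K → Param d × Param d)) ×
      (Fin K → Fin n → Traj S A Hz) => a • noise φ m n (b.1.2 k) (b.2 k) := fun k =>
    ((hφ.measurable_noise n).comp (h0 k)).const_smul a
  exact measurable_fst.fst.add (Finset.measurable_fun_sum _ fun k _ => h1 k)

lemma bounded_noise (hφ : IsSampler mdp pol φ m q) {n : ℕ} (hn : 1 ≤ n)
    (z : Param d × Param d) : ∃ C, ∀ τ, ‖noise φ m n z τ‖ ≤ C := by
  obtain ⟨C, hC⟩ := hφ.bounded z
  refine ⟨∑ _i : Fin n, (n : ℝ)⁻¹ * (C + ‖m z‖), fun τ => ?_⟩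
  rw [noise_eq hn]
  refine norm_sum_le_of_le _ fun i _ => ?_
  rw [norm_smul, Real.norm_of_nonneg (by positivity)]
  gcongr
  exact (norm_sub_le _ _).trans (by gcongr; exact hC _)

section

variable (hφ : IsSampler mdp pol φ m q) {n : ℕ} (hn : 1 ≤ n) (z : Param d × Param d)
include hφ hn

lemma integral_noise :
    ∫ τ, noise φ m n z τ ∂(Measure.pi fun _ : Fin n => trajLaw mdp pol Hz z.1) = 0 := by
  simp_rw [noise_eq hn]
  refine integral_pi_sum_eq_zero (fun _ : Fin n => trajLaw mdp pol Hz z.1)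
    (f := fun _ τ => (n : ℝ)⁻¹ • (φ z τ - m z))
    (fun _ => ((hφ.measurable_right z).sub_const (m z)).const_smul (n : ℝ)⁻¹) (fun _ => ?_) _ fun _ _ => ?_
  · obtain ⟨C, hC⟩ := hφ.bounded z
    refine ⟨(n : ℝ)⁻¹ * (C + ‖m z‖), fun τ => ?_⟩
    rw [norm_smul, Real.norm_of_nonneg (by positivity)]
    gcongr
    exact (norm_sub_le _ _).trans (by gcongr; exact hC _)
  · rw [integral_smul, hφ.integral_sub_mean, smul_zero]

lemma integral_norm_noise_sq_le :
    ∫ τ, ‖noise φ m n z τ‖ ^ 2 ∂(Measure.pi fun _ : Fin n => trajLaw mdp pol Hz z.1) ≤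
      q z / n := by
  simp_rw [noise_eq hn]
  have := integral_pi_norm_add_sum_sq (fun _ : Fin n => trajLaw mdp pol Hz z.1)
    (f := fun _ τ => (n : ℝ)⁻¹ • (φ z τ - m z))
    (fun _ => ((hφ.measurable_right z).sub_const (m z)).const_smul (n : ℝ)⁻¹) (fun _ => ?_) Finset.univ
    (fun _ _ => ?_) 0
  · simp only [zero_add, norm_zero, ne_eq, OfNat.ofNat_ne_zero, not_false_eq_true, zero_pow] at this
    rw [this]
    simp_rw [norm_smul, mul_pow, integral_const_mul]
    rw [Finset.sum_const, Finset.card_univ, Fintype.card_fin, nsmul_eq_mul,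
      Real.norm_of_nonneg (by positivity)]
    have hn' : (n : ℝ) ≠ 0 := by positivity
    calc (n : ℝ) * ((n : ℝ)⁻¹ ^ 2 * ∫ τ, ‖φ z τ - m z‖ ^ 2 ∂(trajLaw mdp pol Hz z.1))
        = (∫ τ, ‖φ z τ - m z‖ ^ 2 ∂(trajLaw mdp pol Hz z.1)) / n := by field_simp
      _ ≤ q z / n := by gcongr; exact hφ.variance z
  · obtain ⟨C, hC⟩ := hφ.bounded z
    refine ⟨(n : ℝ)⁻¹ * (C + ‖m z‖), fun τ => ?_⟩
    rw [norm_smul, Real.norm_of_nonneg (by positivity)]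
    gcongr
    exact (norm_sub_le _ _).trans (by gcongr; exact hC _)
  · rw [integral_smul, hφ.integral_sub_mean, smul_zero]

end

/-- This is the conditional estimate with the past frozen: `w` and `z` are deterministic here. The
Lebesgue-integral form allows integrating it over the past before integrability along the run is
known. -/
lemma lintegral_batchLaw_le (hφ : IsSampler mdp pol φ m q) {n : ℕ} (hn : 1 ≤ n)
    (z : Fin K → Param d × Param d) (s : Finset (Fin K)) (a : ℝ) (w : Param d) :
    ∫⁻ x, ‖w + ∑ k ∈ s, a • noise φ m n (z k) (x k)‖ₑ ^ 2
        ∂(batchLaw mdp pol Hz n fun k => (z k).1) ≤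
      ENNReal.ofReal (‖w‖ ^ 2 + a ^ 2 / n * ∑ k ∈ s, q (z k)) := by
  have hm : ∀ k, Measurable fun τ => a • noise φ m n (z k) τ := fun k =>
    ((hφ.measurable_noise n).comp measurable_prodMk_left).const_smul a
  have hb : ∀ k, ∃ C, ∀ τ, ‖a • noise φ m n (z k) τ‖ ≤ C := fun k => by
    obtain ⟨C, hC⟩ := hφ.bounded_noise hn (z k)
    refine ⟨|a| * C, fun τ => ?_⟩
    rw [norm_smul]
    exact mul_le_mul_of_nonneg_left (hC τ) (abs_nonneg a)
  have hmx : Measurable fun x : Fin K → Fin n → Traj S A Hz =>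
      w + ∑ k ∈ s, a • noise φ m n (z k) (x k) :=
    (Finset.measurable_fun_sum _ fun k _ => (hm k).comp (measurable_pi_apply k)).const_add w
  have hint : Integrable (fun x : Fin K → Fin n → Traj S A Hz =>
      ‖w + ∑ k ∈ s, a • noise φ m n (z k) (x k)‖ ^ 2)
      (batchLaw mdp pol Hz n fun k => (z k).1) := by
    choose C hC using hb
    refine integrable_of_bounded _ (hmx.norm.pow_const 2).aestronglyMeasurable
      ⟨(‖w‖ + ∑ k ∈ s, C k) ^ 2, fun x => ?_⟩
    rw [norm_pow, norm_norm]
    gcongr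
    exact (norm_add_le _ _).trans (by gcongr; exact norm_sum_le_of_le _ fun k _ => hC k _)
  have he : ∀ v : Param d, ‖v‖ₑ ^ 2 = ENNReal.ofReal (‖v‖ ^ 2) := fun v => by
    rw [ENNReal.ofReal_pow (norm_nonneg _), ofReal_norm]
  simp_rw [he]
  rw [← ofReal_integral_eq_lintegral_ofReal hint (Filter.Eventually.of_forall
    fun _ => sq_nonneg _)]
  refine ENNReal.ofReal_le_ofReal ?_
  have h1 := integral_pi_norm_add_sum_sq
    (fun k => Measure.pi fun _ : Fin n => trajLaw mdp pol Hz (z k).1)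
    (f := fun k τ => a • noise φ m n (z k) τ) hm hb s
    (fun k _ => by rw [integral_smul, hφ.integral_noise hn, smul_zero]) w
  rw [batchLaw, h1, Finset.mul_sum]
  gcongr with k hk
  simp_rw [norm_smul, mul_pow, integral_const_mul]
  rw [Real.norm_eq_abs, sq_abs, div_mul_eq_mul_div, mul_div_assoc]
  gcongr
  exact hφ.integral_norm_noise_sq_le hn (z k)

end IsSampler

/-! ### Conditional second moments along a run -/

namespace Run

variable {Ω : Type*} [mΩ : MeasurableSpace Ω] {P : Measure Ω} [IsProbabilityMeasure P]
  {est : Estimator Hz} {inp : Input d}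
  {agg : (Fin K → Param d) → Param d} {proto : Protocol K d}
  {Hon : ℕ → Finset (Fin K)} {T : ℕ}

/-- The trajectories which are drawn in iteration `t` if the coin shows `c`. -/
def batchTraj (run : Run P mdp pol γ est inp agg proto Hon T) (t : ℕ) (c : Bool) (ω : Ω) :
    Fin K → Fin (inp.batch t c) → Traj S A Hz :=
  fun k i => run.traj t k i ω

/-- The probability that the coin shows `c`. -/
def _root_.DecByzPG.Input.coinProb (inp : Input d) (c : Bool) : ℝ :=
  if c = true then inp.p else 1 - inp.p

variable (run : Run P mdp pol γ est inp agg proto Hon T)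

omit [IsProbabilityMeasure P] in
lemma measurableSet_coin {t : ℕ} (ht : t < T) (c : Bool) :
    MeasurableSet {ω | run.coin t ω = c} :=
  (run.ℱ.le (t + 1)) _ (run.measurable_coin t ht (measurableSet_singleton c))

omit [IsProbabilityMeasure P] in
lemma measurable_batchTraj {t : ℕ} (ht : t < T) (c : Bool) : Measurable (run.batchTraj t c) :=
  measurable_pi_iff.2 fun k => measurable_pi_iff.2 fun i =>
    (run.measurable_traj t ht k i).mono (run.ℱ.le _) le_rfl

/-- Here the sampling law of the run becomes a Fubini formula: `Y` carries all that is needed from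
the past, in particular the parameters that determine the batch law. -/
lemma lintegral_coin (h : SmoothPolicy pol G M) {t : ℕ} (ht : t < T) (c : Bool) {β : Type*}
    [MeasurableSpace β] {Y : Ω → β} (hY : Measurable[run.ℱ t] Y) {ϑ : β → Fin K → Param d}
    (hϑ : Measurable ϑ) (hϑY : ∀ ω k, ϑ (Y ω) k = run.θ t k ω)
    {f : β × (Fin K → Fin (inp.batch t c) → Traj S A Hz) → ℝ≥0∞} (hf : Measurable f) :
    ∫⁻ ω in {ω | run.coin t ω = c}, f (Y ω, run.batchTraj t c ω) ∂P =
      ENNReal.ofReal (inp.coinProb c) *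
        ∫⁻ ω, ∫⁻ x, f (Y ω, x) ∂(batchLaw mdp pol Hz (inp.batch t c) (ϑ (Y ω))) ∂P := by
  have hY' : Measurable Y := hY.mono (run.ℱ.le t) le_rfl
  have hX := run.measurable_batchTraj ht c
  let κ : Kernel β (Fin K → Fin (inp.batch t c) → Traj S A Hz) :=
    ⟨fun b => batchLaw mdp pol Hz (inp.batch t c) (ϑ b), (h.measurable_batchLaw mdp _).comp hϑ⟩
  have : IsMarkovKernel κ := ⟨fun b => by
    change IsProbabilityMeasure (batchLaw mdp pol Hz (inp.batch t c) (ϑ b)); infer_instance⟩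
  have hprob : IsProbabilityMeasure (P.map Y) := Measure.isProbabilityMeasure_map hY'.aemeasurable
  have key : (P.restrict {ω | run.coin t ω = c}).map (fun ω => (Y ω, run.batchTraj t c ω)) =
      ENNReal.ofReal (inp.coinProb c) • (P.map Y ⊗ₘ κ) := by
    -- On rectangles, with one side an event of the past and the other an event for the batch, the
    -- identity is the defining property `law`.
    refine Measure.ext_prod fun {B U} hB hU => ?_
    rw [Measure.map_apply (hY'.prodMk hX) (hB.prod hU), Measure.smul_apply,
      Measure.compProd_apply_prod hB hU, smul_eq_mul,
      setLIntegral_map hB (Kernel.measurable_coe κ hU) hY',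
      Measure.restrict_apply ((hY'.prodMk hX) (hB.prod hU))]
    have h1 := run.law t ht (Y ⁻¹' B) (hY hB) c U hU
    have h2 : ∀ ω, κ (Y ω) U = Measure.pi (fun k => Measure.pi
        (fun _ : Fin (inp.batch t c) => trajLaw mdp pol Hz (run.θ t k ω))) U := fun ω => by
      change batchLaw mdp pol Hz (inp.batch t c) (ϑ (Y ω)) U = _
      simp_rw [batchLaw, hϑY]
    simp_rw [h2]
    rw [Input.coinProb, ← h1]
    congr 1
    ext ω
    simp only [Set.mem_inter_iff, Set.mem_preimage, Set.mem_prod, Set.mem_ofPred_eq]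
    tauto
  calc ∫⁻ ω in {ω | run.coin t ω = c}, f (Y ω, run.batchTraj t c ω) ∂P
      = ∫⁻ x, f x ∂((P.restrict {ω | run.coin t ω = c}).map
          (fun ω => (Y ω, run.batchTraj t c ω))) := (lintegral_map hf (hY'.prodMk hX)).symm
    _ = _ := by
      rw [key, lintegral_smul_measure, Measure.lintegral_compProd hf,
        lintegral_map (Measurable.lintegral_kernel_prod_right' hf) hY']
      rfl

/-- Given the past and the coin, the centred batch averages are uncorrelated with mean zero. -/
lemma integral_coin_le (h : SmoothPolicy pol G M) {t : ℕ} (ht : t < T) (c : Bool)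
    (hn : 1 ≤ inp.batch t c) (hp : 0 ≤ inp.coinProb c)
    {φ : Param d × Param d → Traj S A Hz → Param d} {m : Param d × Param d → Param d}
    {q : Param d × Param d → ℝ} (hφ : IsSampler mdp pol φ m q) (s : Finset (Fin K)) (a : ℝ)
    {w : Ω → Param d} (hw : Measurable[run.ℱ t] w) (hw2 : Integrable (fun ω => ‖w ω‖ ^ 2) P)
    (hq : ∀ k ∈ s, Integrable (fun ω => q (run.θ t k ω, run.θ (t - 1) k ω)) P) :
    IntegrableOn (fun ω => ‖w ω + ∑ k ∈ s, a • IsSampler.noise φ m (inp.batch t c)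
        (run.θ t k ω, run.θ (t - 1) k ω) (run.batchTraj t c ω k)‖ ^ 2)
        {ω | run.coin t ω = c} P ∧
      ∫ ω in {ω | run.coin t ω = c}, ‖w ω + ∑ k ∈ s, a • IsSampler.noise φ m (inp.batch t c)
        (run.θ t k ω, run.θ (t - 1) k ω) (run.batchTraj t c ω k)‖ ^ 2 ∂P ≤
      inp.coinProb c * (∫ ω, ‖w ω‖ ^ 2 ∂P + a ^ 2 / (inp.batch t c) *
        ∑ k ∈ s, ∫ ω, q (run.θ t k ω, run.θ (t - 1) k ω) ∂P) := by
  set n := inp.batch t c with hn_def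
  -- The integrand depends on the past only through `w` and the current and previous parameters.
  let Y : Ω → Param d × (Fin K → Param d × Param d) :=
    fun ω => (w ω, fun k => (run.θ t k ω, run.θ (t - 1) k ω))
  have hY : Measurable[run.ℱ t] Y := by
    have h1 : ∀ k, Measurable[run.ℱ t] fun ω => (run.θ t k ω, run.θ (t - 1) k ω) := fun k =>
      (run.measurable_θ t ht.le k).prodMk ((run.measurable_θ (t - 1)
        ((Nat.sub_le _ _).trans ht.le) k).mono (run.ℱ.mono (Nat.sub_le _ _)) le_rfl)
    exact hw.prodMk (@measurable_pi_lambda Ω (Fin K) (fun _ => Param d × Param d) (run.ℱ t) _ _ h1)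
  let F : (Param d × (Fin K → Param d × Param d)) × (Fin K → Fin n → Traj S A Hz) → Param d :=
    fun b => b.1.1 + ∑ k ∈ s, a • IsSampler.noise φ m n (b.1.2 k) (b.2 k)
  have hF : Measurable F := hφ.measurable_add_sum_noise n s a
  have hY' : Measurable Y := hY.mono (run.ℱ.le t) le_rfl
  have hX := run.measurable_batchTraj ht c
  have hFm : Measurable fun ω => F (Y ω, run.batchTraj t c ω) := hF.comp (hY'.prodMk hX)
  have hbint : Integrable (fun ω => ‖w ω‖ ^ 2 + a ^ 2 / n *
      ∑ k ∈ s, q (run.θ t k ω, run.θ (t - 1) k ω)) P :=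
    hw2.add ((integrable_finsetSum _ fun k hk => hq k hk).const_mul _)
  have hbnn : ∀ ω, 0 ≤ ‖w ω‖ ^ 2 + a ^ 2 / n *
      ∑ k ∈ s, q (run.θ t k ω, run.θ (t - 1) k ω) := fun ω =>
    add_nonneg (sq_nonneg _) (mul_nonneg (by positivity)
      (Finset.sum_nonneg fun k _ => hφ.nonneg _))
  have hbI : ∫ ω, (‖w ω‖ ^ 2 + a ^ 2 / n *
      ∑ k ∈ s, q (run.θ t k ω, run.θ (t - 1) k ω)) ∂P =
      ∫ ω, ‖w ω‖ ^ 2 ∂P + a ^ 2 / n *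
        ∑ k ∈ s, ∫ ω, q (run.θ t k ω, run.θ (t - 1) k ω) ∂P := by
    rw [integral_add hw2 ((integrable_finsetSum _ fun k hk => hq k hk).const_mul _),
      integral_const_mul, integral_finsetSum _ fun k hk => hq k hk]
  have hle : ∫⁻ ω in {ω | run.coin t ω = c}, ‖F (Y ω, run.batchTraj t c ω)‖ₑ ^ 2 ∂P ≤
      ENNReal.ofReal (inp.coinProb c * (∫ ω, ‖w ω‖ ^ 2 ∂P + a ^ 2 / n *
        ∑ k ∈ s, ∫ ω, q (run.θ t k ω, run.θ (t - 1) k ω) ∂P)) := by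
    rw [run.lintegral_coin h ht c (Y := Y) hY (ϑ := fun b k => (b.2 k).1)
      (measurable_pi_iff.2 fun k => ((measurable_pi_apply k).comp measurable_snd).fst)
      (fun ω k => rfl) (f := fun b => ‖F b‖ₑ ^ 2) (hF.enorm.pow_const 2),
      ENNReal.ofReal_mul hp, ← hbI, ofReal_integral_eq_lintegral_ofReal hbint
        (Filter.Eventually.of_forall hbnn)]
    gcongr with ω
    exact hφ.lintegral_batchLaw_le hn _ s a (w ω)
  have he : ∀ v : Param d, ‖v‖ₑ ^ 2 = ENNReal.ofReal (‖v‖ ^ 2) := fun v => by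
    rw [ENNReal.ofReal_pow (norm_nonneg _), ofReal_norm]
  simp_rw [he] at hle
  have hmeas : AEStronglyMeasurable (fun ω => ‖F (Y ω, run.batchTraj t c ω)‖ ^ 2)
      (P.restrict {ω | run.coin t ω = c}) := (hFm.norm.pow_const 2).aestronglyMeasurable
  refine ⟨⟨hmeas, ?_⟩, ?_⟩
  · rw [hasFiniteIntegral_iff_ofReal (Filter.Eventually.of_forall fun _ => sq_nonneg _)]
    exact hle.trans_lt ENNReal.ofReal_lt_top
  · change ∫ ω in {ω | run.coin t ω = c}, ‖F (Y ω, run.batchTraj t c ω)‖ ^ 2 ∂P ≤ _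
    rw [integral_eq_lintegral_of_nonneg_ae (Filter.Eventually.of_forall fun _ => sq_nonneg _) hmeas]
    refine ENNReal.toReal_le_of_le_ofReal (mul_nonneg hp ?_) hle
    rw [← hbI]
    exact integral_nonneg hbnn

end Run

end Sampling

/-! ### The two local estimators -/

/-- Centring at the mean can only decrease the second moment; so a variance bound may be obtained
from a bound of the uncentred estimator. -/
lemma integral_norm_sub_mean_sq_le {Y : Type*} [MeasurableSpace Y] {ν : Measure Y}
    [IsProbabilityMeasure ν] {d : ℕ} {f : Y → Param d} (hf : Integrable f ν)
    (hf2 : Integrable (fun y => ‖f y‖ ^ 2) ν) :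
    ∫ y, ‖f y - ∫ y, f y ∂ν‖ ^ 2 ∂ν ≤ ∫ y, ‖f y‖ ^ 2 ∂ν := by
  set μ := ∫ y, f y ∂ν with hμ
  simp_rw [norm_sub_sq_real]
  have h2 : Integrable (fun y => 2 * inner ℝ (f y) μ) ν := (hf.inner_const μ).const_mul 2
  have h3 : Integrable (fun y => ‖f y‖ ^ 2 - 2 * inner ℝ (f y) μ) ν := hf2.sub h2
  have h4 : ∫ y, inner ℝ (f y) μ ∂ν = ‖μ‖ ^ 2 := by
    simp_rw [real_inner_comm μ]
    rw [integral_inner hf, ← hμ, real_inner_self_eq_norm_sq]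
  rw [integral_add h3 (integrable_const _), integral_sub hf2 h2, integral_const_mul, h4]
  simp only [integral_const, probReal_univ, smul_eq_mul, one_mul]
  nlinarith [sq_nonneg ‖μ‖]

section Samplers

variable {S A : Type*} [MeasurableSpace S] [MeasurableSpace A] {R : ℝ} {d Hz : ℕ}

/-- The estimator used with large batches. -/
def freshEstimator (mdp : MDP S A R) (pol : Policy S A d) (γ : ℝ) (est : Estimator Hz)
    (z : Param d × Param d) (τ : Traj S A Hz) : Param d :=
  est.grad mdp pol γ τ z.1

/-- The importance-weighted estimator of the change of the gradient. -/
def changeEstimator (mdp : MDP S A R) (pol : Policy S A d) (γ : ℝ) (est : Estimator Hz)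
    (z : Param d × Param d) (τ : Traj S A Hz) : Param d :=
  est.grad mdp pol γ τ z.1 - pol.impWeight z.1 z.2 τ • est.grad mdp pol γ τ z.2

/-- The constant in the variance bound of the change estimator. -/
def changeConst (est : Estimator Hz) (R G M W : ℝ) : ℝ :=
  2 * (est.bound R * (Hz * M)) ^ 2 + 2 * (est.bound R * (Hz * G)) ^ 2 * W

lemma changeConst_nonneg (est : Estimator Hz) (R G M : ℝ) {W : ℝ} (hW : 0 ≤ W) :
    0 ≤ changeConst est R G M W := by
  unfold changeConst; positivity

variable {mdp : MDP S A R} {pol : Policy S A d} {γ G M σ W : ℝ} {est : Estimator Hz}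

lemma SmoothPolicy.measurable_gradient_objective (h : SmoothPolicy pol G M) (mdp : MDP S A R)
    (hG : 0 ≤ G) (hR : 0 ≤ R) (hγ0 : 0 ≤ γ) (hγ1 : γ < 1) :
    Measurable (gradient (objective mdp pol γ Hz)) := by
  refine Continuous.measurable (LipschitzWith.continuous (LipschitzWith.of_dist_le'
    (K := smoothConst Hz R γ G M) fun θ θ' => ?_))
  rw [dist_eq_norm, dist_eq_norm]
  exact h.norm_gradient_objective_sub_le mdp hG hR hγ0 hγ1 θ θ'

lemma SmoothPolicy.measurable_grad_comp (h : SmoothPolicy pol G M) (mdp : MDP S A R)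
    (est : Estimator Hz) (hM : 0 ≤ M) (hγ0 : 0 ≤ γ) (hγ1 : γ < 1) {Y : Type*} [MeasurableSpace Y]
    {θ : Y → Param d} {τ : Y → Traj S A Hz} (hθ : Measurable θ) (hτ : Measurable τ) :
    Measurable fun y => est.grad mdp pol γ (τ y) (θ y) := by
  have h1 : Measurable fun y => (θ y, τ y) := hθ.prodMk hτ
  have h2 := (h.measurable_grad_uncurry mdp est hM hγ0 hγ1).comp h1
  exact h2

lemma SmoothPolicy.measurable_impWeight_comp (h : SmoothPolicy pol G M) {Y : Type*}
    [MeasurableSpace Y] {θ θ' : Y → Param d} {τ : Y → Traj S A Hz} (hθ : Measurable θ)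
    (hθ' : Measurable θ') (hτ : Measurable τ) :
    Measurable fun y => pol.impWeight (θ y) (θ' y) (τ y) := by
  have h1 : Measurable fun y => ((θ y, θ' y), τ y) := (hθ.prodMk hθ').prodMk hτ
  have h2 := h.measurable_impWeight_uncurry.comp h1
  exact h2

variable (hA : Assumptions mdp pol γ est G M σ W) (hG : 0 ≤ G) (hM : 0 ≤ M) (hR : 0 ≤ R)
  (hγ0 : 0 ≤ γ) (hγ1 : γ < 1) (hW : 0 ≤ W)

include hA hG hM hR hγ0 hγ1 in
lemma isSampler_freshEstimator :
    IsSampler mdp pol (freshEstimator mdp pol γ est)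
      (fun z => gradient (objective mdp pol γ Hz) z.1) (fun _ => σ ^ 2) where
  measurable := hA.smoothPolicy.measurable_grad_comp mdp est hM hγ0 hγ1 measurable_fst.fst
    measurable_snd
  measurable_mean := (hA.smoothPolicy.measurable_gradient_objective mdp hG hR hγ0 hγ1).comp
    measurable_fst
  bounded z := ⟨_, fun τ => hA.smoothPolicy.norm_grad_le mdp est hG hγ0 hγ1 τ z.1⟩
  mean z := hA.smoothPolicy.integral_grad mdp est hG hR hγ0 hγ1 z.1
  variance z := by
    have h1 := hA.variance_le z.1
    unfold freshEstimator
    have hm := ((hA.smoothPolicy.measurable_grad (γ := γ) mdp est z.1).sub_const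
      (gradient (objective mdp pol γ Hz) z.1)).norm.pow_const 2
    rw [integral_eq_lintegral_of_nonneg_ae (Filter.Eventually.of_forall fun _ => sq_nonneg _)
      hm.aestronglyMeasurable]
    refine ENNReal.toReal_le_of_le_ofReal (sq_nonneg σ) ?_
    simp_rw [ENNReal.ofReal_pow (norm_nonneg _), ofReal_norm]
    exact h1

include hA hG hM hR hγ0 hγ1 hW in
-- The weight turns the old gradient estimate into one that is unbiased under the current law. The
-- variance is quadratic in the displacement because the estimator is a Lipschitz difference plus a
-- bounded vector times `1 - ω`.
lemma isSampler_changeEstimator :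
    IsSampler mdp pol (changeEstimator mdp pol γ est)
      (fun z => gradient (objective mdp pol γ Hz) z.1 - gradient (objective mdp pol γ Hz) z.2)
      (fun z => changeConst est R G M W * ‖z.1 - z.2‖ ^ 2) := by
  have hS := hA.smoothPolicy
  have hJm := hS.measurable_gradient_objective (Hz := Hz) mdp hG hR hγ0 hγ1
  set Cg := est.bound R * (Hz * G) with hCg
  set Cl := est.bound R * (Hz * M) with hCl
  have hCg0 : 0 ≤ Cg := mul_nonneg (est.bound_nonneg hR) (by positivity)
  have hgb : ∀ (τ : Traj S A Hz) θ, ‖est.grad mdp pol γ τ θ‖ ≤ Cg :=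
    fun τ θ => hS.norm_grad_le mdp est hG hγ0 hγ1 τ θ
  have hgi : ∀ θ θ', Integrable (fun τ => est.grad mdp pol γ τ θ) (trajLaw mdp pol Hz θ') :=
    fun θ θ' => integrable_of_bounded _ (hS.measurable_grad mdp est θ).aestronglyMeasurable
      ⟨Cg, fun τ => hgb τ θ⟩
  -- This bound grows exponentially with the displacement and serves only for integrability; the
  -- variance bound below rests on the assumed variance of the weights.
  have hwb : ∀ (z : Param d × Param d) (τ : Traj S A Hz), ‖pol.impWeight z.1 z.2 τ‖ ≤
      Real.exp (Hz * (G * ‖z.2 - z.1‖)) := fun z τ => by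
    rw [Real.norm_of_nonneg (pol.impWeight_pos _ _ _).le]
    exact hS.impWeight_le _ _ _
  have hwgm : ∀ z : Param d × Param d, Measurable fun τ : Traj S A Hz =>
      pol.impWeight z.1 z.2 τ • est.grad mdp pol γ τ z.2 := fun z =>
    (pol.measurable_impWeight _ _).smul (hS.measurable_grad mdp est z.2)
  have hwgb : ∀ (z : Param d × Param d) (τ : Traj S A Hz),
      ‖pol.impWeight z.1 z.2 τ • est.grad mdp pol γ τ z.2‖ ≤
        Real.exp (Hz * (G * ‖z.2 - z.1‖)) * Cg := fun z τ => by
    rw [norm_smul]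
    exact mul_le_mul (hwb z τ) (hgb τ _) (norm_nonneg _) (Real.exp_pos _).le
  have hmean : ∀ z : Param d × Param d,
      ∫ τ, changeEstimator mdp pol γ est z τ ∂(trajLaw mdp pol Hz z.1) =
        gradient (objective mdp pol γ Hz) z.1 - gradient (objective mdp pol γ Hz) z.2 := by
    intro z
    unfold changeEstimator
    rw [integral_sub (hgi _ _) (integrable_of_bounded _ (hwgm z).aestronglyMeasurable
      ⟨_, hwgb z⟩), ← integral_trajLaw_change, hS.integral_grad mdp est hG hR hγ0 hγ1,
      hS.integral_grad mdp est hG hR hγ0 hγ1]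
  have hmeas : Measurable fun x : (Param d × Param d) × Traj S A Hz =>
      changeEstimator mdp pol γ est x.1 x.2 := by
    have m1 := hS.measurable_grad_comp mdp est hM hγ0 hγ1
      (Y := (Param d × Param d) × Traj S A Hz) measurable_fst.fst measurable_snd
    have m2 := hS.measurable_grad_comp mdp est hM hγ0 hγ1
      (Y := (Param d × Param d) × Traj S A Hz) measurable_fst.snd measurable_snd
    have m3 := hS.measurable_impWeight_comp
      (Y := (Param d × Param d) × Traj S A Hz) measurable_fst.fst measurable_fst.snd measurable_snd
    exact m1.sub (m3.smul m2)
  have hbdd : ∀ (z : Param d × Param d) (τ : Traj S A Hz), ‖changeEstimator mdp pol γ est z τ‖ ≤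
      Cg + Real.exp (Hz * (G * ‖z.2 - z.1‖)) * Cg := fun z τ =>
    (norm_sub_le _ _).trans (add_le_add (hgb τ _) (hwgb z τ))
  refine ⟨hmeas, (hJm.comp measurable_fst).sub (hJm.comp measurable_snd),
    fun z => ⟨_, hbdd z⟩, hmean, fun z => ?_⟩
  have hφm : Measurable (changeEstimator mdp pol γ est z : Traj S A Hz → Param d) := by
    have m1 := hmeas.comp (measurable_prodMk_left (x := z))
    exact m1
  have hφi := integrable_of_bounded (trajLaw mdp pol Hz z.1) hφm.aestronglyMeasurable ⟨_, hbdd z⟩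
  have hφ2 : Integrable (fun τ => ‖changeEstimator mdp pol γ est z τ‖ ^ 2)
      (trajLaw mdp pol Hz z.1) :=
    integrable_of_bounded _ (hφm.norm.pow_const 2).aestronglyMeasurable
      ⟨(Cg + Real.exp (Hz * (G * ‖z.2 - z.1‖)) * Cg) ^ 2, fun τ => by
        rw [norm_pow, norm_norm]
        exact pow_le_pow_left₀ (norm_nonneg _) (hbdd z τ) 2⟩
  have hwi : Integrable (fun τ => (1 - pol.impWeight z.1 z.2 τ) ^ 2) (trajLaw mdp pol Hz z.1) :=
    integrable_of_bounded _ ((measurable_const.sub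
      (pol.measurable_impWeight _ _)).pow_const 2).aestronglyMeasurable
      ⟨(1 + Real.exp (Hz * (G * ‖z.2 - z.1‖))) ^ 2, fun τ => by
        rw [norm_pow]
        refine pow_le_pow_left₀ (norm_nonneg _) ((norm_sub_le _ _).trans ?_) 2
        rw [norm_one]
        exact add_le_add le_rfl (hwb z τ)⟩
  -- The weight has mean one, so this second moment is its variance.
  have hvar : ∫ τ, (1 - pol.impWeight z.1 z.2 τ) ^ 2 ∂(trajLaw mdp pol Hz z.1) ≤
      W * ‖z.1 - z.2‖ ^ 2 := by
    have h1 := hA.impWeight_le z.2 z.1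
    rw [evariance, integral_impWeight, norm_sub_rev] at h1
    rw [integral_eq_lintegral_of_nonneg_ae (Filter.Eventually.of_forall fun _ => sq_nonneg _)
      hwi.aestronglyMeasurable]
    refine ENNReal.toReal_le_of_le_ofReal (by positivity) ?_
    refine le_trans (le_of_eq (lintegral_congr fun τ => ?_)) h1
    rw [← ofReal_norm, ← ENNReal.ofReal_pow (norm_nonneg _), Real.norm_eq_abs, sq_abs]
    congr 1
    ring
  have hle1 : ∫ τ, ‖changeEstimator mdp pol γ est z τ - (gradient (objective mdp pol γ Hz) z.1 -
      gradient (objective mdp pol γ Hz) z.2)‖ ^ 2 ∂(trajLaw mdp pol Hz z.1) ≤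
      ∫ τ, ‖changeEstimator mdp pol γ est z τ‖ ^ 2 ∂(trajLaw mdp pol Hz z.1) := by
    rw [← hmean z]
    exact integral_norm_sub_mean_sq_le hφi hφ2
  refine hle1.trans ?_
  have hpt : ∀ τ, ‖changeEstimator mdp pol γ est z τ‖ ^ 2 ≤
      2 * Cl ^ 2 * ‖z.1 - z.2‖ ^ 2 + 2 * Cg ^ 2 * (1 - pol.impWeight z.1 z.2 τ) ^ 2 := fun τ => by
    have e : changeEstimator mdp pol γ est z τ =
        (est.grad mdp pol γ τ z.1 - est.grad mdp pol γ τ z.2) +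
          (1 - pol.impWeight z.1 z.2 τ) • est.grad mdp pol γ τ z.2 := by
      unfold changeEstimator; module
    rw [e]
    have h1 : ‖est.grad mdp pol γ τ z.1 - est.grad mdp pol γ τ z.2‖ ^ 2 ≤
        (Cl * ‖z.1 - z.2‖) ^ 2 :=
      pow_le_pow_left₀ (norm_nonneg _) (hS.norm_grad_sub_le mdp est hM hγ0 hγ1 τ _ _) 2
    have h2 : ‖(1 - pol.impWeight z.1 z.2 τ) • est.grad mdp pol γ τ z.2‖ ^ 2 ≤
        (1 - pol.impWeight z.1 z.2 τ) ^ 2 * Cg ^ 2 := by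
      rw [norm_smul, mul_pow, Real.norm_eq_abs, sq_abs]
      gcongr
      exact hgb τ _
    have h3 : ‖(est.grad mdp pol γ τ z.1 - est.grad mdp pol γ τ z.2) +
          (1 - pol.impWeight z.1 z.2 τ) • est.grad mdp pol γ τ z.2‖ ^ 2 ≤ _ :=
      (pow_le_pow_left₀ (norm_nonneg _) (norm_add_le _ _) 2).trans add_sq_le
    nlinarith
  refine (integral_mono hφ2 ((integrable_const _).add (hwi.const_mul _)) hpt).trans ?_
  simp only [Pi.add_apply]
  rw [integral_add (integrable_const _) (hwi.const_mul _), integral_const_mul (2 * Cg ^ 2)]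
  simp only [integral_const, probReal_univ, smul_eq_mul, one_mul, changeConst]
  nlinarith [mul_le_mul_of_nonneg_left hvar (show 0 ≤ 2 * Cg ^ 2 by positivity)]

lemma localEstimate_eq_fresh (inp : Input d) (t : ℕ) (c : Bool) (hc : c = true ∨ t = 0)
    (τ : ℕ → Traj S A Hz) (θ θprev : Param d) :
    localEstimate mdp pol γ est inp t c τ θ θprev = gradient (objective mdp pol γ Hz) θ +
      IsSampler.noise (freshEstimator mdp pol γ est)
        (fun z => gradient (objective mdp pol γ Hz) z.1) (inp.batch t c) (θ, θprev)
        (fun i => τ i) := by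
  have hb : inp.batch t c = inp.N := if_pos hc
  rw [localEstimate, if_pos hc, IsSampler.noise, add_sub_cancel, hb, Finset.sum_range]
  rfl

/-- Mean plus centred noise. The mean contains the agent's own last displacement divided by `η`;
together with the difference of gradients it reproduces, up to disagreement, the gradient plus the
previous error. -/
lemma localEstimate_eq_change (inp : Input d) (t : ℕ) (c : Bool) (hc : ¬(c = true ∨ t = 0))
    (τ : ℕ → Traj S A Hz) (θ θprev : Param d) :
    localEstimate mdp pol γ est inp t c τ θ θprev =
      (gradient (objective mdp pol γ Hz) θ - gradient (objective mdp pol γ Hz) θprev) +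
        inp.η⁻¹ • (θ - θprev) +
      IsSampler.noise (changeEstimator mdp pol γ est)
        (fun z => gradient (objective mdp pol γ Hz) z.1 - gradient (objective mdp pol γ Hz) z.2)
        (inp.batch t c) (θ, θprev) (fun i => τ i) := by
  have hb : inp.batch t c = inp.B := if_neg hc
  rw [localEstimate, if_neg hc, IsSampler.noise, hb, Finset.sum_range, Finset.sum_range]
  simp only [changeEstimator, Finset.sum_sub_distrib, smul_sub]
  abel

include hA hM hγ0 hγ1 in
lemma measurable_localEstimate {Ω : Type*} [MeasurableSpace Ω] (inp : Input d) (t : ℕ)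
    {c : Ω → Bool} {τ : ℕ → Ω → Traj S A Hz} {θ θprev : Ω → Param d} (hc : Measurable c)
    (hτ : ∀ i, Measurable (τ i)) (hθ : Measurable θ) (hθp : Measurable θprev) :
    Measurable fun ω =>
      localEstimate mdp pol γ est inp t (c ω) (fun i => τ i ω) (θ ω) (θprev ω) := by
  have hS := hA.smoothPolicy
  have h1 : ∀ i, Measurable fun ω => est.grad mdp pol γ (τ i ω) (θ ω) := fun i =>
    hS.measurable_grad_comp mdp est hM hγ0 hγ1 hθ (hτ i)
  have h2 : ∀ i, Measurable fun ω =>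
      pol.impWeight (θ ω) (θprev ω) (τ i ω) • est.grad mdp pol γ (τ i ω) (θprev ω) := fun i =>
    (hS.measurable_impWeight_comp hθ hθp (hτ i)).smul
      (hS.measurable_grad_comp mdp est hM hγ0 hγ1 hθp (hτ i))
  have hs1 : ∀ n : ℕ, Measurable fun ω =>
      (n : ℝ)⁻¹ • ∑ i ∈ Finset.range n, est.grad mdp pol γ (τ i ω) (θ ω) := fun n =>
    (Finset.measurable_fun_sum _ fun i _ => h1 i).const_smul (n : ℝ)⁻¹
  have hs2 : ∀ n : ℕ, Measurable fun ω => (n : ℝ)⁻¹ • ∑ i ∈ Finset.range n,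
      pol.impWeight (θ ω) (θprev ω) (τ i ω) • est.grad mdp pol γ (τ i ω) (θprev ω) := fun n =>
    (Finset.measurable_fun_sum _ fun i _ => h2 i).const_smul (n : ℝ)⁻¹
  unfold localEstimate
  refine Measurable.ite ?_ (hs1 _) (((hs1 _).add ((hθ.sub hθp).const_smul inp.η⁻¹)).sub (hs2 _))
  by_cases ht : t = 0
  · simp [ht]
  · simp only [ht, or_false]
    exact hc (measurableSet_singleton true)

end Samplers

/-! ### One iteration, pathwise -/

section Pathwise

variable {K d : ℕ}

/-- The bound that robust aggregation gives for the distance of the aggregate from the honest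
average. -/
def aggBound (α C : ℝ) (Hon : Finset (Fin K)) (v : Fin K → Param d) : ℝ :=
  √(C * α / (Hon.card * (Hon.card - 1)) * ∑ i ∈ Hon, ∑ l ∈ Hon, ‖v i - v l‖ ^ 2)

lemma aggBound_nonneg (α C : ℝ) (Hon : Finset (Fin K)) (v : Fin K → Param d) :
    0 ≤ aggBound α C Hon v := Real.sqrt_nonneg _

lemma card_mul_pred_nonneg (n : ℕ) : (0 : ℝ) ≤ n * (n - 1) := by
  rcases Nat.eq_zero_or_pos n with rfl | hn
  · simp
  · have : (1 : ℝ) ≤ n := by exact_mod_cast hn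
    exact mul_nonneg (by linarith) (by linarith)

lemma avg_congr {s : Finset (Fin K)} {x y : Fin K → Param d} (h : ∀ i ∈ s, x i = y i) :
    avg s x = avg s y := by
  rw [avg, avg, Finset.sum_congr rfl h]

lemma avg_sub_const {s : Finset (Fin K)} (hs : s.Nonempty) (x : Fin K → Param d) (z : Param d) :
    avg s x - z = (s.card : ℝ)⁻¹ • ∑ i ∈ s, (x i - z) := by
  have : (s.card : ℝ) ≠ 0 := by exact_mod_cast hs.card_pos.ne'
  rw [avg, Finset.sum_sub_distrib, smul_sub, Finset.sum_const, ← Nat.cast_smul_eq_nsmul ℝ,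
    smul_smul, inv_mul_cancel₀ this, one_smul]

lemma norm_avg_sub_le {s : Finset (Fin K)} (hs : s.Nonempty) {x : Fin K → Param d} {z : Param d}
    {r : ℝ} (h : ∀ i ∈ s, ‖x i - z‖ ≤ r) : ‖avg s x - z‖ ≤ r := by
  have hc : (0 : ℝ) < s.card := by exact_mod_cast hs.card_pos
  rw [avg_sub_const hs, norm_smul, Real.norm_of_nonneg (by positivity), inv_mul_le_iff₀ hc]
  exact (norm_sum_le_of_le _ h).trans (by simp)

/-- Applying the hypothesis in mean to a Dirac law makes it a deterministic inequality. It therefore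
applies to inputs in which Byzantine entries depend arbitrarily on the honest ones. -/
lemma RobustAggregator.norm_sub_le {α C : ℝ} (hα : 0 ≤ α) (hC : 0 ≤ C)
    {agg : (Fin K → Param d) → Param d} (hagg : RobustAggregator α C agg) {Hon : Finset (Fin K)}
    (hcard : (1 - α) * K ≤ Hon.card) (x : Fin K → Param d) :
    ‖agg x - avg Hon x‖ ≤ aggBound α C Hon x := by
  have h := hagg (Measure.dirac x) Hon hcard
  simp_rw [lintegral_dirac] at h
  have he : ∀ v : Param d, ‖v‖ₑ ^ 2 = ENNReal.ofReal (‖v‖ ^ 2) := fun v => by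
    rw [ENNReal.ofReal_pow (norm_nonneg _), ofReal_norm]
  have hc : 0 ≤ C * α / (Hon.card * (Hon.card - 1)) :=
    div_nonneg (mul_nonneg hC hα) (card_mul_pred_nonneg _)
  simp_rw [he] at h
  simp_rw [← ENNReal.ofReal_sum_of_nonneg fun l _ => sq_nonneg _] at h
  rw [← ENNReal.ofReal_sum_of_nonneg fun i _ => Finset.sum_nonneg fun l _ => sq_nonneg _,
    ← ENNReal.ofReal_mul hc] at h
  rw [aggBound]
  refine Real.le_sqrt_of_sq_le ((ENNReal.ofReal_le_ofReal_iff ?_).1 h)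
  exact mul_nonneg hc (Finset.sum_nonneg fun _ _ => Finset.sum_nonneg fun _ _ => sq_nonneg _)

lemma aggBound_sq {α C : ℝ} (hα : 0 ≤ α) (hC : 0 ≤ C) (Hon : Finset (Fin K))
    (v : Fin K → Param d) : aggBound α C Hon v ^ 2 =
      C * α / (Hon.card * (Hon.card - 1)) * ∑ i ∈ Hon, ∑ l ∈ Hon, ‖v i - v l‖ ^ 2 :=
  Real.sq_sqrt (mul_nonneg (div_nonneg (mul_nonneg hC hα) (card_mul_pred_nonneg _))
    (Finset.sum_nonneg fun _ _ => Finset.sum_nonneg fun _ _ => sq_nonneg _))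

lemma norm_add_three_sq_le {E : Type*} [SeminormedAddCommGroup E] (a b c : E) :
    ‖a + b + c‖ ^ 2 ≤ 3 * (‖a‖ ^ 2 + ‖b‖ ^ 2 + ‖c‖ ^ 2) := by
  have h1 := norm_add₃_le (a := a) (b := b) (c := c)
  have h2 := pow_le_pow_left₀ (norm_nonneg _) h1 2
  nlinarith [sq_nonneg (‖a‖ - ‖b‖), sq_nonneg (‖b‖ - ‖c‖), sq_nonneg (‖a‖ - ‖c‖)]

/-- The aggregation bound in terms of the noise and of the spread of the means. -/
lemma aggBound_sq_le {α C : ℝ} (hα : 0 ≤ α) (hC : 0 ≤ C) {Hon : Finset (Fin K)}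
    {v m ξ : Fin K → Param d} {r : ℝ} (hv : ∀ i ∈ Hon, v i = m i + ξ i)
    (hm : ∀ i ∈ Hon, ∀ l ∈ Hon, ‖m i - m l‖ ≤ r) :
    aggBound α C Hon v ^ 2 ≤
      C * α * (6 * ((Hon.card : ℝ)⁻¹ * ∑ i ∈ Hon, ‖ξ i‖ ^ 2) + 3 * r ^ 2) := by
  classical
  rw [aggBound_sq hα hC]
  set n : ℝ := (Hon.card : ℝ) with hn
  have hsum0 : 0 ≤ ∑ i ∈ Hon, ‖ξ i‖ ^ 2 := Finset.sum_nonneg fun i _ => sq_nonneg _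
  -- The diagonal is removed so that the double sum counts `n (n - 1)` pairs, which cancels the
  -- denominator exactly.
  have hpt : ∀ i ∈ Hon, ∀ l ∈ Hon, ‖v i - v l‖ ^ 2 ≤
      3 * (‖ξ i‖ ^ 2 + ‖ξ l‖ ^ 2 + r ^ 2) - if i = l then 3 * (‖ξ i‖ ^ 2 + ‖ξ l‖ ^ 2 + r ^ 2) else 0 := by
    intro i hi l hl
    split_ifs with hil
    · subst hil; simp
    · rw [hv i hi, hv l hl, show m i + ξ i - (m l + ξ l) = ξ i + (-ξ l) + (m i - m l) by abel]
      have h1 := norm_add_three_sq_le (ξ i) (-ξ l) (m i - m l)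
      rw [norm_neg] at h1
      have h2 := pow_le_pow_left₀ (norm_nonneg _) (hm i hi l hl) 2
      linarith
  have hS : ∑ i ∈ Hon, ∑ l ∈ Hon, ‖v i - v l‖ ^ 2 ≤
      6 * (n - 1) * ∑ i ∈ Hon, ‖ξ i‖ ^ 2 + 3 * (n * (n - 1)) * r ^ 2 := by
    refine (Finset.sum_le_sum fun i hi => Finset.sum_le_sum fun l hl => hpt i hi l hl).trans
      (le_of_eq ?_)
    simp only [Finset.sum_sub_distrib, Finset.sum_ite_eq, mul_add, Finset.sum_add_distrib,
      Finset.sum_const, nsmul_eq_mul, ← Finset.mul_sum, ← hn]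
    rw [Finset.sum_congr rfl fun i hi => if_pos hi]
    simp only [Finset.sum_add_distrib, ← Finset.mul_sum, Finset.sum_const, nsmul_eq_mul, ← hn]
    ring
  -- If the denominator vanishes, the quotient is zero by convention and the bound is trivial.
  rcases (card_mul_pred_nonneg Hon.card).eq_or_lt with h0 | hpos
  · rw [← hn] at h0
    rw [← h0, div_zero, zero_mul]
    positivity
  · rw [← hn] at hpos
    rw [div_mul_eq_mul_div, div_le_iff₀ hpos]
    refine (mul_le_mul_of_nonneg_left hS (mul_nonneg hC hα)).trans (le_of_eq ?_)
    have hn0 : n ≠ 0 := fun h => by simp [h] at hpos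
    field_simp

lemma receive_of_mem {Msg : Type*} {Hon : Finset (Fin K)} (honest byz : Fin K → Fin K → Msg)
    (k : Fin K) {i : Fin K} (hi : i ∈ Hon) : receive Hon honest byz k i = honest i k := by
  rw [receive, if_pos (Or.inl hi)]

/-- What aggregation and agreement do to the parameters of the agents in one iteration. -/
lemma step_bounds {α Cra Cavg δ η D : ℝ} (hα : 0 ≤ α) (hCra : 0 ≤ Cra) (hCavg : 0 ≤ Cavg)
    (hδ : 0 ≤ δ) (hη : 0 ≤ η) (hD : 0 ≤ D)
    {agg : (Fin K → Param d) → Param d} (hagg : RobustAggregator α Cra agg)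
    {Hon Q Q' : Finset (Fin K)} (hcard : (1 - α) * K ≤ Hon.card) (hne : Hon.Nonempty)
    (hHQ : Hon ⊆ Q) (hHQ' : Hon ⊆ Q')
    {out : (Fin K → Param d) → Fin K → Param d}
    (hcontr : ∀ x, ∀ i ∈ Q', ∀ l ∈ Q', ‖out x i - out x l‖ ≤ δ * Metric.diam (x '' Hon))
    (havg : ∀ x, ‖avg Hon (out x) - avg Hon x‖ ≤ Cavg * Metric.diam (x '' Hon))
    {x v : Fin K → Param d} {byz : Fin K → Fin K → Param d} {z : Param d}
    (hx : ∀ i ∈ Q, ∀ l ∈ Q, ‖x i - x l‖ ≤ D) (hz : ∀ i ∈ Q, ‖x i - z‖ ≤ D)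
    {x' : Fin K → Param d}
    (hx' : x' = out (fun k => x k + η • agg (receive Hon (fun i _ => v i) byz k))) :
    (∀ i ∈ Q', ∀ l ∈ Q', ‖x' i - x' l‖ ≤ δ * (D + 2 * η * aggBound α Cra Hon v)) ∧
    (∀ i ∈ Q', ‖x' i - avg Hon x'‖ ≤ δ * (D + 2 * η * aggBound α Cra Hon v)) ∧
    ‖avg Hon x' - z - η • avg Hon v‖ ≤
      (1 + Cavg) * D + (1 + 2 * Cavg) * (η * aggBound α Cra Hon v) := by
  set E := aggBound α Cra Hon v with hE
  have hE0 : 0 ≤ E := aggBound_nonneg _ _ _ _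
  set y : Fin K → Param d := fun k => x k + η • agg (receive Hon (fun i _ => v i) byz k) with hy
  -- Every agent, Byzantine or not, sees the true vectors of the honest agents, and the robustness
  -- bound involves only those. Hence all aggregates lie within `E` of one common vector.
  have hv : ∀ k, ‖agg (receive Hon (fun i _ => v i) byz k) - avg Hon v‖ ≤ E := by
    intro k
    have h1 := hagg.norm_sub_le hα hCra hcard (receive Hon (fun i _ => v i) byz k)
    have h2 : ∀ i ∈ Hon, receive Hon (fun i _ => v i) byz k i = v i := fun i hi =>
      receive_of_mem _ _ k hi
    rw [avg_congr h2] at h1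
    refine h1.trans (le_of_eq ?_)
    rw [hE, aggBound, aggBound]
    congr 2
    exact Finset.sum_congr rfl fun i hi => Finset.sum_congr rfl fun l hl => by
      rw [h2 i hi, h2 l hl]
  have hy2 : ∀ k, ‖y k - (x k + η • avg Hon v)‖ ≤ η * E := by
    intro k
    rw [hy]
    simp only [add_sub_add_left_eq_sub, ← smul_sub, norm_smul, Real.norm_of_nonneg hη]
    exact mul_le_mul_of_nonneg_left (hv k) hη
  -- The common step `η • avg Hon v` cancels in differences; what remains is the old disagreement
  -- and two aggregation errors.
  have hdiam : Metric.diam (y '' Hon) ≤ D + 2 * η * E := by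
    refine Metric.diam_le_of_forall_dist_le (by positivity) ?_
    rintro _ ⟨i, hi, rfl⟩ _ ⟨l, hl, rfl⟩
    rw [dist_eq_norm]
    have e : y i - y l = (y i - (x i + η • avg Hon v)) - (y l - (x l + η • avg Hon v))
        + (x i - x l) := by abel
    rw [e]
    have h1 := (norm_add_le (y i - (x i + η • avg Hon v) - (y l - (x l + η • avg Hon v)))
      (x i - x l)).trans (add_le_add (norm_sub_le _ _) (hx i (hHQ hi) l (hHQ hl)))
    linarith [hy2 i, hy2 l]
  have hA : ∀ i ∈ Q', ∀ l ∈ Q', ‖x' i - x' l‖ ≤ δ * (D + 2 * η * E) := fun i hi l hl => by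
    rw [hx']
    exact (hcontr y i hi l hl).trans (mul_le_mul_of_nonneg_left hdiam hδ)
  refine ⟨hA, fun i hi => ?_, ?_⟩
  · rw [norm_sub_rev]
    exact norm_avg_sub_le hne fun l hl => hA l (hHQ' hl) i hi
  · have h1 : ‖avg Hon x' - avg Hon y‖ ≤ Cavg * (D + 2 * η * E) := by
      rw [hx']
      exact (havg y).trans (mul_le_mul_of_nonneg_left hdiam hCavg)
    have h2 : ‖avg Hon y - (z + η • avg Hon v)‖ ≤ D + η * E := by
      refine norm_avg_sub_le hne fun i hi => ?_
      rw [show y i - (z + η • avg Hon v) = (x i - z) + (y i - (x i + η • avg Hon v)) by abel]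
      exact (norm_add_le _ _).trans (add_le_add (hz i (hHQ hi)) (hy2 i))
    rw [show avg Hon x' - z - η • avg Hon v =
      (avg Hon x' - avg Hon y) + (avg Hon y - (z + η • avg Hon v)) by abel]
    refine (norm_add_le _ _).trans ((add_le_add h1 h2).trans (le_of_eq ?_))
    ring

end Pathwise

section RunAnalysis

variable {S A : Type*} [MeasurableSpace S] [MeasurableSpace A] {R : ℝ} {d Hz K : ℕ}
  {Ω : Type*} [mΩ : MeasurableSpace Ω] {P : Measure Ω}
  {mdp : MDP S A R} {pol : Policy S A d} {γ : ℝ} {est : Estimator Hz} {inp : Input d}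
  {agg : (Fin K → Param d) → Param d} {proto : Protocol K d}
  {Hon : ℕ → Finset (Fin K)} {T : ℕ}

/-! ### Derived processes -/

namespace Run

variable (run : Run P mdp pol γ est inp agg proto Hon T)

/-- The local estimate of agent `k` in iteration `t`. -/
def estimate (t : ℕ) (k : Fin K) (ω : Ω) : Param d :=
  localEstimate mdp pol γ est inp t (run.coin t ω) (fun j => run.traj t k j ω)
    (run.θ t k ω) (run.θ (t - 1) k ω)

/-- The honest average of the parameters. -/
def center : ℕ → Ω → Param d
  | 0, _ => inp.θ₀
  | t + 1, ω => avg (Hon t) fun k => run.θ (t + 1) k ω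

/-- The bound for the aggregation error in iteration `t`. -/
def aggError (α C : ℝ) (t : ℕ) (ω : Ω) : ℝ :=
  aggBound α C (Hon t) fun k => run.estimate t k ω

/-- A bound for the disagreement of the agents, in units of the step size. -/
def spread (α C δ : ℝ) : ℕ → Ω → ℝ
  | 0, _ => 0
  | t + 1, ω => δ * (spread α C δ t ω + 2 * run.aggError α C t ω)

/-- The realized direction of the honest average. -/
def drift (t : ℕ) (ω : Ω) : Param d := inp.η⁻¹ • (run.center (t + 1) ω - run.center t ω)

/-- The error of the realized direction as an estimate of the gradient. -/
def gradError (t : ℕ) (ω : Ω) : Param d :=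
  run.drift t ω - gradient (objective mdp pol γ Hz) (run.center t ω)

/-- The properties of aggregation and agreement that the analysis uses, for an agreement protocol
that contracts the parameters of the agents in `Q t` by the factor `δ`. -/
structure Tracking (run : Run P mdp pol γ est inp agg proto Hon T) (α Cra Cavg δ : ℝ)
    (Q : ℕ → Finset (Fin K)) : Prop where
  α_nonneg : 0 ≤ α
  α_lt : α < 1 / 4
  K_pos : 1 ≤ K
  Cra_nonneg : 0 ≤ Cra
  Cavg_nonneg : 0 ≤ Cavg
  δ_nonneg : 0 ≤ δ
  η_pos : 0 < inp.η
  card : ∀ t < T, (1 - α) * K ≤ (Hon t).card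
  robust : RobustAggregator α Cra agg
  subset : ∀ t < T, Hon t ⊆ Q t
  subset_succ : ∀ t < T, Hon t ⊆ Q (t + 1)
  antitone : ∀ t, t + 1 < T → Q (t + 1) ⊆ Q t
  contract : ∀ t < T, ∀ byz x, ∀ i ∈ Q (t + 1), ∀ l ∈ Q (t + 1),
    ‖proto.run inp.κ (Hon t) byz x i - proto.run inp.κ (Hon t) byz x l‖ ≤
      δ * Metric.diam (x '' Hon t)
  average : ∀ t < T, ∀ byz x, ‖avg (Hon t) (proto.run inp.κ (Hon t) byz x) - avg (Hon t) x‖ ≤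
      Cavg * Metric.diam (x '' Hon t)

lemma aggError_nonneg (α C : ℝ) (t : ℕ) (ω : Ω) : 0 ≤ run.aggError α C t ω :=
  aggBound_nonneg _ _ _ _

lemma spread_nonneg {δ : ℝ} (hδ : 0 ≤ δ) (α C : ℝ) (ω : Ω) : ∀ t, 0 ≤ run.spread α C δ t ω
  | 0 => le_rfl
  | t + 1 => mul_nonneg hδ (add_nonneg (spread_nonneg hδ α C ω t)
      (mul_nonneg zero_le_two (run.aggError_nonneg α C t ω)))

namespace Tracking

variable {run} {α Cra Cavg δ : ℝ} {Q : ℕ → Finset (Fin K)}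
  (hT : run.Tracking α Cra Cavg δ Q)
include hT

lemma card_ge {t : ℕ} (ht : t < T) : 3 / 4 * (K : ℝ) ≤ (Hon t).card := by
  refine le_trans ?_ (hT.card t ht)
  have := hT.α_lt
  gcongr
  linarith

lemma card_pos {t : ℕ} (ht : t < T) : (0 : ℝ) < (Hon t).card := by
  have h1 := hT.card_ge ht
  have h2 : (1 : ℝ) ≤ K := by exact_mod_cast hT.K_pos
  linarith

lemma nonempty {t : ℕ} (ht : t < T) : (Hon t).Nonempty := by
  rw [← Finset.card_pos]
  exact_mod_cast hT.card_pos ht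

lemma inv_card_le {t : ℕ} (ht : t < T) : ((Hon t).card : ℝ)⁻¹ ≤ 2 / K := by
  have h1 := hT.card_ge ht
  have h2 : (1 : ℝ) ≤ K := by exact_mod_cast hT.K_pos
  rw [inv_eq_one_div, div_le_div_iff₀ (hT.card_pos ht) (by linarith)]
  linarith

/-- An estimate uses the previous parameters too, so an honest agent must have been tracked one
iteration earlier. This is where antitonicity of `Q` is needed. At `t = 0` natural subtraction makes
the previous time `0` again. -/
lemma subset_pred {t : ℕ} (ht : t < T) : Hon t ⊆ Q (t - 1) := by
  rcases t with _ | t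
  · exact hT.subset 0 ht
  · exact (hT.subset _ ht).trans (hT.antitone t ht)

lemma step_spec {t : ℕ} (ht : t < T) (ω : Ω)
    (hx : ∀ i ∈ Q t, ∀ l ∈ Q t, ‖run.θ t i ω - run.θ t l ω‖ ≤ inp.η * run.spread α Cra δ t ω)
    (hz : ∀ i ∈ Q t, ‖run.θ t i ω - run.center t ω‖ ≤ inp.η * run.spread α Cra δ t ω) :
    (∀ i ∈ Q (t + 1), ∀ l ∈ Q (t + 1), ‖run.θ (t + 1) i ω - run.θ (t + 1) l ω‖ ≤
      inp.η * run.spread α Cra δ (t + 1) ω) ∧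
    (∀ i ∈ Q (t + 1), ‖run.θ (t + 1) i ω - run.center (t + 1) ω‖ ≤
      inp.η * run.spread α Cra δ (t + 1) ω) ∧
    ‖run.drift t ω - avg (Hon t) (fun k => run.estimate t k ω)‖ ≤
      (1 + Cavg) * run.spread α Cra δ t ω + (1 + 2 * Cavg) * run.aggError α Cra t ω := by
  have hη := hT.η_pos
  have key := step_bounds hT.α_nonneg hT.Cra_nonneg hT.Cavg_nonneg hT.δ_nonneg hη.le
    (mul_nonneg hη.le (run.spread_nonneg hT.δ_nonneg α Cra ω t)) hT.robust (hT.card t ht)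
    (hT.nonempty ht) (hT.subset t ht) (hT.subset_succ t ht)
    (out := proto.run inp.κ (Hon t) (fun r i k' => run.agreeMsg t r i k' ω))
    (hT.contract t ht _) (hT.average t ht _) (v := fun k => run.estimate t k ω)
    (byz := fun i k => run.gradMsg t i k ω) hx hz (x' := fun k => run.θ (t + 1) k ω)
    (funext fun k => run.step t ht k ω)
  have e : δ * (inp.η * run.spread α Cra δ t ω +
      2 * inp.η * aggBound α Cra (Hon t) fun k => run.estimate t k ω) =
      inp.η * run.spread α Cra δ (t + 1) ω := by
    simp only [spread, aggError]; ring
  rw [e] at key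
  refine ⟨key.1, key.2.1, ?_⟩
  have h3 : run.drift t ω - avg (Hon t) (fun k => run.estimate t k ω) =
      inp.η⁻¹ • (avg (Hon t) (fun k => run.θ (t + 1) k ω) - run.center t ω -
        inp.η • avg (Hon t) (fun k => run.estimate t k ω)) := by
    rw [smul_sub, smul_smul, inv_mul_cancel₀ hη.ne', one_smul]
    rfl
  rw [h3, norm_smul, Real.norm_of_nonneg (inv_nonneg.2 hη.le), inv_mul_le_iff₀ hη]
  refine key.2.2.trans (le_of_eq ?_)
  rw [aggError]; ring

lemma norm_sub_le {t : ℕ} (ht : t ≤ T) (ω : Ω) :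
    (∀ i ∈ Q t, ∀ l ∈ Q t, ‖run.θ t i ω - run.θ t l ω‖ ≤ inp.η * run.spread α Cra δ t ω) ∧
    (∀ i ∈ Q t, ‖run.θ t i ω - run.center t ω‖ ≤ inp.η * run.spread α Cra δ t ω) := by
  induction t with
  | zero => simp [run.start, spread, center]
  | succ t ih =>
    have h := hT.step_spec ht ω (ih (by omega)).1 (ih (by omega)).2
    exact ⟨h.1, h.2.1⟩

lemma norm_drift_sub_le {t : ℕ} (ht : t < T) (ω : Ω) :
    ‖run.drift t ω - avg (Hon t) (fun k => run.estimate t k ω)‖ ≤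
      (1 + Cavg) * run.spread α Cra δ t ω + (1 + 2 * Cavg) * run.aggError α Cra t ω :=
  (hT.step_spec ht ω (hT.norm_sub_le ht.le ω).1 (hT.norm_sub_le ht.le ω).2).2.2

/-- The movement of an honest agent. -/
lemma norm_move_sq_le {t : ℕ} (ht : t + 1 < T) (ω : Ω) {k : Fin K} (hk : k ∈ Hon (t + 1)) :
    ‖run.θ (t + 1) k ω - run.θ t k ω‖ ^ 2 ≤ 3 * inp.η ^ 2 *
      (‖run.drift t ω‖ ^ 2 + run.spread α Cra δ (t + 1) ω ^ 2 + run.spread α Cra δ t ω ^ 2) := by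
  have hη := hT.η_pos
  have h1 := (hT.norm_sub_le ht.le ω).2 k (hT.subset _ ht hk)
  have h2 := (hT.norm_sub_le (t := t) (by omega) ω).2 k (hT.subset_pred ht hk)
  have e : run.θ (t + 1) k ω - run.θ t k ω = inp.η • run.drift t ω +
      (run.θ (t + 1) k ω - run.center (t + 1) ω) + (-(run.θ t k ω - run.center t ω)) := by
    rw [drift, smul_smul, mul_inv_cancel₀ hη.ne', one_smul]; abel
  rw [e]
  refine (norm_add_three_sq_le _ _ _).trans ?_
  rw [norm_smul, Real.norm_of_nonneg hη.le, norm_neg]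
  have h3 := pow_le_pow_left₀ (norm_nonneg _) h1 2
  have h4 := pow_le_pow_left₀ (norm_nonneg _) h2 2
  nlinarith

end Tracking

/-! ### Measurability -/

lemma measurable_avg {X : Type*} [MeasurableSpace X] (s : Finset (Fin K)) {x : Fin K → X → Param d}
    (hx : ∀ k, Measurable (x k)) : Measurable fun y => avg s fun k => x k y :=
  (Finset.measurable_fun_sum s fun k _ => hx k).const_smul ((s.card : ℝ)⁻¹)

lemma measurable_center {t : ℕ} (ht : t ≤ T) : Measurable[run.ℱ t] (run.center t) := by
  rcases t with _ | t
  · exact measurable_const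
  · exact @measurable_avg d K Ω (run.ℱ (t + 1)) (Hon t) _ fun k => run.measurable_θ (t + 1) ht k

lemma measurable_drift {t : ℕ} (ht : t < T) : Measurable[run.ℱ (t + 1)] (run.drift t) :=
  ((run.measurable_center (Nat.succ_le_of_lt ht)).sub ((run.measurable_center ht.le).mono
    (run.ℱ.mono (Nat.le_succ t)) le_rfl)).const_smul inp.η⁻¹

lemma measurable_gradError (hJ : Measurable (gradient (objective mdp pol γ Hz))) {t : ℕ}
    (ht : t < T) : Measurable[run.ℱ (t + 1)] (run.gradError t) :=
  (run.measurable_drift ht).sub (hJ.comp ((run.measurable_center ht.le).mono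
    (run.ℱ.mono (Nat.le_succ t)) le_rfl))

lemma measurable_θ' {t : ℕ} (ht : t ≤ T) (k : Fin K) : Measurable (run.θ t k) :=
  (run.measurable_θ t ht k).mono (run.ℱ.le t) le_rfl

variable {G M σ W : ℝ} (hA : Assumptions mdp pol γ est G M σ W) (hM : 0 ≤ M)
  (hγ0 : 0 ≤ γ) (hγ1 : γ < 1)

include hA hM hγ0 hγ1

lemma measurable_estimate {t : ℕ} (ht : t < T) (k : Fin K) : Measurable (run.estimate t k) :=
  measurable_localEstimate hA hM hγ0 hγ1 inp t
    ((run.measurable_coin t ht).mono (run.ℱ.le _) le_rfl)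
    (fun i => (run.measurable_traj t ht k i).mono (run.ℱ.le _) le_rfl)
    (run.measurable_θ' ht.le k) (run.measurable_θ' ((Nat.sub_le _ _).trans ht.le) k)

lemma measurable_aggError (α C : ℝ) {t : ℕ} (ht : t < T) : Measurable (run.aggError α C t) := by
  have h := run.measurable_estimate hA hM hγ0 hγ1 ht
  refine Measurable.sqrt (Measurable.const_mul (Finset.measurable_fun_sum _ fun i _ =>
    Finset.measurable_fun_sum _ fun l _ => ?_) _)
  exact ((h i).sub (h l)).norm.pow_const 2

lemma measurable_spread (α C δ : ℝ) : ∀ {t : ℕ}, t ≤ T → Measurable (run.spread α C δ t)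
  | 0, _ => measurable_const
  | _ + 1, ht => ((measurable_spread α C δ (Nat.le_of_succ_le ht)).add
      ((run.measurable_aggError hA hM hγ0 hγ1 α C ht).const_mul 2)).const_mul δ

end Run

end RunAnalysis

/-! ### Second moments on one outcome of the coin -/

lemma norm_add_sq_le_weighted {E : Type*} [SeminormedAddCommGroup E] (a b : E) {β : ℝ}
    (hβ : 0 < β) : ‖a + b‖ ^ 2 ≤ (1 + β) * ‖a‖ ^ 2 + (1 + 1 / β) * ‖b‖ ^ 2 := by
  have h1 := pow_le_pow_left₀ (norm_nonneg _) (norm_add_le a b) 2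
  have h2 : 2 * (‖a‖ * ‖b‖) ≤ β * ‖a‖ ^ 2 + 1 / β * ‖b‖ ^ 2 := by
    have h3 : 0 ≤ (β * ‖a‖ - ‖b‖) ^ 2 / β := by positivity
    have h4 : (β * ‖a‖ - ‖b‖) ^ 2 / β = β * ‖a‖ ^ 2 + 1 / β * ‖b‖ ^ 2 - 2 * (‖a‖ * ‖b‖) := by
      field_simp; ring
    linarith
  nlinarith

section RunAnalysis

variable {S A : Type*} [MeasurableSpace S] [MeasurableSpace A] {R : ℝ} {d Hz K : ℕ}
  {Ω : Type*} [mΩ : MeasurableSpace Ω] {P : Measure Ω} [IsProbabilityMeasure P]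
  {mdp : MDP S A R} {pol : Policy S A d} {γ : ℝ} {est : Estimator Hz} {inp : Input d}
  {agg : (Fin K → Param d) → Param d} {proto : Protocol K d}
  {Hon : ℕ → Finset (Fin K)} {T : ℕ}
  {run : Run P mdp pol γ est inp agg proto Hon T}
  {α Cra Cavg δ : ℝ} {Q : ℕ → Finset (Fin K)}
  {G M σ W : ℝ}

namespace Run.Tracking

open IsSampler

/-- The second moments of the aggregation error and of the gradient error on the event that the
coin shows `c`. -/
lemma coin_bound (hT : run.Tracking α Cra Cavg δ Q) (hA : Assumptions mdp pol γ est G M σ W)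
    (hG : 0 ≤ G) (hM : 0 ≤ M) (hR : 0 ≤ R) (hγ0 : 0 ≤ γ) (hγ1 : γ < 1)
    {t : ℕ} (ht : t < T) (c : Bool) (hn : 1 ≤ inp.batch t c) (hp : 0 ≤ inp.coinProb c)
    {φ : Param d × Param d → Traj S A Hz → Param d} {m : Param d × Param d → Param d}
    {q : Param d × Param d → ℝ} (hφ : IsSampler mdp pol φ m q)
    {w : Ω → Param d} (hw : Measurable[run.ℱ t] w) (hw2 : Integrable (fun ω => ‖w ω‖ ^ 2) P)
    {μ : Ω → Fin K → Param d} {qb : ℝ}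
    (hest : ∀ ω, run.coin t ω = c → ∀ k ∈ Hon t, run.estimate t k ω = μ ω k +
      noise φ m (inp.batch t c) (run.θ t k ω, run.θ (t - 1) k ω) (run.batchTraj t c ω k))
    (hmean : ∀ ω, ∀ k ∈ Hon t,
      ‖μ ω k - (gradient (objective mdp pol γ Hz) (run.center t ω) + w ω)‖ ≤
        3 / 2 * (run.spread α Cra δ t ω + run.spread α Cra δ (t - 1) ω))
    (hpair : ∀ ω, ∀ k ∈ Hon t, ∀ l ∈ Hon t, ‖μ ω k - μ ω l‖ ≤
        3 / 2 * (run.spread α Cra δ t ω + run.spread α Cra δ (t - 1) ω))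
    (hq : ∀ k ∈ Hon t, Integrable (fun ω => q (run.θ t k ω, run.θ (t - 1) k ω)) P)
    (hqb : ∀ k ∈ Hon t, ∫ ω, q (run.θ t k ω, run.θ (t - 1) k ω) ∂P ≤ qb)
    (hs : Integrable (fun ω => run.spread α Cra δ t ω ^ 2) P)
    (hs' : Integrable (fun ω => run.spread α Cra δ (t - 1) ω ^ 2) P)
    {β : ℝ} (hβ : 0 < β) :
    (IntegrableOn (fun ω => run.aggError α Cra t ω ^ 2) {ω | run.coin t ω = c} P ∧
      ∫ ω in {ω | run.coin t ω = c}, run.aggError α Cra t ω ^ 2 ∂P ≤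
        Cra * α * (6 * (inp.coinProb c * (qb / inp.batch t c)) +
          14 * (∫ ω, run.spread α Cra δ t ω ^ 2 ∂P + ∫ ω, run.spread α Cra δ (t - 1) ω ^ 2 ∂P))) ∧
    (IntegrableOn (fun ω => ‖run.gradError t ω‖ ^ 2) {ω | run.coin t ω = c} P ∧
      ∫ ω in {ω | run.coin t ω = c}, ‖run.gradError t ω‖ ^ 2 ∂P ≤
        (1 + β) * (inp.coinProb c * (∫ ω, ‖w ω‖ ^ 2 ∂P +
          ((Hon t).card : ℝ)⁻¹ * (qb / inp.batch t c))) +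
        (1 + 1 / β) * (3 * (3 + 2 * Cavg) ^ 2 *
          (∫ ω, run.spread α Cra δ t ω ^ 2 ∂P + ∫ ω, run.spread α Cra δ (t - 1) ω ^ 2 ∂P +
            ∫ ω in {ω | run.coin t ω = c}, run.aggError α Cra t ω ^ 2 ∂P))) := by
  have hS := hA.smoothPolicy
  have hJ := hS.measurable_gradient_objective (Hz := Hz) mdp hG hR hγ0 hγ1
  have hCa := mul_nonneg hT.Cra_nonneg hT.α_nonneg
  have hCavg := hT.Cavg_nonneg
  have hhpos := hT.card_pos ht
  have hset := run.measurableSet_coin ht c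
  have hn0 : (0 : ℝ) < inp.batch t c := by exact_mod_cast hn
  set h : ℝ := ((Hon t).card : ℝ) with hh
  set ν := P.restrict {ω | run.coin t ω = c} with hν
  have hsν : Integrable (fun ω => run.spread α Cra δ t ω ^ 2) ν := hs.integrableOn
  have hsν' : Integrable (fun ω => run.spread α Cra δ (t - 1) ω ^ 2) ν := hs'.integrableOn
  have hss : Integrable (fun ω => run.spread α Cra δ t ω ^ 2 +
      run.spread α Cra δ (t - 1) ω ^ 2) ν := hsν.add hsν'
  have hsle : ∫ ω, run.spread α Cra δ t ω ^ 2 ∂ν ≤ ∫ ω, run.spread α Cra δ t ω ^ 2 ∂P :=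
    setIntegral_le_integral hs (Filter.Eventually.of_forall fun _ => sq_nonneg _)
  have hsle' : ∫ ω, run.spread α Cra δ (t - 1) ω ^ 2 ∂ν ≤
      ∫ ω, run.spread α Cra δ (t - 1) ω ^ 2 ∂P :=
    setIntegral_le_integral hs' (Filter.Eventually.of_forall fun _ => sq_nonneg _)
  have hcoin : ∀ᵐ ω ∂ν, run.coin t ω = c := ae_restrict_mem hset
  let ξ : Fin K → Ω → Param d := fun k ω =>
    noise φ m (inp.batch t c) (run.θ t k ω, run.θ (t - 1) k ω) (run.batchTraj t c ω k)
  -- The aggregation error feels the noise of each agent separately, without the gain of averaging,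
  -- so a single agent is considered and `w` is zero.
  have hξ : ∀ k ∈ Hon t, Integrable (fun ω => ‖ξ k ω‖ ^ 2) ν ∧
      ∫ ω, ‖ξ k ω‖ ^ 2 ∂ν ≤ inp.coinProb c * (qb / inp.batch t c) := by
    intro k hk
    have h1 := run.integral_coin_le hS ht c hn hp hφ {k} 1 (w := fun _ => 0) measurable_const
      (by simp) (by simpa using hq k hk)
    simp only [Finset.sum_singleton, one_smul, zero_add, norm_zero, ne_eq, OfNat.ofNat_ne_zero,
      not_false_eq_true, zero_pow, integral_zero, one_pow] at h1
    refine ⟨h1.1, h1.2.trans ?_⟩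
    rw [one_div, ← div_eq_inv_mul]
    gcongr
    exact hqb k hk
  have hagg : ∀ᵐ ω ∂ν, run.aggError α Cra t ω ^ 2 ≤ Cra * α *
      (6 * (h⁻¹ * ∑ k ∈ Hon t, ‖ξ k ω‖ ^ 2) +
        14 * (run.spread α Cra δ t ω ^ 2 + run.spread α Cra δ (t - 1) ω ^ 2)) := by
    filter_upwards [hcoin] with ω hω
    refine (aggBound_sq_le hT.α_nonneg hT.Cra_nonneg (hest ω hω) (hpair ω)).trans ?_
    refine mul_le_mul_of_nonneg_left (add_le_add le_rfl ?_) hCa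
    nlinarith [sq_nonneg (run.spread α Cra δ t ω - run.spread α Cra δ (t - 1) ω),
      sq_nonneg (run.spread α Cra δ t ω), sq_nonneg (run.spread α Cra δ (t - 1) ω)]
  have hξi : Integrable (fun ω => ∑ k ∈ Hon t, ‖ξ k ω‖ ^ 2) ν :=
    integrable_finsetSum _ fun k hk => (hξ k hk).1
  have hBi : Integrable (fun ω => Cra * α * (6 * (h⁻¹ * ∑ k ∈ Hon t, ‖ξ k ω‖ ^ 2) +
        14 * (run.spread α Cra δ t ω ^ 2 + run.spread α Cra δ (t - 1) ω ^ 2))) ν :=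
    (((hξi.const_mul _).const_mul _).add (hss.const_mul _)).const_mul _
  have haggi : Integrable (fun ω => run.aggError α Cra t ω ^ 2) ν := by
    refine hBi.mono' ((run.measurable_aggError hA hM hγ0 hγ1 α Cra ht).pow_const
      2).aestronglyMeasurable ?_
    filter_upwards [hagg] with ω hω
    rwa [Real.norm_of_nonneg (sq_nonneg _)]
  refine ⟨⟨haggi, ?_⟩, ?_⟩
  · refine (integral_mono_ae haggi hBi hagg).trans ?_
    rw [integral_const_mul, integral_add ((hξi.const_mul _).const_mul _)
      (hss.const_mul _), integral_const_mul, integral_const_mul, integral_const_mul,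
      integral_add hsν hsν', integral_finsetSum _ fun k hk => (hξ k hk).1]
    refine mul_le_mul_of_nonneg_left (add_le_add (mul_le_mul_of_nonneg_left ?_ (by norm_num))
      (mul_le_mul_of_nonneg_left (add_le_add hsle hsle') (by norm_num))) hCa
    rw [inv_mul_le_iff₀ hhpos]
    refine (Finset.sum_le_sum fun k hk => (hξ k hk).2).trans ?_
    rw [Finset.sum_const, nsmul_eq_mul]
  -- The gradient error is split into `N`, the carried-over error plus the averaged noise, and a
  -- remainder that is bounded path by path by spread and aggregation error. Averaging over honest
  -- agents gains the factor `h⁻¹`.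
  · let N : Ω → Param d := fun ω => w ω + ∑ k ∈ Hon t, h⁻¹ • ξ k ω
    obtain ⟨hNi, hNle⟩ := run.integral_coin_le hS ht c hn hp hφ (Hon t) h⁻¹ hw hw2 hq
    have hNle' : ∫ ω, ‖N ω‖ ^ 2 ∂ν ≤
        inp.coinProb c * (∫ ω, ‖w ω‖ ^ 2 ∂P + h⁻¹ * (qb / inp.batch t c)) := by
      refine hNle.trans ?_
      refine mul_le_mul_of_nonneg_left (add_le_add le_rfl ?_) hp
      have h1 : ∑ k ∈ Hon t, ∫ ω, q (run.θ t k ω, run.θ (t - 1) k ω) ∂P ≤ h * qb := by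
        refine (Finset.sum_le_sum hqb).trans ?_
        rw [Finset.sum_const, nsmul_eq_mul]
      refine (mul_le_mul_of_nonneg_left h1 (by positivity)).trans (le_of_eq ?_)
      field_simp
    -- The constant `3 + 2 * Cavg` dominates both `(1 + Cavg) + 3/2`, from agreement and the spread
    -- of the means, and `1 + 2 * Cavg`, from aggregation.
    have hres : ∀ᵐ ω ∂ν, ‖run.gradError t ω - N ω‖ ≤ (3 + 2 * Cavg) *
        (run.spread α Cra δ t ω + run.spread α Cra δ (t - 1) ω + run.aggError α Cra t ω) := by
      filter_upwards [hcoin] with ω hω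
      have h1 := hT.norm_drift_sub_le ht ω
      have h2 := norm_avg_sub_le (hT.nonempty ht) (hmean ω)
      have h3 : avg (Hon t) (fun k => run.estimate t k ω) =
          avg (Hon t) (μ ω) + ∑ k ∈ Hon t, h⁻¹ • ξ k ω := by
        rw [avg_congr (hest ω hω), avg, avg, Finset.sum_add_distrib, smul_add, ← Finset.smul_sum]
      have h4 : run.gradError t ω - N ω =
          (run.drift t ω - avg (Hon t) (fun k => run.estimate t k ω)) +
          (avg (Hon t) (μ ω) -
            (gradient (objective mdp pol γ Hz) (run.center t ω) + w ω)) := by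
        rw [h3, gradError]
        simp only [N]
        abel
      rw [h4]
      refine (norm_add_le _ _).trans ((add_le_add h1 h2).trans ?_)
      have s1 := run.spread_nonneg hT.δ_nonneg α Cra ω t
      have s2 := run.spread_nonneg hT.δ_nonneg α Cra ω (t - 1)
      have s3 := run.aggError_nonneg α Cra t ω
      nlinarith [mul_nonneg hCavg s1, mul_nonneg hCavg s2]
    have hpt : ∀ᵐ ω ∂ν, ‖run.gradError t ω‖ ^ 2 ≤ (1 + β) * ‖N ω‖ ^ 2 +
        (1 + 1 / β) * (3 * (3 + 2 * Cavg) ^ 2 * (run.spread α Cra δ t ω ^ 2 +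
          run.spread α Cra δ (t - 1) ω ^ 2 + run.aggError α Cra t ω ^ 2)) := by
      filter_upwards [hres] with ω hω
      have h1 := norm_add_sq_le_weighted (N ω) (run.gradError t ω - N ω) hβ
      rw [add_sub_cancel] at h1
      refine h1.trans (add_le_add le_rfl (mul_le_mul_of_nonneg_left ?_ (by positivity)))
      refine (pow_le_pow_left₀ (norm_nonneg _) hω 2).trans ?_
      rw [mul_pow, mul_comm 3, mul_assoc]
      refine mul_le_mul_of_nonneg_left ?_ (sq_nonneg _)
      nlinarith [sq_nonneg (run.spread α Cra δ t ω - run.spread α Cra δ (t - 1) ω),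
        sq_nonneg (run.spread α Cra δ t ω - run.aggError α Cra t ω),
        sq_nonneg (run.spread α Cra δ (t - 1) ω - run.aggError α Cra t ω)]
    have hi1 : Integrable (fun ω => (1 + β) * ‖N ω‖ ^ 2) ν := Integrable.const_mul hNi _
    have hi2 : Integrable (fun ω => run.spread α Cra δ t ω ^ 2 +
          run.spread α Cra δ (t - 1) ω ^ 2 + run.aggError α Cra t ω ^ 2) ν :=
      hss.add haggi
    have hi3 : Integrable (fun ω => (1 + 1 / β) * (3 * (3 + 2 * Cavg) ^ 2 *
      (run.spread α Cra δ t ω ^ 2 + run.spread α Cra δ (t - 1) ω ^ 2 +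
        run.aggError α Cra t ω ^ 2))) ν := (hi2.const_mul _).const_mul _
    have hei : Integrable (fun ω => ‖run.gradError t ω‖ ^ 2) ν := by
      refine (hi1.add hi3).mono' ((((run.measurable_gradError hJ ht).mono (run.ℱ.le _)
        le_rfl).norm.pow_const 2).aestronglyMeasurable) ?_
      filter_upwards [hpt] with ω hω
      rwa [Real.norm_of_nonneg (sq_nonneg _)]
    refine ⟨hei, (integral_mono_ae hei (hi1.add hi3) hpt).trans ?_⟩
    simp only [Pi.add_apply]
    rw [integral_add hi1 hi3, integral_const_mul, integral_const_mul, integral_const_mul,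
      integral_add hss haggi, integral_add hsν hsν']
    gcongr

end Run.Tracking

end RunAnalysis

/-! ### Fresh and recursive estimates -/

section RunAnalysis

variable {S A : Type*} [MeasurableSpace S] [MeasurableSpace A] {R : ℝ} {d Hz K : ℕ}
  {Ω : Type*} [mΩ : MeasurableSpace Ω] {P : Measure Ω} [IsProbabilityMeasure P]
  {mdp : MDP S A R} {pol : Policy S A d} {γ : ℝ} {est : Estimator Hz} {inp : Input d}
  {agg : (Fin K → Param d) → Param d} {proto : Protocol K d}
  {Hon : ℕ → Finset (Fin K)} {T : ℕ}

namespace Run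

variable (run : Run P mdp pol γ est inp agg proto Hon T)

omit [IsProbabilityMeasure P] in
lemma integrable_of_coin {t : ℕ} (ht : t < T) {f : Ω → ℝ}
    (h : ∀ c, IntegrableOn f {ω | run.coin t ω = c} P) :
    Integrable f P ∧ ∫ ω, f ω ∂P = ∫ ω in {ω | run.coin t ω = true}, f ω ∂P +
      ∫ ω in {ω | run.coin t ω = false}, f ω ∂P := by
  have hc : {ω | run.coin t ω = true}ᶜ = {ω | run.coin t ω = false} := by
    ext ω; simp
  have hi : Integrable f P := by
    rw [← integrableOn_univ, ← Set.union_compl_self {ω | run.coin t ω = true}, hc]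
    exact (h true).union (h false)
  refine ⟨hi, ?_⟩
  rw [← hc, integral_add_compl (run.measurableSet_coin ht true) hi]

/-- The second moment of the spread. -/
def spreadSq (α C δ : ℝ) (t : ℕ) : ℝ := ∫ ω, run.spread α C δ t ω ^ 2 ∂P

/-- The second moment of the drift. -/
def driftSq (t : ℕ) : ℝ := ∫ ω, ‖run.drift t ω‖ ^ 2 ∂P

/-- The second moment of the gradient error. -/
def gradErrorSq (t : ℕ) : ℝ := ∫ ω, ‖run.gradError t ω‖ ^ 2 ∂P

omit [IsProbabilityMeasure P] in
lemma spreadSq_nonneg (α C δ : ℝ) (t : ℕ) : 0 ≤ run.spreadSq α C δ t :=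
  integral_nonneg fun _ => sq_nonneg _

omit [IsProbabilityMeasure P] in
lemma driftSq_nonneg (t : ℕ) : 0 ≤ run.driftSq t := integral_nonneg fun _ => sq_nonneg _

omit [IsProbabilityMeasure P] in
lemma gradErrorSq_nonneg (t : ℕ) : 0 ≤ run.gradErrorSq t := integral_nonneg fun _ => sq_nonneg _

end Run

variable {run : Run P mdp pol γ est inp agg proto Hon T}
  {α Cra Cavg δ : ℝ} {Q : ℕ → Finset (Fin K)}
  {G M σ W : ℝ}

namespace Run.Tracking

variable (hT : run.Tracking α Cra Cavg δ Q) (hA : Assumptions mdp pol γ est G M σ W)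
  (hG : 0 ≤ G) (hM : 0 ≤ M) (hR : 0 ≤ R) (hγ0 : 0 ≤ γ) (hγ1 : γ < 1)
  (hηL : inp.η * smoothConst Hz R γ G M ≤ 1 / 2)

include hA hG hM hR hγ0 hγ1 hηL in
omit [IsProbabilityMeasure P] in
lemma _root_.DecByzPG.Assumptions.norm_gradient_sub_le {x y : Param d} {r : ℝ} (hr : 0 ≤ r)
    (hxy : ‖x - y‖ ≤ inp.η * r) : ‖gradient (objective mdp pol γ Hz) x -
      gradient (objective mdp pol γ Hz) y‖ ≤ 1 / 2 * r := by
  have h1 : 0 < 1 - γ := by linarith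
  have hL : 0 ≤ smoothConst Hz R γ G M := by unfold smoothConst; positivity
  refine (hA.smoothPolicy.norm_gradient_objective_sub_le mdp hG hR hγ0 hγ1 _ _).trans ?_
  refine (mul_le_mul_of_nonneg_left hxy hL).trans ?_
  nlinarith

include hT hA hG hM hR hγ0 hγ1 hηL

/-- A fresh estimate forgets the past, so `w = 0` in `coin_bound`; no contraction has to be
preserved and the weight `β = 1` suffices. -/
lemma fresh_bound {t : ℕ} (ht : t < T) {c : Bool} (hc : c = true ∨ t = 0) (hN : 1 ≤ inp.N)
    (hp : 0 ≤ inp.coinProb c)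
    (hs : Integrable (fun ω => run.spread α Cra δ t ω ^ 2) P)
    (hs' : Integrable (fun ω => run.spread α Cra δ (t - 1) ω ^ 2) P) :
    (IntegrableOn (fun ω => run.aggError α Cra t ω ^ 2) {ω | run.coin t ω = c} P ∧
      ∫ ω in {ω | run.coin t ω = c}, run.aggError α Cra t ω ^ 2 ∂P ≤
        Cra * α * (6 * (inp.coinProb c * (σ ^ 2 / inp.N)) +
          14 * (run.spreadSq α Cra δ t + run.spreadSq α Cra δ (t - 1)))) ∧
    (IntegrableOn (fun ω => ‖run.gradError t ω‖ ^ 2) {ω | run.coin t ω = c} P ∧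
      ∫ ω in {ω | run.coin t ω = c}, ‖run.gradError t ω‖ ^ 2 ∂P ≤
        2 * (inp.coinProb c * (((Hon t).card : ℝ)⁻¹ * (σ ^ 2 / inp.N))) +
        6 * (3 + 2 * Cavg) ^ 2 * (run.spreadSq α Cra δ t + run.spreadSq α Cra δ (t - 1) +
            ∫ ω in {ω | run.coin t ω = c}, run.aggError α Cra t ω ^ 2 ∂P)) := by
  have hb : inp.batch t c = inp.N := if_pos hc
  have hsn := fun ω t => run.spread_nonneg hT.δ_nonneg α Cra ω t
  have hmean : ∀ ω, ∀ k ∈ Hon t, ‖gradient (objective mdp pol γ Hz) (run.θ t k ω) -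
      gradient (objective mdp pol γ Hz) (run.center t ω)‖ ≤ 1 / 2 * run.spread α Cra δ t ω :=
    fun ω k hk => hA.norm_gradient_sub_le hG hM hR hγ0 hγ1 hηL (hsn ω t)
      ((hT.norm_sub_le ht.le ω).2 k (hT.subset t ht hk))
  have key := hT.coin_bound hA hG hM hR hγ0 hγ1 ht c (by rwa [hb]) hp
    (isSampler_freshEstimator hA hG hM hR hγ0 hγ1) (w := fun _ => 0) measurable_const
    (by simp) (μ := fun ω k => gradient (objective mdp pol γ Hz) (run.θ t k ω)) (qb := σ ^ 2)
    (fun ω hω k _ => by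
      rw [estimate, hω]; exact localEstimate_eq_fresh inp t c hc _ _ _)
    (fun ω k hk => by
      rw [add_zero]
      linarith [hmean ω k hk, hsn ω t, hsn ω (t - 1)])
    (fun ω k hk l hl => by
      have h := hA.norm_gradient_sub_le hG hM hR hγ0 hγ1 hηL (hsn ω t)
        ((hT.norm_sub_le ht.le ω).1 k (hT.subset t ht hk) l (hT.subset t ht hl))
      linarith [hsn ω t, hsn ω (t - 1)])
    (fun k _ => integrable_const _) (fun k _ => by simp) hs hs' one_pos
  simp only [hb, norm_zero, ne_eq, OfNat.ofNat_ne_zero, not_false_eq_true, zero_pow,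
    integral_zero, zero_add] at key
  refine ⟨key.1, key.2.1, key.2.2.trans (le_of_eq ?_)⟩
  simp only [spreadSq]
  ring

/-- Here the past error is the carried-over vector `w` in `coin_bound`, and the noise variance is
proportional to the squared displacement, that is, to `η²` times drift and spread. The weight `β =
p/2` spends half of the contraction supplied by the coin. -/
lemma change_bound {t : ℕ} (ht : t + 1 < T) (hB : 1 ≤ inp.B) (hW : 0 ≤ W)
    (hp0 : 0 < inp.p) (hp1 : inp.p ≤ 1)
    (hu : Integrable (fun ω => ‖run.drift t ω‖ ^ 2) P)
    (he : Integrable (fun ω => ‖run.gradError t ω‖ ^ 2) P)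
    (hs : Integrable (fun ω => run.spread α Cra δ (t + 1) ω ^ 2) P)
    (hs' : Integrable (fun ω => run.spread α Cra δ t ω ^ 2) P) {qb : ℝ}
    (hqb : 3 * changeConst est R G M W * inp.η ^ 2 * (run.driftSq t +
      (run.spreadSq α Cra δ (t + 1) + run.spreadSq α Cra δ t)) ≤ qb) :
    (IntegrableOn (fun ω => run.aggError α Cra (t + 1) ω ^ 2)
        {ω | run.coin (t + 1) ω = false} P ∧
      ∫ ω in {ω | run.coin (t + 1) ω = false}, run.aggError α Cra (t + 1) ω ^ 2 ∂P ≤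
        Cra * α * (6 * qb +
          14 * (run.spreadSq α Cra δ (t + 1) + run.spreadSq α Cra δ t))) ∧
    (IntegrableOn (fun ω => ‖run.gradError (t + 1) ω‖ ^ 2) {ω | run.coin (t + 1) ω = false} P ∧
      ∫ ω in {ω | run.coin (t + 1) ω = false}, ‖run.gradError (t + 1) ω‖ ^ 2 ∂P ≤
        (1 - inp.p / 2) * run.gradErrorSq t + ((Hon (t + 1)).card : ℝ)⁻¹ * qb +
        3 / inp.p * (3 * (3 + 2 * Cavg) ^ 2 *
          (run.spreadSq α Cra δ (t + 1) + run.spreadSq α Cra δ t +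
            ∫ ω in {ω | run.coin (t + 1) ω = false}, run.aggError α Cra (t + 1) ω ^ 2 ∂P))) := by
  have hη := hT.η_pos
  have hΓ := changeConst_nonneg est R G M hW
  have hc : ¬(false = true ∨ t + 1 = 0) := by simp
  have hb : inp.batch (t + 1) false = inp.B := if_neg hc
  have hp : inp.coinProb false = 1 - inp.p := by simp [Input.coinProb]
  have hB1 : (1 : ℝ) ≤ inp.B := by exact_mod_cast hB
  have hqb0 : 0 ≤ qb := le_trans (mul_nonneg (by positivity) (add_nonneg (run.driftSq_nonneg t)
    (add_nonneg (run.spreadSq_nonneg _ _ _ _) (run.spreadSq_nonneg _ _ _ _)))) hqb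
  have hsn := fun ω t => run.spread_nonneg hT.δ_nonneg α Cra ω t
  have hJ := hA.smoothPolicy.measurable_gradient_objective (Hz := Hz) mdp hG hR hγ0 hγ1
  let J' := gradient (objective mdp pol γ Hz)
  let μ : Ω → Fin K → Param d := fun ω k => (J' (run.θ (t + 1) k ω) - J' (run.θ t k ω)) +
    inp.η⁻¹ • (run.θ (t + 1) k ω - run.θ t k ω)
  have hscale : ∀ (x : Param d) (r : ℝ), ‖x‖ ≤ inp.η * r → ‖inp.η⁻¹ • x‖ ≤ r := by
    intro x r hx
    rwa [norm_smul, Real.norm_of_nonneg (inv_nonneg.2 hη.le), inv_mul_le_iff₀ hη]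
  -- The factor `3/2` is `1/2` from the gradient, by `ηL ≤ 1/2`, plus `1` from the displacement
  -- divided by `η`.
  have hfour : ∀ (x x' y y' : Param d) (r r' : ℝ), 0 ≤ r → 0 ≤ r' → ‖x - y‖ ≤ inp.η * r →
      ‖x' - y'‖ ≤ inp.η * r' → ‖(J' x - J' x' + inp.η⁻¹ • (x - x')) -
        (J' y - J' y' + inp.η⁻¹ • (y - y'))‖ ≤ 3 / 2 * (r + r') := by
    intro x x' y y' r r' hr hr' h h'
    have g1 : ‖J' x - J' y‖ ≤ 1 / 2 * r :=
      hA.norm_gradient_sub_le hG hM hR hγ0 hγ1 hηL hr h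
    have g2 : ‖J' x' - J' y'‖ ≤ 1 / 2 * r' :=
      hA.norm_gradient_sub_le hG hM hR hγ0 hγ1 hηL hr' h'
    have g3 := hscale _ _ h
    have g4 := hscale _ _ h'
    have e : (J' x - J' x' + inp.η⁻¹ • (x - x')) - (J' y - J' y' + inp.η⁻¹ • (y - y')) =
        ((J' x - J' y) - (J' x' - J' y')) + (inp.η⁻¹ • (x - y) - inp.η⁻¹ • (x' - y')) := by
      simp only [smul_sub]
      abel
    rw [e]
    have n1 := norm_add_le ((J' x - J' y) - (J' x' - J' y'))
      (inp.η⁻¹ • (x - y) - inp.η⁻¹ • (x' - y'))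
    have n2 := _root_.norm_sub_le (J' x - J' y) (J' x' - J' y')
    have n3 := _root_.norm_sub_le (inp.η⁻¹ • (x - y)) (inp.η⁻¹ • (x' - y'))
    linarith
  have ht' : t ≤ T := by omega
  have hmean : ∀ ω, ∀ k ∈ Hon (t + 1),
      ‖μ ω k - (J' (run.center (t + 1) ω) + run.gradError t ω)‖ ≤
        3 / 2 * (run.spread α Cra δ (t + 1) ω + run.spread α Cra δ t ω) := by
    intro ω k hk
    -- The honest average obeys the same formula as the individual means: gradient plus previous
    -- error is the map of `hfour` evaluated along the centres. So the distance to it is a matter of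
    -- disagreement only.
    have e : J' (run.center (t + 1) ω) + run.gradError t ω =
        J' (run.center (t + 1) ω) - J' (run.center t ω) +
          inp.η⁻¹ • (run.center (t + 1) ω - run.center t ω) := by
      simp only [gradError, drift, J']
      abel
    rw [e]
    exact hfour _ _ _ _ _ _ (hsn ω _) (hsn ω _)
      ((hT.norm_sub_le ht.le ω).2 k (hT.subset _ ht hk))
      ((hT.norm_sub_le ht' ω).2 k (hT.subset_pred ht hk))
  have hpair : ∀ ω, ∀ k ∈ Hon (t + 1), ∀ l ∈ Hon (t + 1), ‖μ ω k - μ ω l‖ ≤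
        3 / 2 * (run.spread α Cra δ (t + 1) ω + run.spread α Cra δ t ω) := fun ω k hk l hl =>
    hfour _ _ _ _ _ _ (hsn ω _) (hsn ω _)
      ((hT.norm_sub_le ht.le ω).1 k (hT.subset _ ht hk) l (hT.subset _ ht hl))
      ((hT.norm_sub_le ht' ω).1 k (hT.subset_pred ht hk) l (hT.subset_pred ht hl))
  have hqi : ∀ k ∈ Hon (t + 1), Integrable (fun ω => changeConst est R G M W *
      ‖run.θ (t + 1) k ω - run.θ t k ω‖ ^ 2) P ∧
      ∫ ω, changeConst est R G M W * ‖run.θ (t + 1) k ω - run.θ t k ω‖ ^ 2 ∂P ≤ qb := by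
    intro k hk
    have hi : Integrable (fun ω => 3 * inp.η ^ 2 * (‖run.drift t ω‖ ^ 2 +
        run.spread α Cra δ (t + 1) ω ^ 2 + run.spread α Cra δ t ω ^ 2)) P :=
      ((hu.add hs).add hs').const_mul _
    have hi2 : Integrable (fun ω => ‖run.θ (t + 1) k ω - run.θ t k ω‖ ^ 2) P := by
      refine hi.mono' (((run.measurable_θ' ht.le k).sub
        (run.measurable_θ' (by omega) k)).norm.pow_const 2).aestronglyMeasurable ?_
      refine Filter.Eventually.of_forall fun ω => ?_
      rw [Real.norm_of_nonneg (sq_nonneg _)]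
      exact hT.norm_move_sq_le ht ω hk
    refine ⟨hi2.const_mul _, le_trans ?_ hqb⟩
    rw [integral_const_mul]
    refine (mul_le_mul_of_nonneg_left
      (integral_mono hi2 hi fun ω => hT.norm_move_sq_le ht ω hk) hΓ).trans (le_of_eq ?_)
    have hus : Integrable (fun ω => ‖run.drift t ω‖ ^ 2 + run.spread α Cra δ (t + 1) ω ^ 2) P :=
      hu.add hs
    rw [integral_const_mul, integral_add hus hs', integral_add hu hs]
    simp only [driftSq, spreadSq]
    ring
  have key := hT.coin_bound hA hG hM hR hγ0 hγ1 ht false (by rwa [hb]) (by rw [hp]; linarith)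
    (isSampler_changeEstimator hA hG hM hR hγ0 hγ1 hW) (w := run.gradError t)
    (run.measurable_gradError hJ (by omega)) he (μ := μ) (qb := qb)
    (fun ω hω k _ => by
      rw [estimate, hω]; exact localEstimate_eq_change inp (t + 1) false hc _ _ _)
    hmean hpair (fun k hk => (hqi k hk).1) (fun k hk => (hqi k hk).2) hs hs'
    (β := inp.p / 2) (by positivity)
  -- The gain from the small batch is discarded; the resulting bounds do not depend on `B`.
  have hdiv : qb / inp.B ≤ qb := div_le_self hqb0 hB1
  simp only [hb, hp, add_tsub_cancel_right] at key
  refine ⟨⟨key.1.1, key.1.2.trans ?_⟩, key.2.1, key.2.2.trans ?_⟩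
  · refine mul_le_mul_of_nonneg_left (add_le_add ?_ le_rfl)
      (mul_nonneg hT.Cra_nonneg hT.α_nonneg)
    nlinarith
  · refine add_le_add ?_ ?_
    · have hinv : 0 ≤ ((Hon (t + 1)).card : ℝ)⁻¹ := by positivity
      have h1 : ((Hon (t + 1)).card : ℝ)⁻¹ * (qb / inp.B) ≤ ((Hon (t + 1)).card : ℝ)⁻¹ * qb := by
        gcongr
      have h2 := run.gradErrorSq_nonneg t
      have h3 : 0 ≤ ((Hon (t + 1)).card : ℝ)⁻¹ * (qb / inp.B) := by positivity
      rw [← mul_assoc, show ∫ ω, ‖run.gradError t ω‖ ^ 2 ∂P = run.gradErrorSq t from rfl]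
      -- The product is `1 - p/2 - p²/2`, which leaves the contraction factor of the recursion.
      have h4 : (1 + inp.p / 2) * (1 - inp.p) ≤ 1 - inp.p / 2 := by nlinarith
      have h5 : (1 + inp.p / 2) * (1 - inp.p) ≤ 1 := by nlinarith
      rw [mul_add]
      refine add_le_add (mul_le_mul_of_nonneg_right h4 h2) ?_
      exact (mul_le_of_le_one_left h3 h5).trans h1
    · refine mul_le_mul_of_nonneg_right ?_ (mul_nonneg (by positivity) (add_nonneg (add_nonneg
        (integral_nonneg fun _ => sq_nonneg _) (integral_nonneg fun _ => sq_nonneg _))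
        (integral_nonneg fun _ => sq_nonneg _)))
      -- The price of the Young weight is `1 + 2/p ≤ 3/p`.
      rw [one_div_div, ← sub_nonneg]
      have : 3 / inp.p - (1 + 2 / inp.p) = (1 - inp.p) / inp.p := by field_simp; ring
      rw [this]
      exact div_nonneg (by linarith) hp0.le

end Run.Tracking

end RunAnalysis

/-! ### Scalar bookkeeping for the recursions -/

/-- The constant in the recursions for the second moments. -/
def recursionConst (σ Cra Cavg Γ Γ₀ : ℝ) : ℝ :=
  1 + (4 + 36 * (3 + 2 * Cavg) ^ 2 * Cra) + (6 * Γ + 162 * (3 + 2 * Cavg) ^ 2 * Cra * Γ) +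
    (6 * Γ₀ + 6 * (3 + 2 * Cavg) ^ 2 * (1 + 14 * Cra) +
      9 * (3 + 2 * Cavg) ^ 2 * (1 + Cra * (18 * Γ₀ + 14))) +
    (2 + 8 * Cra * (6 * σ ^ 2 + 36 * Γ₀ + 28))

/-- In the application `e` is `η²`, `w` is `pσ²/N`, `u` is the second moment of the drift, `D` that
of two consecutive spreads, and `I₁`, `I₀` are the aggregation errors on the two outcomes of the
coin. -/
lemma aggError_recursion {α Cra Γ Γ₀ e u D w σ I₁ I₀ : ℝ} (hα1 : α ≤ 1)
    (hCra : 0 ≤ Cra) (hΓ' : 0 ≤ Γ) (he : 0 ≤ e) (hΓ : Γ * e ≤ Γ₀) (hu0 : 0 ≤ u) (hD0 : 0 ≤ D)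
    (hwσ : w ≤ σ ^ 2) (hw0 : 0 ≤ w)
    (hI₁ : I₁ ≤ Cra * (6 * α * w + 14 * D))
    (hI₀ : I₀ ≤ Cra * (α * (18 * Γ * e * u) + (18 * Γ₀ + 14) * D)) :
    I₁ + I₀ ≤ Cra * (6 * σ ^ 2 + 36 * Γ₀ + 28) * (1 + u + D) := by
  have hΓ₀ : 0 ≤ Γ₀ := (mul_nonneg hΓ' he).trans hΓ
  have h1 : α * w ≤ σ ^ 2 := (mul_le_of_le_one_left hw0 hα1).trans hwσ
  have h2 : α * (18 * Γ * e * u) ≤ 18 * Γ₀ * u :=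
    (mul_le_of_le_one_left (by positivity) hα1).trans
      (by linarith [mul_le_mul_of_nonneg_right hΓ hu0])
  have h3 : I₁ + I₀ ≤ Cra * (6 * σ ^ 2 + 18 * Γ₀ * u + (18 * Γ₀ + 28) * D) := by
    refine (add_le_add hI₁ hI₀).trans ?_
    rw [← mul_add]
    refine mul_le_mul_of_nonneg_left ?_ hCra
    linarith
  refine h3.trans ?_
  rw [mul_assoc Cra]
  refine mul_le_mul_of_nonneg_left ?_ hCra
  have hσ2 := sq_nonneg σ
  linarith [mul_nonneg hσ2 hu0, mul_nonneg hσ2 hD0, mul_nonneg hΓ₀ hu0, mul_nonneg hΓ₀ hD0]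

/-- Same notation, with `h` the inverse number of honest agents. The aggregation error enters with
factor `1/p` only on the recursive branch, where its noise is proportional to `e * u`. Therefore `α`
is divided by `p` in front of the drift but not in front of the sampling noise `w`. -/
lemma gradError_recursion {α Cra Cavg Γ Γ₀ e u D w σ I₁ I₀ K p h : ℝ} (hα0 : 0 ≤ α)
    (hCra : 0 ≤ Cra) (hΓ' : 0 ≤ Γ) (he : 0 ≤ e) (hΓ : Γ * e ≤ Γ₀) (hu0 : 0 ≤ u) (hD0 : 0 ≤ D)
    (hK1 : 1 ≤ K) (hp0 : 0 < p) (hp1 : p ≤ 1) (hw0 : 0 ≤ w) (hh0 : 0 ≤ h) (hhK : h ≤ 2 / K)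
    (hx : 3 * Γ * e * (u + D) ≤ 3 * Γ * e * u + 3 * Γ₀ * D)
    (hI₁ : I₁ ≤ Cra * (6 * α * w + 14 * D))
    (hI₀ : I₀ ≤ Cra * (α * (18 * Γ * e * u) + (18 * Γ₀ + 14) * D)) :
    2 * (h * w) + 6 * (3 + 2 * Cavg) ^ 2 * (D + I₁) + (h * (3 * Γ * e * (u + D)) +
      3 / p * (3 * (3 + 2 * Cavg) ^ 2 * (D + I₀))) ≤
      recursionConst σ Cra Cavg Γ Γ₀ *
        (w * (α + 1 / K) + (α / p + 1 / K) * e * u + 1 / p * D) := by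
  have hΓ₀ : 0 ≤ Γ₀ := (mul_nonneg hΓ' he).trans hΓ
  have hh2 : h ≤ 2 := hhK.trans (div_le_self zero_le_two hK1)
  have hc0 : 0 ≤ (3 + 2 * Cavg) ^ 2 := sq_nonneg _
  rw [recursionConst]
  generalize (3 + 2 * Cavg) ^ 2 = c at *
  have hpi : 1 ≤ 1 / p := by rw [le_div_iff₀ hp0]; linarith
  rw [show 3 / p = 3 * (1 / p) by ring, show α / p = α * (1 / p) by ring]
  rw [show 2 / K = 2 * (1 / K) by ring] at hhK
  have hkpos : 0 ≤ 1 / K := by positivity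
  generalize 1 / K = k at *
  generalize 1 / p = q at *
  have hq0 : 0 ≤ q := by linarith
  have t1 : h * w ≤ 2 * k * w := by gcongr
  have t2 : h * (3 * Γ * e * (u + D)) ≤ 2 * k * (3 * Γ * e * u) + 2 * (3 * Γ₀ * D) := by
    refine (mul_le_mul_of_nonneg_left hx hh0).trans ?_
    rw [mul_add]
    gcongr
  have t3 := mul_le_mul_of_nonneg_left hI₁ (show 0 ≤ 6 * c by positivity)
  have t4 := mul_le_mul_of_nonneg_left hI₀ (show 0 ≤ 3 * q * (3 * c) by positivity)
  have hηu : 0 ≤ e * u := by positivity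
  have hqD : D ≤ q * D := le_mul_of_one_le_left hD0 hpi
  have s0 : 2 * (h * w) + 6 * c * (D + I₁) + (h * (3 * Γ * e * (u + D)) +
      3 * q * (3 * c * (D + I₀))) ≤ (4 * k + 36 * c * Cra * α) * w +
        (6 * Γ * k + 162 * c * Cra * Γ * (α * q)) * (e * u) +
        (6 * Γ₀ + 6 * c * (1 + 14 * Cra) + 9 * c * (1 + Cra * (18 * Γ₀ + 14)) * q) * D := by
    linarith
  refine s0.trans ?_
  have p1 : (4 * k + 36 * c * Cra * α) * w ≤ (4 + 36 * c * Cra) * (w * (α + k)) := by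
    have := mul_nonneg (mul_nonneg (mul_nonneg hc0 hCra) hkpos) hw0
    have := mul_nonneg hα0 hw0
    linarith
  have p2 : (6 * Γ * k + 162 * c * Cra * Γ * (α * q)) * (e * u) ≤
      (6 * Γ + 162 * c * Cra * Γ) * ((α * q + k) * e * u) := by
    have := mul_nonneg (mul_nonneg hΓ' (mul_nonneg hα0 hq0)) hηu
    have := mul_nonneg (mul_nonneg (mul_nonneg (mul_nonneg hc0 hCra) hΓ') hkpos) hηu
    linarith
  have p3 : (6 * Γ₀ + 6 * c * (1 + 14 * Cra) + 9 * c * (1 + Cra * (18 * Γ₀ + 14)) * q) * D ≤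
      (6 * Γ₀ + 6 * c * (1 + 14 * Cra) + 9 * c * (1 + Cra * (18 * Γ₀ + 14))) * (q * D) := by
    have := mul_le_mul_of_nonneg_left hqD (show 0 ≤ 6 * Γ₀ + 6 * c * (1 + 14 * Cra) by positivity)
    linarith
  have ha1 : 0 ≤ 4 + 36 * c * Cra := by positivity
  have ha2 : 0 ≤ 6 * Γ + 162 * c * Cra * Γ := by positivity
  have ha3 : 0 ≤ 6 * Γ₀ + 6 * c * (1 + 14 * Cra) + 9 * c * (1 + Cra * (18 * Γ₀ + 14)) := by
    positivity
  have ha4 : 0 ≤ 2 + 8 * Cra * (6 * σ ^ 2 + 36 * Γ₀ + 28) := by positivity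
  refine (add_le_add (add_le_add p1 p2) p3).trans ?_
  have r1 : 0 ≤ w * (α + k) := by positivity
  have r2 : 0 ≤ (α * q + k) * e * u := by positivity
  have r3 : 0 ≤ q * D := by positivity
  generalize 4 + 36 * c * Cra = a1 at *
  generalize 6 * Γ + 162 * c * Cra * Γ = a2 at *
  generalize 6 * Γ₀ + 6 * c * (1 + 14 * Cra) + 9 * c * (1 + Cra * (18 * Γ₀ + 14)) = a3 at *
  generalize 2 + 8 * Cra * (6 * σ ^ 2 + 36 * Γ₀ + 28) = a4 at *
  generalize w * (α + k) = x₁ at *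
  generalize (α * q + k) * e * u = x₂ at *
  rw [mul_add, mul_add]
  refine add_le_add (add_le_add (mul_le_mul_of_nonneg_right ?_ r1)
    (mul_le_mul_of_nonneg_right ?_ r2)) (mul_le_mul_of_nonneg_right ?_ r3) <;> linarith

/-! ### Recursions for the unconditional moments -/

section RunAnalysis

variable {S A : Type*} [MeasurableSpace S] [MeasurableSpace A] {R : ℝ} {d Hz K : ℕ}
  {Ω : Type*} [mΩ : MeasurableSpace Ω] {P : Measure Ω} [IsProbabilityMeasure P]
  {mdp : MDP S A R} {pol : Policy S A d} {γ : ℝ} {est : Estimator Hz} {inp : Input d}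
  {agg : (Fin K → Param d) → Param d} {proto : Protocol K d}
  {Hon : ℕ → Finset (Fin K)} {T : ℕ}
  {run : Run P mdp pol γ est inp agg proto Hon T}
  {α Cra Cavg δ : ℝ} {Q : ℕ → Finset (Fin K)}
  {G M σ W : ℝ}

namespace Run.Tracking

variable (hT : run.Tracking α Cra Cavg δ Q) (hA : Assumptions mdp pol γ est G M σ W)
  (hG : 0 ≤ G) (hM : 0 ≤ M) (hR : 0 ≤ R) (hγ0 : 0 ≤ γ) (hγ1 : γ < 1)
  (hηL : inp.η * smoothConst Hz R γ G M ≤ 1 / 2) (hN : 1 ≤ inp.N)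
  (hp0 : 0 < inp.p) (hp1 : inp.p ≤ 1)

include hA hG hM hR hγ0 hγ1

omit hM in
-- Drift and gradient error differ by a gradient, which is uniformly bounded.
lemma integrable_drift_sq {t : ℕ} (ht : t < T)
    (he : Integrable (fun ω => ‖run.gradError t ω‖ ^ 2) P) :
    Integrable (fun ω => ‖run.drift t ω‖ ^ 2) P := by
  have hi : Integrable (fun ω => 2 * ‖run.gradError t ω‖ ^ 2 +
      2 * (R / (1 - γ) * (Hz * G)) ^ 2) P := (he.const_mul 2).add (integrable_const _)
  refine hi.mono' (((run.measurable_drift ht).mono (run.ℱ.le _)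
    le_rfl).norm.pow_const 2).aestronglyMeasurable (Filter.Eventually.of_forall fun ω => ?_)
  rw [Real.norm_of_nonneg (sq_nonneg _)]
  have h1 := norm_add_sq_le_weighted (run.gradError t ω)
    (gradient (objective mdp pol γ Hz) (run.center t ω)) one_pos
  rw [gradError, sub_add_cancel] at h1
  have h2 := pow_le_pow_left₀ (norm_nonneg _) (hA.smoothPolicy.norm_gradient_objective_le mdp
    (Hz := Hz) hG hR hγ0 hγ1 (run.center t ω)) 2
  rw [gradError]
  linarith

omit hG hR [IsProbabilityMeasure P] in
lemma integrable_spread_succ_sq {t : ℕ} (ht : t < T)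
    (hs : Integrable (fun ω => run.spread α Cra δ t ω ^ 2) P)
    (hagg : Integrable (fun ω => run.aggError α Cra t ω ^ 2) P) :
    Integrable (fun ω => run.spread α Cra δ (t + 1) ω ^ 2) P ∧
    run.spreadSq α Cra δ (t + 1) ≤
      δ ^ 2 * (2 * run.spreadSq α Cra δ t + 8 * ∫ ω, run.aggError α Cra t ω ^ 2 ∂P) := by
  have hi : Integrable (fun ω => δ ^ 2 * (2 * run.spread α Cra δ t ω ^ 2 +
      8 * run.aggError α Cra t ω ^ 2)) P := ((hs.const_mul 2).add (hagg.const_mul 8)).const_mul _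
  have hle : ∀ ω, run.spread α Cra δ (t + 1) ω ^ 2 ≤ δ ^ 2 * (2 * run.spread α Cra δ t ω ^ 2 +
      8 * run.aggError α Cra t ω ^ 2) := by
    intro ω
    rw [spread, mul_pow]
    refine mul_le_mul_of_nonneg_left ?_ (sq_nonneg _)
    nlinarith [sq_nonneg (run.spread α Cra δ t ω - 2 * run.aggError α Cra t ω)]
  have hi' : Integrable (fun ω => run.spread α Cra δ (t + 1) ω ^ 2) P := by
    refine hi.mono' ((run.measurable_spread hA hM hγ0 hγ1 α Cra δ ht).pow_const
      2).aestronglyMeasurable (Filter.Eventually.of_forall fun ω => ?_)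
    rw [Real.norm_of_nonneg (sq_nonneg _)]
    exact hle ω
  refine ⟨hi', (integral_mono hi' hi hle).trans (le_of_eq ?_)⟩
  rw [integral_const_mul, integral_add (hs.const_mul 2) (hagg.const_mul 8), integral_const_mul,
    integral_const_mul]
  rfl

include hT hηL hN hp0 hp1

/-- In iteration `0` both outcomes of the coin use the large batch, so the two fresh bounds add up
with total probability one; the agents still coincide and there is no spread. -/
lemma zero_bound (ht : 0 < T) :
    (Integrable (fun ω => run.aggError α Cra 0 ω ^ 2) P ∧
      ∫ ω, run.aggError α Cra 0 ω ^ 2 ∂P ≤ Cra * α * (6 * (σ ^ 2 / inp.N))) ∧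
    (Integrable (fun ω => ‖run.gradError 0 ω‖ ^ 2) P ∧
      run.gradErrorSq 0 ≤ (4 + 36 * (3 + 2 * Cavg) ^ 2 * Cra) *
        (σ ^ 2 / inp.N * (α + 1 / K))) := by
  have hp : ∀ c, 0 ≤ inp.coinProb c := by
    rintro (_ | _)
    · simp [Input.coinProb, hp1]
    · simp [Input.coinProb, hp0.le]
  have hs : Integrable (fun ω => run.spread α Cra δ 0 ω ^ 2) P := by simp [spread]
  have hd : run.spreadSq α Cra δ 0 = 0 := by simp [spreadSq, spread]
  have key := fun c => hT.fresh_bound hA hG hM hR hγ0 hγ1 hηL ht (c := c) (.inr rfl) hN (hp c)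
    hs hs
  obtain ⟨ha, hae⟩ := run.integrable_of_coin ht fun c => (key c).1.1
  obtain ⟨he, hee⟩ := run.integrable_of_coin ht fun c => (key c).2.1
  have kt := key true
  have kf := key false
  simp only [hd, Input.coinProb, add_zero, mul_zero, zero_tsub, if_true, Bool.false_eq_true,
    if_false, zero_add] at kt kf
  have hs0 : 0 ≤ σ ^ 2 / inp.N := by positivity
  refine ⟨⟨ha, ?_⟩, he, ?_⟩
  · rw [hae]
    linarith [kt.1.2, kf.1.2]
  · have hinv := mul_le_mul_of_nonneg_right (hT.inv_card_le ht) hs0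
    have hCK : 0 ≤ (36 * (3 + 2 * Cavg) ^ 2 * Cra) * (σ ^ 2 / inp.N * (1 / K)) := by
      have := hT.Cra_nonneg
      positivity
    have hα : 0 ≤ 4 * (σ ^ 2 / inp.N * α) := by
      have := hT.α_nonneg
      positivity
    have h1 : run.gradErrorSq 0 ≤ 2 * (((Hon 0).card : ℝ)⁻¹ * (σ ^ 2 / inp.N)) +
        6 * (3 + 2 * Cavg) ^ 2 * (Cra * α * (6 * (σ ^ 2 / inp.N))) := by
      rw [gradErrorSq, hee]
      have h2 := mul_le_mul_of_nonneg_left (add_le_add kt.1.2 kf.1.2)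
        (show 0 ≤ 6 * (3 + 2 * Cavg) ^ 2 by positivity)
      linarith [kt.2.2, kf.2.2]
    have h3 : 2 / (K : ℝ) * (σ ^ 2 / inp.N) = 2 * (σ ^ 2 / inp.N * (1 / K)) := by ring
    linarith

/-- The two outcomes of the coin are added. Restarting contributes new sampling noise, weighted by
`p`, and no history; not restarting keeps the fraction `1 - p/2` of the old error and adds noise
driven by the movement. -/
lemma succ_bound {t : ℕ} (ht : t + 1 < T) (hB : 1 ≤ inp.B) (hW : 0 ≤ W) {Γ₀ : ℝ}
    (hΓ : changeConst est R G M W * inp.η ^ 2 ≤ Γ₀)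
    (he : Integrable (fun ω => ‖run.gradError t ω‖ ^ 2) P)
    (hs : Integrable (fun ω => run.spread α Cra δ (t + 1) ω ^ 2) P)
    (hs' : Integrable (fun ω => run.spread α Cra δ t ω ^ 2) P) :
    (Integrable (fun ω => run.aggError α Cra (t + 1) ω ^ 2) P ∧
      ∫ ω, run.aggError α Cra (t + 1) ω ^ 2 ∂P ≤
        Cra * (6 * σ ^ 2 + 36 * Γ₀ + 28) * (1 + run.driftSq t +
          (run.spreadSq α Cra δ (t + 1) + run.spreadSq α Cra δ t))) ∧
    (Integrable (fun ω => ‖run.gradError (t + 1) ω‖ ^ 2) P ∧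
      run.gradErrorSq (t + 1) ≤ (1 - inp.p / 2) * run.gradErrorSq t +
        recursionConst σ Cra Cavg (changeConst est R G M W) Γ₀ *
        (inp.p * (σ ^ 2 / inp.N * (α + 1 / K)) + (α / inp.p + 1 / K) * inp.η ^ 2 * run.driftSq t +
          1 / inp.p * (run.spreadSq α Cra δ (t + 1) + run.spreadSq α Cra δ t))) := by
  have hu := integrable_drift_sq hA hG hR hγ0 hγ1 (by omega) he
  have hΓ' := changeConst_nonneg est R G M hW
  set Γ := changeConst est R G M W with hΓdef
  set D := run.spreadSq α Cra δ (t + 1) + run.spreadSq α Cra δ t with hD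
  have hD0 : 0 ≤ D := add_nonneg (run.spreadSq_nonneg _ _ _ _) (run.spreadSq_nonneg _ _ _ _)
  have hu0 := run.driftSq_nonneg t
  set u := run.driftSq t
  have kt := hT.fresh_bound hA hG hM hR hγ0 hγ1 hηL ht (c := true) (.inl rfl) hN
    (by simp [Input.coinProb, hp0.le]) hs hs'
  have kf := hT.change_bound hA hG hM hR hγ0 hγ1 hηL ht hB hW hp0 hp1 hu he hs hs' le_rfl
  simp only [← hΓdef, ← hD, add_tsub_cancel_right, Input.coinProb, if_true] at kt kf
  obtain ⟨ha, hae⟩ := run.integrable_of_coin ht (f := fun ω => run.aggError α Cra (t + 1) ω ^ 2)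
    (by rintro (_ | _); exacts [kf.1.1, kt.1.1])
  obtain ⟨he, hee⟩ := run.integrable_of_coin ht (f := fun ω => ‖run.gradError (t + 1) ω‖ ^ 2)
    (by rintro (_ | _); exacts [kf.2.1, kt.2.1])
  set I₁ := ∫ ω in {ω | run.coin (t + 1) ω = true}, run.aggError α Cra (t + 1) ω ^ 2 ∂P
  set I₀ := ∫ ω in {ω | run.coin (t + 1) ω = false}, run.aggError α Cra (t + 1) ω ^ 2 ∂P
  set v := σ ^ 2 / (inp.N : ℝ) with hv
  have hv0 : 0 ≤ v := by positivity
  have hCra := hT.Cra_nonneg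
  have hα0 := hT.α_nonneg
  have hα1 : α ≤ 1 := by linarith [hT.α_lt]
  have hηsq := sq_nonneg inp.η
  have hΓ₀ : 0 ≤ Γ₀ := (mul_nonneg hΓ' hηsq).trans hΓ
  have hK1 : (1 : ℝ) ≤ K := by exact_mod_cast hT.K_pos
  have hx : 3 * Γ * inp.η ^ 2 * (u + D) ≤ 3 * Γ * inp.η ^ 2 * u + 3 * Γ₀ * D := by
    nlinarith [mul_le_mul_of_nonneg_right hΓ hD0]
  have hI₀ : I₀ ≤ Cra * (α * (18 * Γ * inp.η ^ 2 * u) + (18 * Γ₀ + 14) * D) := by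
    refine kf.1.2.trans ?_
    rw [mul_assoc]
    refine mul_le_mul_of_nonneg_left ?_ hCra
    have : α * ((18 * Γ₀ + 14) * D) ≤ (18 * Γ₀ + 14) * D :=
      mul_le_of_le_one_left (by positivity) hα1
    nlinarith [mul_le_mul_of_nonneg_left hx hα0]
  have hI₁ : I₁ ≤ Cra * (6 * α * (inp.p * v) + 14 * D) := by
    refine kt.1.2.trans ?_
    rw [mul_assoc]
    refine mul_le_mul_of_nonneg_left ?_ hCra
    have : α * (14 * D) ≤ 14 * D := mul_le_of_le_one_left (by positivity) hα1
    linarith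
  refine ⟨⟨ha, ?_⟩, he, ?_⟩
  · rw [hae]
    have hvσ : inp.p * v ≤ σ ^ 2 := by
      refine (mul_le_of_le_one_left hv0 hp1).trans (div_le_self (sq_nonneg _) ?_)
      exact_mod_cast hN
    exact aggError_recursion hα1 hCra hΓ' hηsq hΓ hu0 hD0 hvσ (by positivity) hI₁ hI₀
  · rw [gradErrorSq, hee]
    refine (add_le_add kt.2.2 kf.2.2).trans ?_
    have hinv0 : 0 ≤ ((Hon (t + 1)).card : ℝ)⁻¹ := by positivity
    have hpv : 0 ≤ inp.p * v := by positivity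
    have key := gradError_recursion (σ := σ) (Cavg := Cavg) hα0 hCra hΓ' hηsq hΓ hu0 hD0
      hK1 hp0 hp1 hpv hinv0 (hT.inv_card_le ht) hx hI₁ hI₀
    linarith

end Run.Tracking

end RunAnalysis

/-! ### Solving the coupled recursions -/

/-- The bound that results from the recursions for the second moments `a` of the gradient error, `u`
of the drift, `d` of the spread, `g` of the gradient, and for the mean `j` of the objective. -/
lemma sum_le_of_recursions {n : ℕ} {a u d g j : ℕ → ℝ} {Λ p s y δ η : ℝ} (hΛ : 1 ≤ Λ)
    (hp0 : 0 < p) (hp1 : p ≤ 1) (hs : 0 ≤ s) (hδ0 : 0 ≤ δ) (hη : 0 < η) (hy0 : 0 ≤ y)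
    (hu : ∀ t, 0 ≤ u t) (hd : ∀ t, 0 ≤ d t)
    (ha0 : a 0 ≤ Λ * s)
    (ha : ∀ t < n, a (t + 1) ≤ (1 - p / 2) * a t +
      Λ * (p * s + y * u t + 1 / p * (d (t + 1) + d t)))
    (hd0 : d 0 = 0) (hd1 : d 1 ≤ Λ * δ ^ 2)
    (hd2 : ∀ t, t + 1 < n → d (t + 2) ≤ Λ * δ ^ 2 * (1 + u t + (d (t + 1) + d t)))
    (hj : ∀ t < n + 1, j t + η / 2 * g t - η / 2 * a t + η / 4 * u t ≤ j (t + 1))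
    (hy : Λ * y ≤ p / 16) (hδ : 36 * Λ ^ 2 * δ ≤ p ^ 2) :
    ∑ t ∈ Finset.range (n + 1), (2 * g t + 1 / 2 * d t) ≤
      4 * (j (n + 1) - j 0) / η + (n + 1) * (4 * Λ * s + δ / 2) := by
  have hΛ0 : 0 < Λ := by linarith
  set Su := ∑ t ∈ Finset.range (n + 1), u t with hSu
  set Sd := ∑ t ∈ Finset.range (n + 1), d t with hSd
  set Sa := ∑ t ∈ Finset.range (n + 1), a t with hSa
  set Sg := ∑ t ∈ Finset.range (n + 1), g t with hSg
  have hSu0 : 0 ≤ Su := Finset.sum_nonneg fun t _ => hu t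
  have hSd0 : 0 ≤ Sd := Finset.sum_nonneg fun t _ => hd t
  -- the telescoping sum of the objective
  have h1 : ∀ m ≤ n + 1, η / 2 * ∑ t ∈ Finset.range m, g t - η / 2 * ∑ t ∈ Finset.range m, a t +
      η / 4 * ∑ t ∈ Finset.range m, u t ≤ j m - j 0 := by
    intro m hm
    induction m with
    | zero => simp
    | succ m ih =>
      simp only [Finset.sum_range_succ]
      linarith [ih (by omega), hj m (by omega)]
  -- the gradient error beyond its stationary level
  let b : ℕ → ℝ := fun t => max (a t - 2 * Λ * s) 0
  have hb0 : ∀ t, 0 ≤ b t := fun t => le_max_right _ _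
  have hab : ∀ t, a t - 2 * Λ * s ≤ b t := fun t => le_max_left _ _
  have h2 : ∀ m ≤ n, p / 2 * ∑ t ∈ Finset.range m, b t + b m ≤
      Λ * y * ∑ t ∈ Finset.range m, u t +
        Λ / p * ∑ t ∈ Finset.range m, (d (t + 1) + d t) := by
    intro m hm
    induction m with
    | zero =>
      have : a 0 - 2 * Λ * s ≤ 0 := by nlinarith
      simp [b, this]
    | succ m ih =>
      simp only [Finset.sum_range_succ]
      have hr : 0 ≤ Λ * y * u m + Λ / p * (d (m + 1) + d m) :=
        add_nonneg (mul_nonneg (mul_nonneg hΛ0.le hy0) (hu m))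
          (mul_nonneg (by positivity) (add_nonneg (hd _) (hd _)))
      -- `2Λs` is the fixed point of `x ↦ (1 - p/2) x + Λps`, so the excess over it contracts
      -- without a constant source. Taking the positive part allows the last excess to be dropped
      -- from the summed inequality.
      have hstep : b (m + 1) ≤ (1 - p / 2) * b m +
          (Λ * y * u m + Λ / p * (d (m + 1) + d m)) := by
        refine max_le ?_ (add_nonneg (mul_nonneg (by linarith) (hb0 m)) hr)
        have e : Λ * (p * s + y * u m + 1 / p * (d (m + 1) + d m)) =
          Λ * p * s + (Λ * y * u m + Λ / p * (d (m + 1) + d m)) := by ring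
        have h3 := mul_le_mul_of_nonneg_left (hab m) (show 0 ≤ 1 - p / 2 by linarith)
        have h4 := ha m (by omega)
        rw [e] at h4
        linarith
      linarith [ih (by omega)]
  have h3 : p / 2 * ∑ t ∈ Finset.range (n + 1), b t ≤ Λ * y * Su + 2 * (Λ / p) * Sd := by
    have e1 := h2 n le_rfl
    have e2 : ∑ t ∈ Finset.range n, u t ≤ Su := by
      rw [hSu, Finset.sum_range_succ]; linarith [hu n]
    have e3 : ∑ t ∈ Finset.range n, (d (t + 1) + d t) ≤ 2 * Sd := by
      rw [Finset.sum_add_distrib]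
      have f1 : Sd = ∑ t ∈ Finset.range n, d t + d n := Finset.sum_range_succ _ _
      have f2 : Sd = ∑ t ∈ Finset.range n, d (t + 1) + d 0 := Finset.sum_range_succ' _ _
      linarith [hd n, hd 0]
    have e4 := mul_le_mul_of_nonneg_left e2 (mul_nonneg hΛ0.le hy0)
    have e5 := mul_le_mul_of_nonneg_left e3 (show 0 ≤ Λ / p by positivity)
    rw [Finset.sum_range_succ]
    nlinarith [hb0 n]
  have h4 : Sa ≤ (n + 1) * (2 * Λ * s) + ∑ t ∈ Finset.range (n + 1), b t := by
    have := Finset.sum_le_sum fun t (_ : t ∈ Finset.range (n + 1)) => hab t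
    rw [Finset.sum_sub_distrib, Finset.sum_const, Finset.card_range, nsmul_eq_mul] at this
    push_cast at this
    linarith
  -- the spread
  have h5 : ∀ m, m < n → ∑ t ∈ Finset.range (m + 2), d t ≤ Λ * δ ^ 2 * (m + 1 +
      ∑ t ∈ Finset.range m, u t + ∑ t ∈ Finset.range m, d t +
        ∑ t ∈ Finset.range (m + 1), d t) := by
    intro m hm
    induction m with
    | zero => simpa [Finset.sum_range_succ, hd0] using hd1
    | succ m ih =>
      have i1 := ih (by omega)
      have i2 := hd2 m hm
      rw [Finset.sum_range_succ]
      refine (add_le_add i1 i2).trans (le_of_eq ?_)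
      rw [← mul_add]
      congr 1
      rw [Finset.sum_range_succ u m, Finset.sum_range_succ d (m + 1), Finset.sum_range_succ d m]
      push_cast
      ring
  have hΛδ0 : 0 ≤ Λ * δ ^ 2 := by positivity
  have h6 : Sd ≤ Λ * δ ^ 2 * (n + 1 + Su + 2 * Sd) := by
    rcases n with _ | m
    · have : Sd = 0 := by simp [hSd, hd0]
      rw [this]; positivity
    · refine (h5 m (by omega)).trans (mul_le_mul_of_nonneg_left ?_ hΛδ0)
      have f1 : Sd = ∑ t ∈ Finset.range (m + 1), d t + d (m + 1) := Finset.sum_range_succ _ _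
      have f2 : ∑ t ∈ Finset.range (m + 1), d t = ∑ t ∈ Finset.range m, d t + d m :=
        Finset.sum_range_succ _ _
      have f3 : Su = ∑ t ∈ Finset.range m, u t + u m + u (m + 1) := by
        rw [hSu, Finset.sum_range_succ, Finset.sum_range_succ]
      push_cast
      linarith [hu m, hu (m + 1), hd m, hd (m + 1)]
  have hp2 : p ^ 2 ≤ 1 := pow_le_one₀ hp0.le hp1
  have hδ36 : Λ * δ ≤ 1 / 36 := by nlinarith
  have hδ1 : δ ≤ 1 / 36 := by nlinarith
  have h7 : Sd ≤ 2 * (Λ * δ ^ 2) * (n + 1 + Su) := by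
    have : Λ * δ ^ 2 ≤ 1 / 4 := by nlinarith
    have := mul_le_mul_of_nonneg_right this hSd0
    linarith
  have hn : (0 : ℝ) ≤ n + 1 + Su := by positivity
  -- The two coefficients are the spread's share in the gradient error and in the claim. Since `Sd`
  -- is of order `δ²`, the condition `36Λ²δ ≤ p²` pays for `1/p²` with one factor `δ`, and the other
  -- survives as the final agreement error.
  have h8 : (8 * Λ / p ^ 2 + 1 / 2) * Sd ≤ δ / 2 * (n + 1 + Su) := by
    have e1 : 8 * Λ / p ^ 2 + 1 / 2 ≤ 9 * Λ / p ^ 2 := by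
      have : 1 / 2 ≤ Λ / p ^ 2 := by rw [le_div_iff₀ (by positivity)]; linarith
      linarith [show 9 * Λ / p ^ 2 = 8 * Λ / p ^ 2 + Λ / p ^ 2 by ring]
    have e2 : 9 * Λ / p ^ 2 * (2 * (Λ * δ ^ 2)) ≤ δ / 2 := by
      rw [div_mul_eq_mul_div, div_le_iff₀ (by positivity)]
      nlinarith [mul_le_mul_of_nonneg_left hδ hδ0]
    calc (8 * Λ / p ^ 2 + 1 / 2) * Sd ≤ 9 * Λ / p ^ 2 * Sd := by gcongr
      _ ≤ 9 * Λ / p ^ 2 * (2 * (Λ * δ ^ 2) * (n + 1 + Su)) := by gcongr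
      _ = 9 * Λ / p ^ 2 * (2 * (Λ * δ ^ 2)) * (n + 1 + Su) := by ring
      _ ≤ _ := by gcongr
  have h9 : 2 * ∑ t ∈ Finset.range (n + 1), b t ≤ 1 / 4 * Su + 8 * Λ / p ^ 2 * Sd := by
    have e1 := h3.trans (add_le_add (mul_le_mul_of_nonneg_right hy hSu0) le_rfl)
    have e2 := mul_le_mul_of_nonneg_left e1 (show 0 ≤ 4 / p by positivity)
    have e3 : 4 / p * (p / 2 * ∑ t ∈ Finset.range (n + 1), b t) =
      2 * ∑ t ∈ Finset.range (n + 1), b t := by field_simp; ring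
    have e4 : 4 / p * (p / 16 * Su + 2 * (Λ / p) * Sd) = 1 / 4 * Su + 8 * Λ / p ^ 2 * Sd := by
      field_simp; ring
    rwa [e3, e4] at e2
  -- This is the telescoped ascent inequality multiplied by `4/η`. The term `-Su` outweighs `Su / 4`
  -- from `h9` and the small multiple from `h8`.
  have h10 : 2 * Sg ≤ 4 * (j (n + 1) - j 0) / η + 2 * Sa - Su := by
    have e1 := h1 (n + 1) le_rfl
    have e2 : 2 * Sg - 2 * Sa + Su = 4 * (η / 2 * Sg - η / 2 * Sa + η / 4 * Su) / η := by
      field_simp; ring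
    have e3 : 4 * (η / 2 * Sg - η / 2 * Sa + η / 4 * Su) / η ≤ 4 * (j (n + 1) - j 0) / η := by
      gcongr
    linarith
  rw [Finset.sum_add_distrib, ← Finset.mul_sum, ← Finset.mul_sum]
  have h11 : δ * Su ≤ 1 / 36 * Su := by gcongr
  linarith

lemma one_le_recursionConst {σ Cra Cavg Γ Γ₀ : ℝ} (hCra : 0 ≤ Cra) (hΓ : 0 ≤ Γ) (hΓ₀ : 0 ≤ Γ₀) :
    1 ≤ recursionConst σ Cra Cavg Γ Γ₀ := by
  unfold recursionConst
  rw [add_assoc, add_assoc, add_assoc]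
  exact le_add_of_nonneg_right (by positivity)

/-! ### The accumulated gradient along a run -/

section RunAnalysis

variable {S A : Type*} [MeasurableSpace S] [MeasurableSpace A] {R : ℝ} {d Hz K : ℕ}
  {Ω : Type*} [mΩ : MeasurableSpace Ω] {P : Measure Ω} [IsProbabilityMeasure P]
  {mdp : MDP S A R} {pol : Policy S A d} {γ : ℝ} {est : Estimator Hz} {inp : Input d}
  {agg : (Fin K → Param d) → Param d} {proto : Protocol K d}
  {Hon : ℕ → Finset (Fin K)} {T : ℕ}
  {run : Run P mdp pol γ est inp agg proto Hon T}
  {α Cra Cavg δ : ℝ} {Q : ℕ → Finset (Fin K)}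
  {G M σ W : ℝ}

namespace Run.Tracking

variable (hT : run.Tracking α Cra Cavg δ Q) (hA : Assumptions mdp pol γ est G M σ W)
  (hG : 0 ≤ G) (hM : 0 ≤ M) (hR : 0 ≤ R) (hγ0 : 0 ≤ γ) (hγ1 : γ < 1)
  (hηL : inp.η * smoothConst Hz R γ G M ≤ 1 / 2) (hN : 1 ≤ inp.N) (hB : 1 ≤ inp.B)
  (hp0 : 0 < inp.p) (hp1 : inp.p ≤ 1) (hW : 0 ≤ W) {Γ₀ : ℝ}
  (hΓ : changeConst est R G M W * inp.η ^ 2 ≤ Γ₀)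

include hT hA hG hM hR hγ0 hγ1 hηL

omit hT hM hηL in
lemma integrable_gradient_sq {X : Ω → Param d} (hX : Measurable X) :
    Integrable (fun ω => ‖gradient (objective mdp pol γ Hz) (X ω)‖ ^ 2) P := by
  have hJ := hA.smoothPolicy.measurable_gradient_objective (Hz := Hz) mdp hG hR hγ0 hγ1
  refine (integrable_const ((R / (1 - γ) * (Hz * G)) ^ 2)).mono'
    ((hJ.comp hX).norm.pow_const 2).aestronglyMeasurable (Filter.Eventually.of_forall fun ω => ?_)
  rw [Real.norm_of_nonneg (sq_nonneg _)]
  exact pow_le_pow_left₀ (norm_nonneg _)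
    (hA.smoothPolicy.norm_gradient_objective_le mdp hG hR hγ0 hγ1 _) 2

omit hT hηL hM in
lemma integrable_objective {X : Ω → Param d} (hX : Measurable X) :
    Integrable (fun ω => objective mdp pol γ Hz (X ω)) P := by
  have hJ : Continuous (objective mdp pol γ Hz) := continuous_iff_continuousAt.2 fun θ =>
    (hA.smoothPolicy.hasGradientAt_gradient_objective mdp hG hR hγ0 hγ1 θ).continuousAt
  refine (integrable_const (R / (1 - γ))).mono'
    (hJ.measurable.comp hX).aestronglyMeasurable (Filter.Eventually.of_forall fun ω => ?_)
  rw [Real.norm_of_nonneg (objective_nonneg hγ0 _)]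
  exact objective_le hR hγ0 hγ1 _

include hN hp0 hp1 hB hW hΓ

/-- Integrability must be carried along inductively: the variance of the next estimates is a moment
of the preceding drift and spread. -/
lemma integrable_all (t : ℕ) (ht : t < T) :
    Integrable (fun ω => run.spread α Cra δ t ω ^ 2) P ∧
    Integrable (fun ω => run.aggError α Cra t ω ^ 2) P ∧
    Integrable (fun ω => ‖run.gradError t ω‖ ^ 2) P := by
  induction t with
  | zero =>
    have h := hT.zero_bound hA hG hM hR hγ0 hγ1 hηL hN hp0 hp1 ht
    exact ⟨by simp [spread], h.1.1, h.2.1⟩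
  | succ t ih =>
    obtain ⟨h1, h2, h3⟩ := ih (by omega)
    have hs := (integrable_spread_succ_sq (δ := δ) hA hM hγ0 hγ1 (by omega) h1 h2).1
    have h := hT.succ_bound hA hG hM hR hγ0 hγ1 hηL hN hp0 hp1 ht hB hW hΓ h3 hs h1
    exact ⟨hs, h.1.1, h.2.1⟩

omit hB hW hΓ in
lemma spreadSq_one_le (ht : 0 < T) (hCΓ : 0 ≤ changeConst est R G M W) (hΓ₀ : 0 ≤ Γ₀) :
    run.spreadSq α Cra δ 1 ≤
      recursionConst σ Cra Cavg (changeConst est R G M W) Γ₀ * δ ^ 2 := by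
  have h := (hT.zero_bound hA hG hM hR hγ0 hγ1 hηL hN hp0 hp1 ht).1
  have hs : Integrable (fun ω => run.spread α Cra δ 0 ω ^ 2) P := by simp [spread]
  have hd : run.spreadSq α Cra δ 0 = 0 := by simp [spreadSq, spread]
  refine (integrable_spread_succ_sq (δ := δ) hA hM hγ0 hγ1 ht hs h.1).2.trans ?_
  rw [hd, mul_comm _ (δ ^ 2)]
  refine mul_le_mul_of_nonneg_left ?_ (sq_nonneg _)
  have hCra := hT.Cra_nonneg
  have hN1 : (1 : ℝ) ≤ inp.N := by exact_mod_cast hN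
  have hα : α ≤ 1 := by linarith [hT.α_lt]
  have h1 : Cra * α * (6 * (σ ^ 2 / inp.N)) ≤ Cra * 1 * (6 * σ ^ 2) := by
    gcongr
    exact div_le_self (sq_nonneg _) hN1
  have h2 : 8 * Cra * (6 * σ ^ 2) ≤ recursionConst σ Cra Cavg (changeConst est R G M W) Γ₀ := by
    unfold recursionConst
    rw [show 8 * Cra * (6 * σ ^ 2 + 36 * Γ₀ + 28) =
      8 * Cra * (36 * Γ₀ + 28) + 8 * Cra * (6 * σ ^ 2) by ring, ← add_assoc, ← add_assoc]
    exact le_add_of_nonneg_left (by positivity)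
  linarith [h.2]

lemma spreadSq_add_two_le {t : ℕ} (ht : t + 1 < T) (hΓ₀ : 0 ≤ Γ₀) :
    run.spreadSq α Cra δ (t + 2) ≤ recursionConst σ Cra Cavg (changeConst est R G M W) Γ₀ *
      δ ^ 2 * (1 + run.driftSq t +
        (run.spreadSq α Cra δ (t + 1) + run.spreadSq α Cra δ t)) := by
  obtain ⟨h1, h2, h3⟩ := hT.integrable_all hA hG hM hR hγ0 hγ1 hηL hN hB hp0 hp1 hW hΓ (t + 1) ht
  obtain ⟨h1', h2', h3'⟩ :=
    hT.integrable_all hA hG hM hR hγ0 hγ1 hηL hN hB hp0 hp1 hW hΓ t (by omega)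
  have h := (hT.succ_bound hA hG hM hR hγ0 hγ1 hηL hN hp0 hp1 ht hB hW hΓ h3' h1 h1').1.2
  refine (integrable_spread_succ_sq (δ := δ) hA hM hγ0 hγ1 ht h1 h2).2.trans ?_
  rw [mul_comm _ (δ ^ 2), mul_assoc]
  refine mul_le_mul_of_nonneg_left ?_ (sq_nonneg _)
  have hCra := hT.Cra_nonneg
  have hCΓ := changeConst_nonneg est R G M hW
  have hd0 := run.spreadSq_nonneg α Cra δ t
  have hd1 := run.spreadSq_nonneg α Cra δ (t + 1)
  have hu := run.driftSq_nonneg t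
  have h2 : 2 + 8 * Cra * (6 * σ ^ 2 + 36 * Γ₀ + 28) ≤
      recursionConst σ Cra Cavg (changeConst est R G M W) Γ₀ := by
    unfold recursionConst
    exact le_add_of_nonneg_left (by positivity)
  refine le_trans ?_ (mul_le_mul_of_nonneg_right h2 (by linarith))
  linarith

omit hB hW hΓ hT hN hp0 hp1 hM in
-- Polarization gives `2⟪∇J, u⟫ = ‖∇J‖² + ‖u‖² - ‖u - ∇J‖²`, and half of the resulting `η/2 ‖u‖²`
-- pays for the quadratic term because `ηL ≤ 1/2`.
lemma objective_ascent (hη : 0 < inp.η) {t : ℕ} (ht : t < T)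
    (he : Integrable (fun ω => ‖run.gradError t ω‖ ^ 2) P) :
    ∫ ω, objective mdp pol γ Hz (run.center t ω) ∂P +
      inp.η / 2 * ∫ ω, ‖gradient (objective mdp pol γ Hz) (run.center t ω)‖ ^ 2 ∂P -
      inp.η / 2 * run.gradErrorSq t + inp.η / 4 * run.driftSq t ≤
      ∫ ω, objective mdp pol γ Hz (run.center (t + 1) ω) ∂P := by
  have hc := (run.measurable_center ht.le).mono (run.ℱ.le _) le_rfl
  have hc' := (run.measurable_center (Nat.succ_le_of_lt ht)).mono (run.ℱ.le _) le_rfl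
  have h1 := integrable_objective (P := P) hA hG hR hγ0 hγ1 hc
  have h1' := integrable_objective (P := P) hA hG hR hγ0 hγ1 hc'
  have h2 := integrable_gradient_sq (P := P) hA hG hR hγ0 hγ1 hc
  have h3 := integrable_drift_sq hA hG hR hγ0 hγ1 ht he
  have h12 : Integrable (fun ω => objective mdp pol γ Hz (run.center t ω) +
      inp.η / 2 * ‖gradient (objective mdp pol γ Hz) (run.center t ω)‖ ^ 2) P :=
    h1.add (h2.const_mul _)
  have h123 : Integrable (fun ω => objective mdp pol γ Hz (run.center t ω) +
      inp.η / 2 * ‖gradient (objective mdp pol γ Hz) (run.center t ω)‖ ^ 2 -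
      inp.η / 2 * ‖run.gradError t ω‖ ^ 2) P := h12.sub (he.const_mul _)
  have h1234 : Integrable (fun ω => objective mdp pol γ Hz (run.center t ω) +
      inp.η / 2 * ‖gradient (objective mdp pol γ Hz) (run.center t ω)‖ ^ 2 -
      inp.η / 2 * ‖run.gradError t ω‖ ^ 2 + inp.η / 4 * ‖run.drift t ω‖ ^ 2) P :=
    h123.add (h3.const_mul _)
  refine le_trans (le_of_eq ?_) (integral_mono h1234 h1' fun ω => ?_)
  · rw [integral_add h123 (h3.const_mul _), integral_sub h12 (he.const_mul _),
      integral_add h1 (h2.const_mul _), integral_const_mul, integral_const_mul,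
      integral_const_mul]
    rfl
  · have q := quadratic_lower_bound
      (hA.smoothPolicy.hasGradientAt_gradient_objective mdp hG hR hγ0 hγ1 (Hz := Hz))
      (hA.smoothPolicy.norm_gradient_objective_sub_le mdp hG hR hγ0 hγ1) (run.center t ω)
      (inp.η • run.drift t ω)
    have e : run.center t ω + inp.η • run.drift t ω = run.center (t + 1) ω := by
      rw [drift, smul_smul, mul_inv_cancel₀ hη.ne', one_smul, add_sub_cancel]
    rw [e, norm_smul, inner_smul_right, Real.norm_of_nonneg hη.le, mul_pow] at q
    have e2 : ‖run.gradError t ω‖ ^ 2 = ‖run.drift t ω‖ ^ 2 -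
        2 * inner ℝ (gradient (objective mdp pol γ Hz) (run.center t ω)) (run.drift t ω) +
        ‖gradient (objective mdp pol γ Hz) (run.center t ω)‖ ^ 2 := by
      rw [gradError, norm_sub_sq_real, real_inner_comm]
    have e3 : smoothConst Hz R γ G M / 2 * (inp.η ^ 2 * ‖run.drift t ω‖ ^ 2) ≤
        inp.η / 4 * ‖run.drift t ω‖ ^ 2 := by
      have := mul_le_mul_of_nonneg_left hηL (show 0 ≤ inp.η / 2 * ‖run.drift t ω‖ ^ 2 by positivity)
      linarith
    simp only [e2]
    linarith

/-- The accumulated squared norm of the gradient along the run of an agent that stays close to the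
honest ones. -/
lemma sum_integral_gradient_sq_le (hΓ₀ : 0 ≤ Γ₀) (hT1 : 1 ≤ T)
    (hy : recursionConst σ Cra Cavg (changeConst est R G M W) Γ₀ *
      ((α / inp.p + 1 / K) * inp.η ^ 2) ≤ inp.p / 16)
    (hδ : 36 * recursionConst σ Cra Cavg (changeConst est R G M W) Γ₀ ^ 2 * δ ≤ inp.p ^ 2)
    {k : Fin K} (hk : ∀ t < T, k ∈ Q t) :
    ∑ t ∈ Finset.range T, ∫ ω, ‖gradient (objective mdp pol γ Hz) (run.θ t k ω)‖ ^ 2 ∂P ≤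
      4 * ((⨆ θ, objective mdp pol γ Hz θ) - objective mdp pol γ Hz inp.θ₀) / inp.η +
        T * (4 * recursionConst σ Cra Cavg (changeConst est R G M W) Γ₀ *
          (σ ^ 2 / inp.N * (α + 1 / K)) + δ / 2) := by
  have hη := hT.η_pos
  have hCΓ := changeConst_nonneg est R G M hW
  have hα := hT.α_nonneg
  have hint := hT.integrable_all hA hG hM hR hγ0 hγ1 hηL hN hB hp0 hp1 hW hΓ
  have hΛ : 1 ≤ recursionConst σ Cra Cavg (changeConst est R G M W) Γ₀ :=
    one_le_recursionConst hT.Cra_nonneg hCΓ hΓ₀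
  have hΛ4 : 4 + 36 * (3 + 2 * Cavg) ^ 2 * Cra ≤
      recursionConst σ Cra Cavg (changeConst est R G M W) Γ₀ := by
    have hCra := hT.Cra_nonneg
    unfold recursionConst
    rw [add_assoc, add_assoc, add_comm 1, add_assoc]
    exact le_add_of_nonneg_right (by positivity)
  obtain ⟨n, rfl⟩ : ∃ n, T = n + 1 := ⟨T - 1, by omega⟩
  have key := sum_le_of_recursions (n := n) (a := run.gradErrorSq) (u := run.driftSq)
    (d := run.spreadSq α Cra δ)
    (g := fun t => ∫ ω, ‖gradient (objective mdp pol γ Hz) (run.center t ω)‖ ^ 2 ∂P)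
    (j := fun t => ∫ ω, objective mdp pol γ Hz (run.center t ω) ∂P)
    (s := σ ^ 2 / inp.N * (α + 1 / K)) (y := (α / inp.p + 1 / K) * inp.η ^ 2)
    hΛ hp0 hp1 (by positivity) hT.δ_nonneg hη (by positivity) run.driftSq_nonneg
    (run.spreadSq_nonneg α Cra δ)
    ((hT.zero_bound hA hG hM hR hγ0 hγ1 hηL hN hp0 hp1 (by omega)).2.2.trans
      (mul_le_mul_of_nonneg_right hΛ4 (by positivity)))
    (fun t ht => (hT.succ_bound hA hG hM hR hγ0 hγ1 hηL hN hp0 hp1 (by omega) hB hW hΓ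
      (hint t (by omega)).2.2 (hint (t + 1) (by omega)).1 (hint t (by omega)).1).2.2)
    (by simp [spreadSq, spread])
    (hT.spreadSq_one_le hA hG hM hR hγ0 hγ1 hηL hN hp0 hp1 (by omega) hCΓ hΓ₀)
    (fun t ht => hT.spreadSq_add_two_le hA hG hM hR hγ0 hγ1 hηL hN hB hp0 hp1 hW hΓ (by omega) hΓ₀)
    (fun t ht => objective_ascent hA hG hR hγ0 hγ1 hηL hη ht (hint t ht).2.2) hy hδ
  have hj0 : ∫ ω, objective mdp pol γ Hz (run.center 0 ω) ∂P = objective mdp pol γ Hz inp.θ₀ := by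
    simp [center]
  have hjT : ∫ ω, objective mdp pol γ Hz (run.center (n + 1) ω) ∂P ≤
      ⨆ θ, objective mdp pol γ Hz θ := by
    have hc := (run.measurable_center le_rfl).mono (run.ℱ.le _) le_rfl
    refine (integral_mono (integrable_objective hA hG hR hγ0 hγ1 hc)
      (integrable_const (⨆ θ, objective mdp pol γ Hz θ)) fun ω =>
        objective_le_iSup hR hγ0 hγ1 _).trans (by simp)
  refine le_trans (Finset.sum_le_sum fun t ht => ?_) (key.trans ?_)
  · have ht' : t < n + 1 := Finset.mem_range.1 ht
    have hc := (run.measurable_center ht'.le).mono (run.ℱ.le _) le_rfl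
    have i1 := integrable_gradient_sq (P := P) hA hG hR hγ0 hγ1 hc
    have i2 := integrable_gradient_sq (P := P) hA hG hR hγ0 hγ1
      (run.measurable_θ' ht'.le k)
    have i3 := (hint t ht').1
    have i4 : Integrable (fun ω => 2 * ‖gradient (objective mdp pol γ Hz) (run.center t ω)‖ ^ 2 +
        1 / 2 * run.spread α Cra δ t ω ^ 2) P := (i1.const_mul _).add (i3.const_mul _)
    refine (integral_mono i2 i4 fun ω => ?_).trans (le_of_eq ?_)
    -- Passing from the centre to agent `k` costs at most `1/2` times the spread in the gradient, so
    -- the squared norm is at most `2 ‖∇J(x_t)‖² + 1/2 * spread²`, the summand in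
    -- `sum_le_of_recursions`.
    · have h1 := hA.norm_gradient_sub_le hG hM hR hγ0 hγ1 hηL
        (run.spread_nonneg hT.δ_nonneg α Cra ω t)
        ((hT.norm_sub_le ht'.le ω).2 k (hk t ht'))
      have h2 := norm_add_sq_le_weighted (gradient (objective mdp pol γ Hz) (run.center t ω))
        (gradient (objective mdp pol γ Hz) (run.θ t k ω) -
          gradient (objective mdp pol γ Hz) (run.center t ω)) one_pos
      rw [add_sub_cancel] at h2
      have h3 := pow_le_pow_left₀ (norm_nonneg _) h1 2
      simp only
      linarith
    · rw [integral_add (i1.const_mul _) (i3.const_mul _), integral_const_mul, integral_const_mul]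
      rfl
  · push_cast
    refine add_le_add ?_ le_rfl
    rw [hj0]
    gcongr

end Run.Tracking

end RunAnalysis

/-! ### The random output time -/

/-- The expectation of a process at an independent, uniformly distributed time. -/
lemma integral_uniform_time {Ω : Type*} {m mΩ : MeasurableSpace Ω} {P : Measure Ω}
    [IsProbabilityMeasure P] {T : ℕ} (hT : 1 ≤ T) {That : Ω → ℕ}
    (hmeas : Measurable That) (hunif : ∀ t < T, P {ω | That ω = t} = 1 / (T : ℝ≥0∞))
    (hind : Indep (MeasurableSpace.comap That ⊤) m P) {f : ℕ → Ω → ℝ}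
    (hf : ∀ t < T, Measurable[m] (f t)) (hfi : ∀ t < T, Integrable (f t) P) :
    Integrable (fun ω => f (That ω) ω) P ∧
      ∫ ω, f (That ω) ω ∂P = (T : ℝ)⁻¹ * ∑ t ∈ Finset.range T, ∫ ω, f t ω ∂P := by
  have hset : ∀ t, MeasurableSet {ω | That ω = t} := fun t => hmeas (measurableSet_singleton t)
  -- The prescribed masses of the values below `T` already add up to one.
  have hlt : ∀ᵐ ω ∂P, That ω < T := by
    have h1 : P {ω | That ω < T} = 1 := by
      have e : {ω | That ω < T} = ⋃ t ∈ Finset.range T, {ω | That ω = t} := by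
        ext ω; simp
      rw [e, measure_biUnion_finset (fun s _ t _ hst => Set.disjoint_left.2 fun ω h1 h2 =>
        hst (h1.symm.trans h2)) fun t _ => hset t,
        Finset.sum_congr rfl fun t ht => hunif t (Finset.mem_range.1 ht)]
      rw [Finset.sum_const, Finset.card_range, nsmul_eq_mul, one_div]
      exact ENNReal.mul_inv_cancel (by exact_mod_cast (by omega : T ≠ 0))
        (ENNReal.natCast_ne_top T)
    exact (prob_compl_eq_zero_iff (hmeas measurableSet_Iio)).2 h1
  let X : ℕ → Ω → ℝ := fun t ω => {ω | That ω = t}.indicator 1 ω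
  have hX : ∀ t, Measurable[MeasurableSpace.comap That ⊤] (X t) := fun t => by
    have e : X t = (fun n => if n = t then (1 : ℝ) else 0) ∘ That := by
      ext ω
      simp [X, Set.indicator_apply]
    rw [e]
    exact measurable_from_top.comp (comap_measurable That)
  have hindf : ∀ t < T, IndepFun (X t) (f t) P := fun t ht =>
    indep_of_indep_of_le_left (indep_of_indep_of_le_right hind (hf t ht).comap_le)
      (hX t).comap_le
  have hXm : ∀ t, Measurable (X t) := fun t => measurable_one.indicator (hset t)
  have hXi : ∀ t, Integrable (X t) P := fun t => (integrable_const (1 : ℝ)).indicator (hset t)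
  have hprod : ∀ t ∈ Finset.range T, Integrable (fun ω => X t ω * f t ω) P := fun t ht =>
    (hindf t (Finset.mem_range.1 ht)).integrable_mul (hXi t) (hfi t (Finset.mem_range.1 ht))
  have hsum : (fun ω => f (That ω) ω) =ᵐ[P] fun ω => ∑ t ∈ Finset.range T, X t ω * f t ω := by
    filter_upwards [hlt] with ω hω
    rw [Finset.sum_eq_single (That ω)]
    · simp [X]
    · intro t _ hne
      simp [X, hne.symm]
    · simp [hω]
  refine ⟨(integrable_finsetSum _ hprod).congr hsum.symm, ?_⟩
  rw [integral_congr_ae hsum, integral_finsetSum _ hprod, Finset.mul_sum]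
  refine Finset.sum_congr rfl fun t ht => ?_
  have ht' := Finset.mem_range.1 ht
  rw [(hindf t ht').integral_fun_mul_eq_mul_integral (hXi t).aestronglyMeasurable
    (hfi t ht').aestronglyMeasurable]
  congr 1
  rw [integral_indicator_one (hset t), Measure.real, hunif t ht']
  simp

/-! ### Tracked agents and the contraction factor -/

section RunAnalysis

variable {S A : Type*} [MeasurableSpace S] [MeasurableSpace A] {R : ℝ} {d Hz K : ℕ}
  {Ω : Type*} [mΩ : MeasurableSpace Ω] {P : Measure Ω}
  {mdp : MDP S A R} {pol : Policy S A d} {γ : ℝ} {est : Estimator Hz} {inp : Input d}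
  {agg : (Fin K → Param d) → Param d} {proto : Protocol K d}
  {Hon : ℕ → Finset (Fin K)} {T : ℕ}

lemma norm_sub_le_diam {x : Fin K → Param d} {s : Set (Fin K)} {i l : Fin K} (hi : i ∈ s)
    (hl : l ∈ s) : ‖x i - x l‖ ≤ Metric.diam (x '' s) := by
  rw [← dist_eq_norm]
  exact Metric.dist_le_diam_of_mem (s.toFinite.image x).isBounded ⟨i, hi, rfl⟩ ⟨l, hl, rfl⟩

/-- The contraction factor of the agreement phase. -/
def contraction (K κ : ℕ) : ℝ := if K = 1 then 0 else 2⁻¹ ^ κ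

lemma contraction_nonneg (K κ : ℕ) : 0 ≤ contraction K κ := by
  unfold contraction; split_ifs <;> positivity

lemma contraction_le (K κ : ℕ) : contraction K κ ≤ 2⁻¹ ^ κ := by
  unfold contraction; split_ifs
  · positivity
  · exact le_rfl

/-- A single agent never disagrees with itself, so for `K = 1` the factor may be taken to be zero.
This matters because `log (NK/p²)` can vanish then, leaving no lower bound for the number of rounds.
-/
lemma norm_sub_le_contraction {κ : ℕ} {x y : Fin K → Param d} {s : Set (Fin K)}
    {r : Set (Fin K)} (h : Metric.diam (y '' s) ≤ Metric.diam (x '' r) / 2 ^ κ)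
    {i l : Fin K} (hi : i ∈ s) (hl : l ∈ s) :
    ‖y i - y l‖ ≤ contraction K κ * Metric.diam (x '' r) := by
  by_cases hK : K = 1
  · subst hK
    simp [Subsingleton.elim i l, contraction]
  · refine (norm_sub_le_diam hi hl).trans (h.trans (le_of_eq ?_))
    rw [contraction, if_neg hK, inv_pow, div_eq_inv_mul]

/-- If honest sets only shrink, the agents tracked after an iteration are those honest in it;
otherwise agreement contracts the local outputs of everyone and all agents are tracked. -/
lemma Run.exists_tracking (run : Run P mdp pol γ est inp agg proto Hon T)
    {α Cra Cavg εbar : ℝ} (hα : 0 ≤ α) (hεbar : 0 < εbar) (hαε : α + εbar < 1 / 4) (hK : 1 ≤ K)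
    (hη : 0 < inp.η) (hCra : 0 ≤ Cra) (hCavg : 0 ≤ Cavg)
    (hcard : ∀ t < T, (1 - α) * K ≤ (Hon t).card) (hagg : RobustAggregator α Cra agg)
    (havg : proto.AveragingAgreement inp.κ α (α + εbar) Cavg)
    (hcase : (∀ t, t + 1 < T → Hon (t + 1) ⊆ Hon t) ∨ proto.CoversAllAgents inp.κ α) :
    ∃ Q : ℕ → Finset (Fin K), run.Tracking α Cra Cavg (contraction K inp.κ) Q ∧
      (1 - (α + εbar)) * K ≤ (Q (T - 1)).card := by
  have hcard' : ∀ t < T, (1 - (α + εbar)) * K ≤ (Hon t).card := fun t ht =>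
    (mul_le_mul_of_nonneg_right (by linarith) (Nat.cast_nonneg K)).trans (hcard t ht)
  have huniv : (1 - (α + εbar)) * K ≤ ((Finset.univ : Finset (Fin K)).card : ℝ) := by
    rw [Finset.card_univ, Fintype.card_fin]
    exact mul_le_of_le_one_left (Nat.cast_nonneg K) (by linarith)
  -- Averaging agreement is used with the full honest set as its distinguished subset.
  have havg' := fun t (ht : t < T) byz x =>
    havg (Hon t) (hcard t ht) byz x (Hon t) subset_rfl (hcard' t ht)
  rcases hcase with hmono | hall
  -- Parameters at time `t + 1` come from the agreement phase of iteration `t`, hence the shift; at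
  -- time `0` all agents coincide.
  · let Q : ℕ → Finset (Fin K) := fun t => Nat.casesOn t Finset.univ Hon
    have hQ : ∀ t, t + 1 < T → Q (t + 1) ⊆ Q t := by
      rintro (_ | t) ht
      · exact Finset.subset_univ _
      · exact hmono t (by omega)
    refine ⟨Q, ⟨hα, by linarith, hK, hCra, hCavg, contraction_nonneg _ _, hη, hcard, hagg,
      ?_, fun t _ => subset_rfl, hQ, ?_, fun t ht byz x => (havg' t ht byz x).2⟩, ?_⟩
    · rintro (_ | t) ht
      · exact Finset.subset_univ _
      · exact hmono t ht
    · exact fun t ht byz x i hi l hl => norm_sub_le_contraction (havg' t ht byz x).1 hi hl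
    · rcases T with _ | _ | t
      · exact huniv
      · exact huniv
      · exact hcard' t (by omega)
  · refine ⟨fun _ => Finset.univ, ⟨hα, by linarith, hK, hCra, hCavg, contraction_nonneg _ _, hη,
      hcard, hagg, fun t _ => Finset.subset_univ _, fun t _ => Finset.subset_univ _,
      fun t _ => subset_rfl, ?_, fun t ht byz x => (havg' t ht byz x).2⟩, huniv⟩
    intro t ht byz x i _ l _
    have h := hall (Hon t) (hcard t ht) byz x
    rw [← Set.image_univ] at h
    exact norm_sub_le_contraction h (Set.mem_univ i) (Set.mem_univ l)

lemma Run.Tracking.subset_of_le {run : Run P mdp pol γ est inp agg proto Hon T}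
    {α Cra Cavg δ : ℝ} {Q : ℕ → Finset (Fin K)} (hT : run.Tracking α Cra Cavg δ Q) {s t : ℕ}
    (hst : s ≤ t) (ht : t < T) : Q t ⊆ Q s := by
  induction t, hst using Nat.le_induction with
  | base => exact subset_rfl
  | succ t _ ih => exact (hT.antitone t ht).trans (ih (by omega))

end RunAnalysis

/-- Logarithmically many agreement rounds make the contraction factor small. -/
lemma contraction_mul_le {K N κ m : ℕ} {p c : ℝ} (hK : 1 ≤ K) (hN : 1 ≤ N) (hp0 : 0 < p)
    (hp1 : p ≤ 1) (hm : 1 ≤ m) (hc : c ≤ 2 ^ m)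
    (hκ : m / Real.log 2 * Real.log (N * K / p ^ 2) ≤ κ) : c * contraction K κ ≤ p ^ 2 := by
  unfold contraction
  split_ifs with h1
  · rw [mul_zero]; positivity
  -- With at least two agents, `NK/p² ≥ 2/p²`, so the logarithm is bounded away from zero and `m`
  -- multiples of it also pay for the constant `2 ^ m`.
  have hK2 : (2 : ℝ) ≤ K := by exact_mod_cast (by omega : 2 ≤ K)
  have hN1 : (1 : ℝ) ≤ N := by exact_mod_cast hN
  have hl : 0 < Real.log 2 := Real.log_pos one_lt_two
  have hx : 2 / p ^ 2 ≤ N * K / p ^ 2 := by gcongr; nlinarith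
  have h2 : Real.log ((2 / p ^ 2) ^ m) ≤ Real.log (2 ^ κ) := by
    rw [Real.log_pow, Real.log_pow]
    have h3 := Real.log_le_log (by positivity) hx
    have h4 : (m : ℝ) * Real.log (2 / p ^ 2) ≤ m * Real.log (N * K / p ^ 2) := by gcongr
    rw [div_mul_eq_mul_div, div_le_iff₀ hl] at hκ
    linarith
  have h3 : (2 / p ^ 2) ^ m ≤ (2 : ℝ) ^ κ :=
    (Real.log_le_log_iff (by positivity) (by positivity)).1 h2
  have hp2 : p ^ 2 ≤ 1 := pow_le_one₀ hp0.le hp1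
  have h4 : (p ^ 2) ^ m ≤ p ^ 2 := pow_le_of_le_one (by positivity) hp2 (by omega)
  have h5 : (2 : ℝ) ^ m ≤ p ^ 2 * 2 ^ κ := by
    rw [div_pow, div_le_iff₀ (by positivity)] at h3
    refine h3.trans ?_
    rw [mul_comm]
    gcongr
  rw [inv_pow, ← div_eq_mul_inv, div_le_iff₀ (by positivity)]
  exact hc.trans h5

end

end DecByzPG

/-! ### Choice of constants and conclusion -/

theorem mainTheorem2
    (Hz : ℕ) (hHz : 1 ≤ Hz) (est : DecByzPG.Estimator Hz)
    (R γ G M σ W Cra Cavg εbar : ℝ)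
    (hR : 0 < R) (hγ0 : 0 < γ) (hγ1 : γ < 1) (hG : 0 < G) (hM : 0 < M) (hσ : 0 < σ) (hW : 0 < W)
    (hCra : 0 < Cra) (hCavg : 0 < Cavg) (hεbar : 0 < εbar) :
    ∃ cA > (0 : ℝ), ∃ cκ > (0 : ℝ), ∃ C > (0 : ℝ), ∃ C' > (0 : ℝ),
      ∀ (S A : Type*) [MeasurableSpace S] [MeasurableSpace A] (d K : ℕ)
        (mdp : DecByzPG.MDP S A R) (pol : DecByzPG.Policy S A d)
        (_ : DecByzPG.Assumptions mdp pol γ est G M σ W)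
        (α : ℝ) (_ : 0 ≤ α) (_ : α + εbar < 1 / 4) (_ : 1 ≤ K)
        (inp : DecByzPG.Input d) (_ : 1 ≤ inp.N) (_ : 1 ≤ inp.B) (_ : 0 < inp.p) (_ : inp.p ≤ 1)
        (Astep : ℝ) (_ : cA * (α / inp.p ^ 2 + 1 / (inp.p * K)) ≤ Astep)
        (_ : inp.η = 1 / 2 * min (1 / √Astep) (1 / DecByzPG.smoothConst Hz R γ G M))
        (_ : cκ * Real.log (inp.N * K / inp.p ^ 2) ≤ inp.κ)
        (agg : (Fin K → DecByzPG.Param d) → DecByzPG.Param d) (_ : Measurable agg)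
        (_ : DecByzPG.RobustAggregator α Cra agg)
        (proto : DecByzPG.Protocol K d) (_ : proto.AveragingAgreement inp.κ α (α + εbar) Cavg)
        (T : ℕ) (_ : 1 ≤ T)
        (Hon : ℕ → Finset (Fin K)) (_ : ∀ t < T, (1 - α) * K ≤ (Hon t).card)
        (_ : (∀ t, t + 1 < T → Hon (t + 1) ⊆ Hon t) ∨ proto.CoversAllAgents inp.κ α)
        (Ω : Type*) [MeasurableSpace Ω] (P : MeasureTheory.Measure Ω)
        [MeasureTheory.IsProbabilityMeasure P]
        (run : DecByzPG.Run P mdp pol γ est inp agg proto Hon T)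
        (That : Ω → ℕ) (_ : Measurable That)
        (_ : ∀ t < T, P {ω | That ω = t} = 1 / (T : ENNReal))
        (_ : ProbabilityTheory.Indep (MeasurableSpace.comap That ⊤) (run.ℱ T) P),
        ∃ 𝒢 : Finset (Fin K), (1 - (α + εbar)) * K ≤ 𝒢.card ∧ ∀ k ∈ 𝒢,
          MeasureTheory.Integrable (fun ω =>
            ‖gradient (DecByzPG.objective mdp pol γ Hz) (run.θ (That ω) k ω)‖ ^ 2) P ∧
          ∫ ω, ‖gradient (DecByzPG.objective mdp pol γ Hz) (run.θ (That ω) k ω)‖ ^ 2 ∂P ≤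
            4 * run.expectedPhi₀ / (inp.η * T)
              + C * σ ^ 2 / inp.N * (α + 1 / K) + C' * (2 : ℝ)⁻¹ ^ inp.κ := by
  have hL : 0 < DecByzPG.smoothConst Hz R γ G M := by
    have h1 : 0 < 1 - γ := by linarith
    unfold DecByzPG.smoothConst
    positivity
  set L := DecByzPG.smoothConst Hz R γ G M
  have hΓ := DecByzPG.changeConst_nonneg est R G M hW.le
  -- From `η ≤ 1/(2L)` one has `η² ≤ 1/(4L²)`, so this bounds the variance constant times `η²`
  -- independently of the input.
  set Γ₀ := DecByzPG.changeConst est R G M W * (1 / (4 * L ^ 2)) with hΓ₀_def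
  have hΓ₀ : 0 ≤ Γ₀ := by positivity
  have hΛ := DecByzPG.one_le_recursionConst (σ := σ) (Cavg := Cavg) hCra.le hΓ hΓ₀
  set Λ := DecByzPG.recursionConst σ Cra Cavg (DecByzPG.changeConst est R G M W) Γ₀ with hΛ_def
  have hΛ0 : 0 < Λ := by linarith
  -- The exponent `m` converts the required smallness of the contraction factor into a multiple of
  -- `log (NK/p²)`.
  obtain ⟨m, hm⟩ := pow_unbounded_of_one_lt (36 * Λ ^ 2) (one_lt_two (α := ℝ))
  have hm1 : 1 ≤ m := by
    rcases m with _ | m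
    · nlinarith
    · omega
  refine ⟨4 * Λ, by positivity, m / Real.log 2,
    div_pos (by exact_mod_cast hm1) (Real.log_pos one_lt_two), 4 * Λ, by positivity, 1, one_pos, ?_⟩
  intro S A _ _ d K mdp pol hA α hα hαε hK inp hN hB hp0 hp1 Astep hAstep hη hκ agg hagg hrob proto
    havg T hT1 Hon hcard hcase Ω _ P _ run That hThat hunif hind
  have hK0 : (0 : ℝ) < K := by exact_mod_cast hK
  have hT0 : (0 : ℝ) < T := by exact_mod_cast hT1
  have hx0 : 0 < α / inp.p ^ 2 + 1 / (inp.p * K) := by positivity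
  have hA0 : 0 < Astep := lt_of_lt_of_le (by positivity) hAstep
  have hη0 : 0 < inp.η := by rw [hη]; positivity
  have hηA : inp.η ^ 2 ≤ 1 / (4 * Astep) := by
    have h1 : inp.η ≤ 1 / 2 * (1 / √Astep) := by
      rw [hη]
      exact mul_le_mul_of_nonneg_left (min_le_left _ _) (by norm_num)
    refine (pow_le_pow_left₀ hη0.le h1 2).trans (le_of_eq ?_)
    rw [mul_pow, div_pow, div_pow, Real.sq_sqrt hA0.le]
    field_simp
    norm_num
  have hηL' : inp.η ≤ 1 / 2 * (1 / L) := by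
    rw [hη]
    exact mul_le_mul_of_nonneg_left (min_le_right _ _) (by norm_num)
  have hηL : inp.η * L ≤ 1 / 2 := by
    refine (mul_le_mul_of_nonneg_right hηL' hL.le).trans (le_of_eq ?_)
    field_simp
  have hΓη : DecByzPG.changeConst est R G M W * inp.η ^ 2 ≤ Γ₀ := by
    refine mul_le_mul_of_nonneg_left ((pow_le_pow_left₀ hη0.le hηL' 2).trans (le_of_eq ?_)) hΓ
    field_simp
    norm_num
  -- Here `cA = 4Λ` is used: `η² ≤ 1/(4A)` and `α/p² + 1/(pK) ≤ A/(4Λ)` multiply to exactly `p/16`.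
  have hy : Λ * ((α / inp.p + 1 / K) * inp.η ^ 2) ≤ inp.p / 16 := by
    have h1 : α / inp.p + 1 / K = inp.p * (α / inp.p ^ 2 + 1 / (inp.p * K)) := by field_simp
    rw [h1]
    have h2 : (α / inp.p ^ 2 + 1 / (inp.p * K)) ≤ Astep / (4 * Λ) := by
      rw [le_div_iff₀ (by positivity)]; linarith
    calc Λ * (inp.p * (α / inp.p ^ 2 + 1 / (inp.p * K)) * inp.η ^ 2)
        ≤ Λ * (inp.p * (Astep / (4 * Λ)) * (1 / (4 * Astep))) := by gcongr
      _ = inp.p / 16 := by field_simp; norm_num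
  obtain ⟨Q, hTr, hQ⟩ := run.exists_tracking hα hεbar hαε hK hη0 hCra.le hCavg.le hcard hrob havg
    hcase
  have hδ : 36 * Λ ^ 2 * DecByzPG.contraction K inp.κ ≤ inp.p ^ 2 :=
    DecByzPG.contraction_mul_le hK hN hp0 hp1 hm1 hm.le hκ
  refine ⟨Q (T - 1), hQ, fun k hk => ?_⟩
  -- The tracked sets decrease, so an agent tracked at the last possible output time `T - 1` is
  -- tracked at all of them.
  have hkQ : ∀ t < T, k ∈ Q t := fun t ht => hTr.subset_of_le (by omega) (by omega) hk
  have hsum := hTr.sum_integral_gradient_sq_le hA hG.le hM.le hR.le hγ0.le hγ1 hηL hN hB hp0 hp1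
    hW.le hΓη hΓ₀ hT1 hy hδ hkQ
  have hJ := hA.smoothPolicy.measurable_gradient_objective (Hz := Hz) mdp hG.le hR.le hγ0.le hγ1
  obtain ⟨hi, he⟩ := DecByzPG.integral_uniform_time hT1 hThat hunif hind
    (f := fun t ω => ‖gradient (DecByzPG.objective mdp pol γ Hz) (run.θ t k ω)‖ ^ 2)
    (fun t ht => by
      have h1 : @Measurable Ω (DecByzPG.Param d) (run.ℱ T) _ (run.θ t k) :=
        (run.measurable_θ t ht.le k).mono (run.ℱ.mono ht.le) le_rfl
      exact (hJ.norm.pow_const 2).comp h1)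
    (fun t ht => DecByzPG.Run.Tracking.integrable_gradient_sq hA hG.le hR.le hγ0.le hγ1
      (run.measurable_θ' ht.le k))
  refine ⟨hi, he.le.trans ?_⟩
  -- The argument yields the bound with the optimality gap alone; the norm term of `Φ₀` is
  -- nonnegative and only weakens it. If that term is not integrable, its integral is zero by
  -- convention.
  have hΦ : (⨆ θ, DecByzPG.objective mdp pol γ Hz θ) - DecByzPG.objective mdp pol γ Hz inp.θ₀ ≤
      run.expectedPhi₀ :=
    le_add_of_nonneg_right (mul_nonneg (by positivity)
      (MeasureTheory.integral_nonneg fun _ => sq_nonneg _))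
  have hcon := DecByzPG.contraction_le K inp.κ
  have hcon0 := DecByzPG.contraction_nonneg K inp.κ
  calc (T : ℝ)⁻¹ * ∑ t ∈ Finset.range T, ∫ ω,
        ‖gradient (DecByzPG.objective mdp pol γ Hz) (run.θ t k ω)‖ ^ 2 ∂P
      ≤ (T : ℝ)⁻¹ * (4 * run.expectedPhi₀ / inp.η + T * (4 * Λ * (σ ^ 2 / inp.N * (α + 1 / K)) +
          DecByzPG.contraction K inp.κ / 2)) := by
        refine mul_le_mul_of_nonneg_left (hsum.trans (add_le_add ?_ le_rfl)) (by positivity)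
        gcongr
    _ = 4 * run.expectedPhi₀ / (inp.η * T) + 4 * Λ * σ ^ 2 / inp.N * (α + 1 / K) +
          DecByzPG.contraction K inp.κ / 2 := by
        field_simp
        ring
    _ ≤ _ := by
        rw [one_mul]
        linarith
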